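/- Let $\mathbf{k}$ be a field of characteristic zero and $V$ a finite-dimensional $\mathbf{k}$-vector space. Definitions. A wheelspace is a sequence of vector spaces $W(m)$, $m\ge 0$, with actions of $S_m\times S_m$ (permuting $m$ inputs and $m$ outputs) and contractions $\mu_{i,j}\colon W(m)\to W(m-1)$ (joining the $i$-th output to the $j$-th input) that are equivariant and commute with each other in the evident sense. A wheelgebra is a wheelspace with a unital associative product $W(m)\otimes W(n)\to W(m+n)$ that is equivariant and commutes with contractions inside each factor. Commutative, almost commutative (exhaustively filtered by sub-wheelspaces, with commutative associated graded) and Poisson wheelgebras are defined with respect to the symmetry $ab\mapsto (12)^{m,n}ab$. A BV wheelgebra is a $\mathbb{Z}$-graded supercommutative wheelgebra with an endomorphism $\Delta$ of the underlying wheelspace that has degree $-1$, satisfies $\Delta^2=0$, and is a differential operator of order at most two, i.e. $\Delta(ab)-\Delta(a)b-(-1)^{|a|}a\Delta(b)$ is a derivation of degree $|a|-1$ in $b$. BV algebras are defined in the same way, without wheels. A wheeled unit of $W$ is an element $t\in W(1)$ such that joining the output of $t$ to the first input of any $a\in W(m)$, $m\geq 1$, or the input of $t$ to the first output of $a$, gives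 $a$ back. Let $\mathrm{WEnd}(V)=\bigoplus_m \mathrm{End}(V)^{\otimes m}=\bigoplus_m V^{\otimes m}\otimes (V^*)^{\otimes m}$, with contractions given by the trace pairings; for an associative algebra $B$, $B\otimes \mathrm{WEnd}(V)$ is again a wheelgebra. Theorem. Let $W$ be a wheelgebra and let $U\subseteq W(1)$ be a set of wheeled units of $W$ ($U=\emptyset$ is allowed). Call a morphism of wheelgebras $\rho\colon W\to B\otimes\mathrm{WEnd}(V)$ a representation if $\rho(t)=1\otimes \mathrm{Id}_V$ for all $t\in U$. (1) There is an associative algebra $\mathrm{RA}_V(W)$ with a representation $\mathsf{ev}\colon W\to \mathrm{RA}_V(W)\otimes \mathrm{WEnd}(V)$ such that every representation $\rho\colon W\to B\otimes \mathrm{WEnd}(V)$, for any associative algebra $B$, equals $(\phi\otimes \mathrm{Id})\circ\mathsf{ev}$ for a unique algebra morphism $\phi\colon \mathrm{RA}_V(W)\to B$. (2) There is a unique action of $\mathrm{GL}(V)$ on $\mathrm{RA}_V(W)$ by algebra automorphisms such that the image of $\mathsf{ev}$ consists of invariants for the action on $\mathrm{RA}_V(W)\otimes\mathrm{WEnd}(V)$,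 where $\mathrm{GL}(V)$ acts diagonally on $\mathrm{End}(V)^{\otimes m}$. If $U\neq\emptyset$, the image of $\mathsf{ev}$ is exactly $(\mathrm{RA}_V(W)\otimes\mathrm{WEnd}(V))^{\mathrm{GL}(V)}$. In every case, these invariants are the sub-wheelgebra generated by the image of $\mathsf{ev}$ and $1\otimes \mathrm{Id}_V$. (3) If $W$ is commutative, so is $\mathrm{RA}_V(W)$. If $W$ is almost commutative with filtration $W_{\le i}$, there is a smallest family of subspaces $F_i$ of $\mathrm{RA}_V(W)$ with $\mathsf{ev}(W_{\leq i})\subseteq F_i\otimes\mathrm{WEnd}(V)$ for all $i$, and it makes $\mathrm{RA}_V(W)$ an almost commutative algebra. If $W$ is Poisson, $\mathrm{RA}_V(W)$ is commutative and has a unique Poisson bracket such that $\mathsf{ev}$ preserves brackets, where $\{b\otimes T,b'\otimes T'\}=\{b,b'\}\otimes TT'$. If $W$ is BV, there are a unique grading and a unique operator $\Delta$ on $\mathrm{RA}_V(W)$ that make it a BV algebra such that $\mathsf{ev}$ preserves degrees and $\mathsf{ev}\circ\Delta=(\Delta\otimes \mathrm{Id})\circ\mathsf{ev}$. -/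

import Mathlib

open scoped TensorProduct

universe u v w x y

/-! ### Block permutations -/

/-- The bijection `σ ⊕ σ'` on consecutive blocks of sizes `m`, `n`. -/
def blockSum {m n m' n' : ℕ} (σ : Fin m ≃ Fin m') (σ' : Fin n ≃ Fin n') :
    Fin (m + n) ≃ Fin (m' + n') :=
  finSumFinEquiv.symm.trans ((Equiv.sumCongr σ σ').trans finSumFinEquiv)

/-- Exchange of the first two of three consecutive blocks, of sizes `n`, `m`, `p`. -/
def blockSwap (n m p : ℕ) : Fin (n + (m + p)) ≃ Fin (m + (n + p)) :=
  (finCongr (Nat.add_assoc n m p).symm).trans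
    ((blockSum (finAddFlip : Fin (n + m) ≃ Fin (m + n)) (Equiv.refl (Fin p))).trans
      (finCongr (Nat.add_assoc m n p)))

/-- Cyclic rotation of three consecutive blocks, of sizes `m`, `n`, `p`: the first block is moved
to the end. -/
def blockRotate (m n p : ℕ) : Fin (m + n + p) ≃ Fin (n + p + m) :=
  (finCongr (Nat.add_assoc m n p)).trans finAddFlip

/-! ### Wheelspaces -/

/-- A wheelspace. The element `w : W m` has `m` inputs and `m` outputs. For `σ τ : Fin m ≃ Fin n`
(so that `m = n`), `act σ τ` moves the input at position `a` to position `σ a` and the output at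
position `a` to position `τ a`; for `m = n` this is the action of `S_m × S_m` on `W m`, and
allowing `m` and `n` to be different expressions for the same number only spares us the
identifications `W (m + n) = W (n + m)` and so on. The map `contr i j` joins the `i`-th output to
the `j`-th input; the remaining legs are renumbered preserving their order. -/
class Wheelspace (k : Type u) [Field k] (W : ℕ → Type w)
    [∀ m, AddCommGroup (W m)] [∀ m, Module k (W m)] where
  act : ∀ {m n : ℕ}, (Fin m ≃ Fin n) → (Fin m ≃ Fin n) → W m →ₗ[k] W n
  act_refl : ∀ {m : ℕ} (a : W m), act (Equiv.refl (Fin m)) (Equiv.refl (Fin m)) a = a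
  act_trans : ∀ {l m n : ℕ} (σ τ : Fin l ≃ Fin m) (σ' τ' : Fin m ≃ Fin n) (a : W l),
    act σ' τ' (act σ τ a) = act (σ.trans σ') (τ.trans τ') a
  contr : ∀ {m : ℕ}, Fin (m + 1) → Fin (m + 1) → W (m + 1) →ₗ[k] W m
  /-- Equivariance of contractions: if `σ j = j'` and `σ` induces `σ'` on the complements of `j`
  and `j'`, and likewise for `τ`, `i`, `i'`, `τ'`, then contracting after relabelling by `σ`, `τ`
  is the same as relabelling by `σ'`, `τ'` after contracting. -/
  contr_act : ∀ {m n : ℕ} (σ τ : Fin (m + 1) ≃ Fin (n + 1)) (σ' τ' : Fin m ≃ Fin n)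
    (i j : Fin (m + 1)),
    (∀ a, σ (j.succAbove a) = (σ j).succAbove (σ' a)) →
    (∀ a, τ (i.succAbove a) = (τ i).succAbove (τ' a)) →
    ∀ a : W (m + 1), contr (τ i) (σ j) (act σ τ a) = act σ' τ' (contr i j a)
  /-- Two contractions commute: `k.succAbove i` is the position of the leg `i` before the leg `k`
  is removed, and `i.predAbove k` is the position of the leg `k` after that leg is removed. -/
  contr_contr : ∀ {m : ℕ} (i j : Fin (m + 1)) (p q : Fin (m + 2)) (a : W (m + 2)),
    contr i j (contr p q a) =
      contr (i.predAbove p) (j.predAbove q) (contr (p.succAbove i) (q.succAbove j) a)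

section Basic

variable (k : Type u) [Field k] {W : ℕ → Type w}
  [∀ m, AddCommGroup (W m)] [∀ m, Module k (W m)]

/-- The identification `W m = W n` for `m = n`. -/
def recast [Wheelspace k W] {m n : ℕ} (h : m = n) : W m →ₗ[k] W n :=
  Wheelspace.act (finCongr h) (finCongr h)

/-- A family of bilinear operations `W m × W n → W (m + n)` is a morphism of wheelspaces
`W ⊗ W → W`: it is equivariant and commutes with the contractions inside each argument. -/
structure IsWheelBilinear [Wheelspace k W]
    (f : ∀ m n : ℕ, W m →ₗ[k] W n →ₗ[k] W (m + n)) : Prop where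
  map_act : ∀ {m n m' n' : ℕ} (σ τ : Fin m ≃ Fin m') (σ' τ' : Fin n ≃ Fin n') (a : W m) (b : W n),
    f m' n' (Wheelspace.act (k := k) σ τ a) (Wheelspace.act (k := k) σ' τ' b) =
      Wheelspace.act (k := k) (blockSum σ σ') (blockSum τ τ') (f m n a b)
  map_contr_left : ∀ {m n : ℕ} (i j : Fin (m + 1)) (a : W (m + 1)) (b : W n),
    f m n (Wheelspace.contr (k := k) i j a) b =
      Wheelspace.contr (k := k) (Fin.cast (Nat.succ_add m n) (Fin.castAdd n i))
        (Fin.cast (Nat.succ_add m n) (Fin.castAdd n j))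
        (recast k (Nat.succ_add m n) (f (m + 1) n a b))
  map_contr_right : ∀ {m n : ℕ} (i j : Fin (n + 1)) (a : W m) (b : W (n + 1)),
    f m n a (Wheelspace.contr (k := k) i j b) =
      Wheelspace.contr (k := k) (m := m + n) (Fin.natAdd m i) (Fin.natAdd m j) (f m (n + 1) a b)

end Basic

/-! ### Associative wheelgebras -/

/-- An associative wheelgebra: a (unital) associative algebra in wheelspaces. -/
class Wheelgebra (k : Type u) [Field k] (W : ℕ → Type w)
    [∀ m, AddCommGroup (W m)] [∀ m, Module k (W m)] extends Wheelspace k W where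
  mul : ∀ {m n : ℕ}, W m →ₗ[k] W n →ₗ[k] W (m + n)
  isWheelBilinear_mul : IsWheelBilinear k (fun m n => mul (m := m) (n := n))
  one : W 0
  one_mul : ∀ {m : ℕ} (a : W m), recast k (Nat.zero_add m) (mul one a) = a
  mul_one : ∀ {m : ℕ} (a : W m), mul a one = a
  mul_assoc : ∀ {m n p : ℕ} (a : W m) (b : W n) (c : W p),
    recast k (Nat.add_assoc m n p) (mul (mul a b) c) = mul a (mul b c)

open Wheelspace Wheelgebra

/-- Morphisms of associative wheelgebras. -/
structure WheelgebraHom (k : Type u) [Field k] (W : ℕ → Type v) (W' : ℕ → Type w)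
    [∀ m, AddCommGroup (W m)] [∀ m, Module k (W m)] [Wheelgebra k W]
    [∀ m, AddCommGroup (W' m)] [∀ m, Module k (W' m)] [Wheelgebra k W'] where
  app : ∀ m : ℕ, W m →ₗ[k] W' m
  map_act : ∀ {m n : ℕ} (σ τ : Fin m ≃ Fin n) (a : W m),
    app n (act (k := k) σ τ a) = act (k := k) σ τ (app m a)
  map_contr : ∀ {m : ℕ} (i j : Fin (m + 1)) (a : W (m + 1)),
    app m (contr (k := k) i j a) = contr (k := k) i j (app (m + 1) a)
  map_one : app 0 (one k) = one k
  map_mul : ∀ {m n : ℕ} (a : W m) (b : W n),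
    app (m + n) (mul (k := k) a b) = mul (k := k) (app m a) (app n b)

section Structures

variable (k : Type u) [Field k] {W : ℕ → Type w}
  [∀ m, AddCommGroup (W m)] [∀ m, Module k (W m)] [Wheelgebra k W]

/-- `t` is a wheeled unit: joining the output of `t` to the first input of any `a`, or the input
of `t` to the first output of `a`, gives `a` back. (By equivariance the same then holds, up to the
evident renumbering of legs, for every other input or output of `a`.) -/
def IsWheelUnit (t : W 1) : Prop :=
  ∀ {m : ℕ} (a : W (m + 1)),
    contr (k := k) (m := 1 + m) (Fin.castAdd (m + 1) 0) (Fin.natAdd 1 (0 : Fin (m + 1))) (mul (k := k) t a) =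
        recast k (Nat.add_comm m 1) a ∧
      contr (k := k) (m := 1 + m) (Fin.natAdd 1 (0 : Fin (m + 1))) (Fin.castAdd (m + 1) 0) (mul (k := k) t a) =
        recast k (Nat.add_comm m 1) a

/-- The sub-wheelgebra generated by a family of elements. -/
inductive WheelGenerated (S : ∀ m, Set (W m)) : ∀ m, W m → Prop
  | mem {m : ℕ} {a : W m} : a ∈ S m → WheelGenerated S m a
  | zero {m : ℕ} : WheelGenerated S m 0
  | add {m : ℕ} {a b : W m} :
      WheelGenerated S m a → WheelGenerated S m b → WheelGenerated S m (a + b)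
  | smul {m : ℕ} {a : W m} (c : k) : WheelGenerated S m a → WheelGenerated S m (c • a)
  | act {m n : ℕ} {a : W m} (σ τ : Fin m ≃ Fin n) :
      WheelGenerated S m a → WheelGenerated S n (Wheelspace.act (k := k) σ τ a)
  | contr {m : ℕ} {a : W (m + 1)} (i j : Fin (m + 1)) :
      WheelGenerated S (m + 1) a → WheelGenerated S m (Wheelspace.contr (k := k) i j a)
  | one : WheelGenerated S 0 (Wheelgebra.one k)
  | mul {m n : ℕ} {a : W m} {b : W n} :
      WheelGenerated S m a → WheelGenerated S n b →
        WheelGenerated S (m + n) (Wheelgebra.mul (k := k) a b)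

variable (W) in
/-- The wheelgebra `W` is commutative, that is, twisted-commutative. -/
def IsCommWheelgebra : Prop :=
  ∀ {m n : ℕ} (a : W m) (b : W n),
    mul (k := k) b a = act (k := k) finAddFlip finAddFlip (mul (k := k) a b)

/-- `F 0 ⊆ F 1 ⊆ ...` is an exhaustive filtration of the wheelgebra `W` by sub-wheelspaces, which
is multiplicative and has a (twisted-)commutative associated graded wheelgebra. -/
structure IsAlmostCommWheelgebra (F : ℕ → ∀ m, Submodule k (W m)) : Prop where
  mono : ∀ {i j : ℕ}, i ≤ j → ∀ m, F i m ≤ F j m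
  exhaustive : ∀ {m : ℕ} (a : W m), ∃ i, a ∈ F i m
  act_mem : ∀ {i m n : ℕ} (σ τ : Fin m ≃ Fin n) {a : W m},
    a ∈ F i m → act (k := k) σ τ a ∈ F i n
  contr_mem : ∀ {l m : ℕ} (i j : Fin (m + 1)) {a : W (m + 1)},
    a ∈ F l (m + 1) → contr (k := k) i j a ∈ F l m
  one_mem : one k ∈ F 0 0
  mul_mem : ∀ {i j m n : ℕ} {a : W m} {b : W n},
    a ∈ F i m → b ∈ F j n → mul (k := k) a b ∈ F (i + j) (m + n)
  comm_zero : ∀ {m n : ℕ} {a : W m} {b : W n}, a ∈ F 0 m → b ∈ F 0 n →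
    mul (k := k) b a - act (k := k) finAddFlip finAddFlip (mul (k := k) a b) = 0
  comm_succ : ∀ {i j l m n : ℕ} {a : W m} {b : W n}, i + j = l + 1 → a ∈ F i m → b ∈ F j n →
    mul (k := k) b a - act (k := k) finAddFlip finAddFlip (mul (k := k) a b) ∈ F l (n + m)

/-- `br` makes `W` a Poisson wheelgebra. -/
structure IsPoissonWheelgebra (br : ∀ m n : ℕ, W m →ₗ[k] W n →ₗ[k] W (m + n)) : Prop where
  comm : IsCommWheelgebra k W
  isWheelBilinear : IsWheelBilinear k br
  skew : ∀ {m n : ℕ} (a : W m) (b : W n),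
    br n m b a = -act (k := k) finAddFlip finAddFlip (br m n a b)
  jacobi : ∀ {m n p : ℕ} (a : W m) (b : W n) (c : W p),
    br (m + n) p (br m n a b) c
      + act (k := k) (blockRotate p m n) (blockRotate p m n) (br (p + m) n (br p m c a) b)
      + act (k := k) (blockRotate m n p).symm (blockRotate m n p).symm
          (br (n + p) m (br n p b c) a) = 0
  leibniz : ∀ {m n p : ℕ} (a : W m) (b : W n) (c : W p),
    br m (n + p) a (mul (k := k) b c) =
      recast k (Nat.add_assoc m n p) (mul (k := k) (br m n a b) c)
        + act (k := k) (blockSwap n m p) (blockSwap n m p) (mul (k := k) b (br m p a c))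

/-- For `a` of degree `d`, the deviation of `Δ` from being a graded derivation,
`Δ(ab) - Δ(a) b - (-1)^d a Δ(b)`; up to the sign `(-1)^(d+1)` this is the bracket
`{a, b}` generated by `Δ`. -/
def wheelBracketOf (Δ : ∀ m, W m →ₗ[k] W m) (d : ℤ) {m n : ℕ} (a : W m) (b : W n) : W (m + n) :=
  Δ (m + n) (mul (k := k) a b) - mul (k := k) (Δ m a) b
    - d.negOnePow • mul (k := k) a (Δ n b)

/-- The `ℤ`-grading `𝒢` and the operator `Δ` make `W` a BV wheelgebra: `W` is a graded wheelgebra,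
it is supercommutative (with the signed twisted braiding), and `Δ` is an endomorphism of the
wheelspace `W` of degree `-1`, with `Δ ∘ Δ = 0`, which is a differential operator of order at most
two: `Δ(ab) - Δ(a) b - (-1)^|a| a Δ(b)` is, in `b`, a derivation of degree `|a| - 1`. -/
structure IsBVWheelgebra (𝒢 : ℤ → ∀ m, Submodule k (W m)) (Δ : ∀ m, W m →ₗ[k] W m) : Prop where
  isInternal : ∀ m, DirectSum.IsInternal (fun d => 𝒢 d m)
  act_mem : ∀ {d : ℤ} {m n : ℕ} (σ τ : Fin m ≃ Fin n) {a : W m},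
    a ∈ 𝒢 d m → act (k := k) σ τ a ∈ 𝒢 d n
  contr_mem : ∀ {d : ℤ} {m : ℕ} (i j : Fin (m + 1)) {a : W (m + 1)},
    a ∈ 𝒢 d (m + 1) → contr (k := k) i j a ∈ 𝒢 d m
  one_mem : one k ∈ 𝒢 0 0
  mul_mem : ∀ {d e : ℤ} {m n : ℕ} {a : W m} {b : W n},
    a ∈ 𝒢 d m → b ∈ 𝒢 e n → mul (k := k) a b ∈ 𝒢 (d + e) (m + n)
  supercomm : ∀ {d e : ℤ} {m n : ℕ} {a : W m} {b : W n}, a ∈ 𝒢 d m → b ∈ 𝒢 e n →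
    mul (k := k) b a =
      (d * e).negOnePow • act (k := k) finAddFlip finAddFlip (mul (k := k) a b)
  map_act : ∀ {m n : ℕ} (σ τ : Fin m ≃ Fin n) (a : W m),
    Δ n (act (k := k) σ τ a) = act (k := k) σ τ (Δ m a)
  map_contr : ∀ {m : ℕ} (i j : Fin (m + 1)) (a : W (m + 1)),
    Δ m (contr (k := k) i j a) = contr (k := k) i j (Δ (m + 1) a)
  degree : ∀ {d : ℤ} {m : ℕ} {a : W m}, a ∈ 𝒢 d m → Δ m a ∈ 𝒢 (d - 1) m
  square_zero : ∀ {m : ℕ} (a : W m), Δ m (Δ m a) = 0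
  second_order : ∀ {d e : ℤ} {m n p : ℕ} {a : W m} {b : W n} (c : W p), a ∈ 𝒢 d m → b ∈ 𝒢 e n →
    wheelBracketOf k Δ d a (mul (k := k) b c) =
      recast k (Nat.add_assoc m n p) (mul (k := k) (wheelBracketOf k Δ d a b) c)
        + ((d - 1) * e).negOnePow • act (k := k) (blockSwap n m p) (blockSwap n m p)
            (mul (k := k) b (wheelBracketOf k Δ d a c))

end Structures

/-! ### The corresponding structures on ordinary algebras -/

section Algebras

variable (k : Type u) [Field k] {R : Type w} [Ring R] [Algebra k R]

/-- `F 0 ⊆ F 1 ⊆ ...` is an exhaustive multiplicative filtration of the algebra `R` whose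
associated graded algebra is commutative. -/
structure IsAlmostCommAlgebra (F : ℕ → Submodule k R) : Prop where
  mono : ∀ {i j : ℕ}, i ≤ j → F i ≤ F j
  exhaustive : ∀ a : R, ∃ i, a ∈ F i
  one_mem : (1 : R) ∈ F 0
  mul_mem : ∀ {i j : ℕ} {a b : R}, a ∈ F i → b ∈ F j → a * b ∈ F (i + j)
  comm_zero : ∀ {a b : R}, a ∈ F 0 → b ∈ F 0 → b * a - a * b = 0
  comm_succ : ∀ {i j l : ℕ} {a b : R}, i + j = l + 1 → a ∈ F i → b ∈ F j → b * a - a * b ∈ F l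

/-- `br` makes `R` a (commutative) Poisson algebra. -/
structure IsPoissonAlgebra (br : R →ₗ[k] R →ₗ[k] R) : Prop where
  comm : ∀ a b : R, a * b = b * a
  skew : ∀ a b : R, br b a = -br a b
  jacobi : ∀ a b c : R, br (br a b) c + br (br c a) b + br (br b c) a = 0
  leibniz : ∀ a b c : R, br a (b * c) = br a b * c + b * br a c

/-- For `a` of degree `d`, the deviation of `Δ` from being a graded derivation. -/
def bracketOf (Δ : R →ₗ[k] R) (d : ℤ) (a b : R) : R :=
  Δ (a * b) - Δ a * b - d.negOnePow • (a * Δ b)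

/-- The `ℤ`-grading `𝒢` and the operator `Δ` (of degree `-1`) make `R` a BV algebra. -/
structure IsBVAlgebra (𝒢 : ℤ → Submodule k R) (Δ : R →ₗ[k] R) : Prop where
  isInternal : DirectSum.IsInternal 𝒢
  one_mem : (1 : R) ∈ 𝒢 0
  mul_mem : ∀ {d e : ℤ} {a b : R}, a ∈ 𝒢 d → b ∈ 𝒢 e → a * b ∈ 𝒢 (d + e)
  supercomm : ∀ {d e : ℤ} {a b : R}, a ∈ 𝒢 d → b ∈ 𝒢 e → b * a = (d * e).negOnePow • (a * b)
  degree : ∀ {d : ℤ} {a : R}, a ∈ 𝒢 d → Δ a ∈ 𝒢 (d - 1)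
  square_zero : ∀ a : R, Δ (Δ a) = 0
  second_order : ∀ {d e : ℤ} {a b : R} (c : R), a ∈ 𝒢 d → b ∈ 𝒢 e →
    bracketOf k Δ d a (b * c) =
      bracketOf k Δ d a b * c + ((d - 1) * e).negOnePow • (b * bracketOf k Δ d a c)

end Algebras

/-! ### The endomorphism wheelgebra -/

section TensorPowers

variable (k : Type u) [Field k] (V : Type v) [AddCommGroup V] [Module k V]

/-- Splitting off the `j`-th factor of a tensor power. -/
noncomputable def tensorSplit {m : ℕ} (j : Fin (m + 1)) :
    (⨂[k] _ : Fin (m + 1), V) →ₗ[k] V ⊗[k] (⨂[k] _ : Fin m, V) :=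
  PiTensorProduct.lift
    { toFun := fun f => f j ⊗ₜ[k] PiTensorProduct.tprod k (j.removeNth f)
      map_update_add' := by
        intro hd f i x y
        obtain rfl : hd = instDecidableEqFin (m + 1) := Subsingleton.elim _ _
        rcases Fin.eq_self_or_eq_succAbove j i with rfl | ⟨a, rfl⟩
        · simp [TensorProduct.add_tmul]
        · simp [Fin.removeNth_update_succAbove, TensorProduct.tmul_add, Fin.ne_succAbove]
      map_update_smul' := by
        intro hd f i c x
        obtain rfl : hd = instDecidableEqFin (m + 1) := Subsingleton.elim _ _
        rcases Fin.eq_self_or_eq_succAbove j i with rfl | ⟨a, rfl⟩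
        · simp [TensorProduct.smul_tmul]
        · simp [Fin.removeNth_update_succAbove, Fin.ne_succAbove] }

@[simp] theorem tensorSplit_tprod {m : ℕ} (j : Fin (m + 1)) (f : Fin (m + 1) → V) :
    tensorSplit k V j (PiTensorProduct.tprod k f) =
      f j ⊗ₜ[k] PiTensorProduct.tprod k (j.removeNth f) := by
  simp [tensorSplit]

/-- The trace pairing of the `i`-th factor `V^*` with the `j`-th factor `V`. -/
noncomputable def tensorTrace {m : ℕ} (i j : Fin (m + 1)) :
    (⨂[k] _ : Fin (m + 1), V) ⊗[k] (⨂[k] _ : Fin (m + 1), Module.Dual k V) →ₗ[k]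
      (⨂[k] _ : Fin m, V) ⊗[k] (⨂[k] _ : Fin m, Module.Dual k V) :=
  (TensorProduct.lid k _).toLinearMap ∘ₗ
    TensorProduct.map (contractRight k V) LinearMap.id ∘ₗ
      (TensorProduct.tensorTensorTensorComm k _ _ _ _).toLinearMap ∘ₗ
        TensorProduct.map (tensorSplit k V j) (tensorSplit k (Module.Dual k V) i)

theorem tensorTrace_tprod {m : ℕ} (i j : Fin (m + 1)) (f : Fin (m + 1) → V)
    (g : Fin (m + 1) → Module.Dual k V) :
    tensorTrace k V i j (PiTensorProduct.tprod k f ⊗ₜ[k] PiTensorProduct.tprod k g) =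
      g i (f j) • (PiTensorProduct.tprod k (j.removeNth f) ⊗ₜ[k]
        PiTensorProduct.tprod k (i.removeNth g)) := by
  simp [tensorTrace]

/-- Concatenation of tensors. -/
noncomputable def tensorAppend {m n : ℕ} :
    (⨂[k] _ : Fin m, V) →ₗ[k] (⨂[k] _ : Fin n, V) →ₗ[k] (⨂[k] _ : Fin (m + n), V) :=
  (TensorProduct.mk k _ _).compr₂
    (TensorPower.mulEquiv : (⨂[k]^m V) ⊗[k] (⨂[k]^n V) ≃ₗ[k] (⨂[k]^(m + n) V)).toLinearMap

@[simp] theorem tensorAppend_tprod {m n : ℕ} (f : Fin m → V) (g : Fin n → V) :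
    tensorAppend k V (PiTensorProduct.tprod k f) (PiTensorProduct.tprod k g) =
      PiTensorProduct.tprod k (Fin.append f g) :=
  TensorPower.tprod_mul_tprod k f g

/-- Degree `m` of the endomorphism wheelgebra of `V`, that is `End(V)^{⊗ m}`, written as
`V^{⊗ m} ⊗ (V^*)^{⊗ m}`. The factors `V` are the inputs, the factors `V^*` the outputs. -/
def WEnd (m : ℕ) : Type (max u v) :=
  (⨂[k] _ : Fin m, V) ⊗[k] (⨂[k] _ : Fin m, Module.Dual k V)

noncomputable instance (m : ℕ) : AddCommGroup (WEnd k V m) :=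
  inferInstanceAs (AddCommGroup ((⨂[k] _ : Fin m, V) ⊗[k] (⨂[k] _ : Fin m, Module.Dual k V)))

noncomputable instance (m : ℕ) : Module k (WEnd k V m) :=
  inferInstanceAs (Module k ((⨂[k] _ : Fin m, V) ⊗[k] (⨂[k] _ : Fin m, Module.Dual k V)))

namespace WEnd

/-- The pure tensor `v_1 ⊗ ... ⊗ v_m ⊗ f_1 ⊗ ... ⊗ f_m`. -/
noncomputable def pure {m : ℕ} (f : Fin m → V) (g : Fin m → Module.Dual k V) : WEnd k V m :=
  PiTensorProduct.tprod k f ⊗ₜ[k] PiTensorProduct.tprod k g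

variable {k V} in
theorem induction {m : ℕ} {P : WEnd k V m → Prop} (hp : ∀ f g, P (pure k V f g))
    (hs : ∀ (c : k) a, P a → P (c • a)) (ha : ∀ a b, P a → P b → P (a + b)) (a : WEnd k V m) :
    P a := by
  have h0 : P 0 := by simpa using hs 0 _ (hp 0 0)
  refine TensorProduct.induction_on (motive := P) a h0 ?_ ha
  intro s t
  refine PiTensorProduct.induction_on
    (motive := fun s : ⨂[k] _ : Fin m, V => P (s ⊗ₜ[k] t : _ ⊗[k] _)) s ?_ ?_
  · intro r f
    refine PiTensorProduct.induction_on
      (motive := fun t : ⨂[k] _ : Fin m, Module.Dual k V =>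
        P ((r • PiTensorProduct.tprod k f) ⊗ₜ[k] t : _ ⊗[k] _)) t ?_ ?_
    · intro r' g
      have h := hs (r * r') _ (hp f g)
      have e : ((r • PiTensorProduct.tprod k f) ⊗ₜ[k] (r' • PiTensorProduct.tprod k g) :
          (⨂[k] _ : Fin m, V) ⊗[k] (⨂[k] _ : Fin m, Module.Dual k V)) =
          (r * r') • (PiTensorProduct.tprod k f ⊗ₜ[k] PiTensorProduct.tprod k g) := by
        rw [TensorProduct.smul_tmul_smul]
      rw [e]
      exact h
    · intro x y hx hy
      rw [TensorProduct.tmul_add]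
      exact ha _ _ hx hy
  · intro x y hx hy
    rw [TensorProduct.add_tmul]
    exact ha _ _ hx hy

/-- Permutation of the factors `V` by `σ` and of the factors `V^*` by `τ`. -/
noncomputable def perm {m n : ℕ} (σ τ : Fin m ≃ Fin n) : WEnd k V m →ₗ[k] WEnd k V n :=
  TensorProduct.map (PiTensorProduct.reindex k (fun _ => V) σ).toLinearMap
    (PiTensorProduct.reindex k (fun _ => Module.Dual k V) τ).toLinearMap

/-- The trace pairing of the `i`-th factor `V^*` with the `j`-th factor `V`. -/
noncomputable def trace {m : ℕ} (i j : Fin (m + 1)) : WEnd k V (m + 1) →ₗ[k] WEnd k V m :=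
  tensorTrace k V i j

/-- The product `End(V)^{⊗ m} ⊗ End(V)^{⊗ n} → End(V)^{⊗ (m + n)}`. -/
noncomputable def prod {m n : ℕ} : WEnd k V m →ₗ[k] WEnd k V n →ₗ[k] WEnd k V (m + n) :=
  TensorProduct.map₂ (tensorAppend k V) (tensorAppend k (Module.Dual k V))

theorem perm_pure {m n : ℕ} (σ τ : Fin m ≃ Fin n) (f : Fin m → V) (g : Fin m → Module.Dual k V) :
    perm k V σ τ (pure k V f g) = pure k V (f ∘ σ.symm) (g ∘ τ.symm) := by
  unfold perm pure
  erw [TensorProduct.map_tmul]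
  erw [PiTensorProduct.reindex_tprod, PiTensorProduct.reindex_tprod]
  rfl

theorem trace_pure {m : ℕ} (i j : Fin (m + 1)) (f : Fin (m + 1) → V)
    (g : Fin (m + 1) → Module.Dual k V) :
    trace k V i j (pure k V f g) = g i (f j) • pure k V (j.removeNth f) (i.removeNth g) :=
  tensorTrace_tprod k V i j f g

theorem prod_pure {m n : ℕ} (f : Fin m → V) (g : Fin m → Module.Dual k V) (f' : Fin n → V)
    (g' : Fin n → Module.Dual k V) :
    prod k V (pure k V f g) (pure k V f' g') = pure k V (Fin.append f f') (Fin.append g g') := by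
  unfold prod pure
  erw [TensorProduct.map₂_apply_tmul]
  erw [TensorProduct.map_tmul]
  rw [tensorAppend_tprod, tensorAppend_tprod]

end WEnd

end TensorPowers

section WEndWheel
variable (k : Type u) [Field k] (V : Type v) [AddCommGroup V] [Module k V]

open WEnd

theorem Fin.append_blockSum {α : Type*} {m n m' n' : ℕ} (σ : Fin m ≃ Fin m') (σ' : Fin n ≃ Fin n')
    (f : Fin m → α) (g : Fin n → α) :
    Fin.append f g ∘ (blockSum σ σ').symm = Fin.append (f ∘ σ.symm) (g ∘ σ'.symm) := by
  funext a
  induction a using Fin.addCases <;> simp [blockSum]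

theorem Fin.removeNth_removeNth_comm {α : Type*} {m : ℕ} (i : Fin (m + 1)) (p : Fin (m + 2))
    (f : Fin (m + 2) → α) :
    (i.predAbove p).removeNth ((p.succAbove i).removeNth f) = i.removeNth (p.removeNth f) := by
  funext a
  simp only [Fin.removeNth]
  rw [Fin.succAbove_succAbove_succAbove_predAbove]

theorem Fin.removeNth_append_left {α : Type*} {m n : ℕ} (i : Fin (m + 1)) (f : Fin (m + 1) → α)
    (g : Fin n → α) :
    (Fin.cast (Nat.succ_add m n) (Fin.castAdd n i)).removeNth
        (Fin.append f g ∘ (finCongr (Nat.succ_add m n)).symm) =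
      Fin.append (i.removeNth f) g := by
  funext a
  induction a using Fin.addCases with
  | left a =>
    simp only [Fin.removeNth, Function.comp, Fin.append_left]
    have : (finCongr (Nat.succ_add m n)).symm
        ((Fin.cast (Nat.succ_add m n) (Fin.castAdd n i)).succAbove (Fin.castAdd n a)) =
        Fin.castAdd n (i.succAbove a) := by
      ext
      simp only [Fin.succAbove, Fin.lt_def]
      simp
      split_ifs <;> simp
    rw [this, Fin.append_left]
  | right a =>
    simp only [Fin.removeNth, Function.comp, Fin.append_right]
    have : (finCongr (Nat.succ_add m n)).symm
        ((Fin.cast (Nat.succ_add m n) (Fin.castAdd n i)).succAbove (Fin.natAdd m a)) =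
        Fin.natAdd (m + 1) a := by
      ext
      simp only [Fin.succAbove, Fin.lt_def]
      have := i.isLt
      simp
      split_ifs
      · omega
      · simp; omega
    rw [this, Fin.append_right]

theorem Fin.removeNth_append_right {α : Type*} {m n : ℕ} (i : Fin (n + 1)) (f : Fin m → α)
    (g : Fin (n + 1) → α) :
    Fin.removeNth (n := m + n) (α := fun _ => α) (Fin.natAdd m i)
        (Fin.append f g : Fin (m + (n + 1)) → α) =
      Fin.append f (i.removeNth g) := by
  funext a
  induction a using Fin.addCases with
  | left a =>
    simp only [Fin.removeNth, Fin.append_left]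
    have : Fin.succAbove (n := m + n) (Fin.natAdd m i) (Fin.castAdd n a) =
        Fin.castAdd (n + 1) a := by
      ext
      simp only [Fin.succAbove, Fin.lt_def]
      have := a.isLt
      simp
      split_ifs
      · simp
      · omega
    rw [this, Fin.append_left]
  | right a =>
    simp only [Fin.removeNth, Fin.append_right]
    have : Fin.succAbove (n := m + n) (Fin.natAdd m i) (Fin.natAdd m a) =
        Fin.natAdd m (i.succAbove a) := by
      ext
      simp only [Fin.succAbove, Fin.lt_def]
      simp
      split_ifs <;> (simp; try omega)
    rw [this, Fin.append_right]

noncomputable instance : Wheelspace k (WEnd k V) where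
  act := perm k V
  act_refl a := by
    induction a using WEnd.induction with
    | hp f g => rw [perm_pure]; rfl
    | hs c a h => rw [map_smul, h]
    | ha a b h h' => rw [map_add, h, h']
  act_trans σ τ σ' τ' a := by
    induction a using WEnd.induction with
    | hp f g => simp only [perm_pure]; rfl
    | hs c a h => simp only [map_smul, h]
    | ha a b h h' => simp only [map_add, h, h']
  contr := trace k V
  contr_act σ τ σ' τ' i j hσ hτ a := by
    induction a using WEnd.induction with
    | hp f g =>
      rw [perm_pure, trace_pure, trace_pure, map_smul, perm_pure]
      have h1 : (σ j).removeNth (f ∘ σ.symm) = j.removeNth f ∘ σ'.symm := by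
        funext a
        have := hσ (σ'.symm a)
        simp only [Fin.removeNth, Function.comp]
        rw [Equiv.apply_symm_apply] at this
        rw [← this, Equiv.symm_apply_apply]
      have h2 : (τ i).removeNth (g ∘ τ.symm) = i.removeNth g ∘ τ'.symm := by
        funext a
        have := hτ (τ'.symm a)
        simp only [Fin.removeNth, Function.comp]
        rw [Equiv.apply_symm_apply] at this
        rw [← this, Equiv.symm_apply_apply]
      rw [h1, h2]
      simp
    | hs c a h => simp only [map_smul, h]
    | ha a b h h' => simp only [map_add, h, h']
  contr_contr i j p q a := by
    induction a using WEnd.induction with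
    | hp f g =>
      simp only [trace_pure, map_smul, smul_smul]
      rw [Fin.removeNth_removeNth_comm, Fin.removeNth_removeNth_comm]
      simp only [Fin.removeNth, Fin.succAbove_succAbove_predAbove]
      rw [mul_comm]
    | hs c a h => simp only [map_smul, h]
    | ha a b h h' => simp only [map_add, h, h']

theorem WEnd.act_pure {m n : ℕ} (σ τ : Fin m ≃ Fin n) (f : Fin m → V)
    (g : Fin m → Module.Dual k V) :
    act (k := k) (W := WEnd k V) σ τ (pure k V f g) = pure k V (f ∘ σ.symm) (g ∘ τ.symm) :=
  perm_pure k V σ τ f g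

theorem WEnd.contr_pure {m : ℕ} (i j : Fin (m + 1)) (f : Fin (m + 1) → V)
    (g : Fin (m + 1) → Module.Dual k V) :
    contr (k := k) (W := WEnd k V) i j (pure k V f g) =
      g i (f j) • pure k V (j.removeNth f) (i.removeNth g) :=
  trace_pure k V i j f g

noncomputable instance : Wheelgebra k (WEnd k V) where
  mul := WEnd.prod k V
  isWheelBilinear_mul :=
    { map_act := by
        intro m n m' n' σ τ σ' τ' a b
        induction a using WEnd.induction with
        | hp f g =>
          induction b using WEnd.induction with
          | hp f' g' => simp only [act_pure, prod_pure, Fin.append_blockSum]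
          | hs c a h => simp only [map_smul, h]
          | ha a b h h' => simp only [map_add, h, h']
        | hs c a h => simp only [map_smul, LinearMap.smul_apply, h]
        | ha a b h h' => simp only [map_add, LinearMap.add_apply, h, h']
      map_contr_left := by
        intro m n i j a b
        induction a using WEnd.induction with
        | hp f g =>
          induction b using WEnd.induction with
          | hp f' g' =>
            simp only [recast, act_pure, prod_pure, contr_pure, map_smul, LinearMap.smul_apply]
            rw [Fin.removeNth_append_left, Fin.removeNth_append_left]
            congr 1
            simp
          | hs c a h => simp only [map_smul, h]
          | ha a b h h' => simp only [map_add, h, h']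
        | hs c a h => simp only [map_smul, LinearMap.smul_apply, h]
        | ha a b h h' => simp only [map_add, LinearMap.add_apply, h, h']
      map_contr_right := by
        intro m n i j a b
        induction a using WEnd.induction with
        | hp f g =>
          induction b using WEnd.induction with
          | hp f' g' =>
            simp only [prod_pure, contr_pure, map_smul]
            rw [Fin.removeNth_append_right, Fin.removeNth_append_right]
            congr 1
            erw [Fin.append_right, Fin.append_right]
          | hs c a h =>
            simp only [map_smul, h]
          | ha a b h h' =>
            simp only [map_add, h, h']
        | hs c a h =>
          simp only [map_smul, LinearMap.smul_apply, h]
        | ha a b h h' =>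
          simp only [map_add, LinearMap.add_apply, h, h'] }
  one := pure k V Fin.elim0 Fin.elim0
  one_mul := by
    intro m a
    induction a using WEnd.induction with
    | hp f g =>
      simp only [recast, prod_pure, act_pure]
      congr 1 <;> (rw [Fin.elim0_append]; rfl)
    | hs c a h => simp only [map_smul, h]
    | ha a b h h' => simp only [map_add, h, h']
  mul_one := by
    intro m a
    induction a using WEnd.induction with
    | hp f g =>
      simp only [prod_pure]
      congr 1 <;> (rw [Fin.append_elim0]; rfl)
    | hs c a h => simp only [map_smul, LinearMap.smul_apply, h]
    | ha a b h h' => simp only [map_add, LinearMap.add_apply, h, h']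
  mul_assoc := by
    intro m n p a b c
    induction a using WEnd.induction with
    | hp f g =>
      induction b using WEnd.induction with
      | hp f' g' =>
        induction c using WEnd.induction with
        | hp f'' g'' =>
          simp only [recast, prod_pure, act_pure]
          congr 1 <;> (rw [Fin.append_assoc]; rfl)
        | hs c a h => simp only [map_smul, h]
        | ha a b h h' => simp only [map_add, h, h']
      | hs c a h => simp only [map_smul, LinearMap.smul_apply, h]
      | ha a b h h' => simp only [map_add, LinearMap.add_apply, h, h']
    | hs c a h => simp only [map_smul, LinearMap.smul_apply, h]
    | ha a b h h' => simp only [map_add, LinearMap.add_apply, h, h']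

end WEndWheel

/-! ### Extension of scalars and morphisms to `B ⊗ WEnd V` -/

section BaseChange

variable (k : Type u) [Field k] (B : Type x) [Ring B] [Algebra k B] (W : ℕ → Type w)
  [∀ m, AddCommGroup (W m)] [∀ m, Module k (W m)]

/-- Degree `m` of `B ⊗ W`. -/
def BaseChange (m : ℕ) : Type (max x w) := B ⊗[k] W m

noncomputable instance (m : ℕ) : AddCommGroup (BaseChange k B W m) :=
  inferInstanceAs (AddCommGroup (B ⊗[k] W m))

noncomputable instance (m : ℕ) : Module k (BaseChange k B W m) :=
  inferInstanceAs (Module k (B ⊗[k] W m))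

namespace BaseChange

variable {k B W} in
/-- The pure tensor `b ⊗ a`. -/
noncomputable def pure {m : ℕ} (b : B) (a : W m) : BaseChange k B W m := b ⊗ₜ[k] a

variable {k B W} in
theorem induction {m : ℕ} {P : BaseChange k B W m → Prop} (hp : ∀ b a, P (pure b a))
    (ha : ∀ a b, P a → P b → P (a + b)) (a : BaseChange k B W m) : P a := by
  have h0 : P 0 := by
    have := hp 0 0
    rwa [pure, TensorProduct.zero_tmul] at this
  exact TensorProduct.induction_on (motive := P) a h0 hp ha

variable {W} in
/-- `Id_B ⊗ f`. -/
noncomputable def lift {m n : ℕ} (f : W m →ₗ[k] W n) :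
    BaseChange k B W m →ₗ[k] BaseChange k B W n :=
  LinearMap.lTensor B f

variable {B} in
/-- `f ⊗ Id` for a linear map `f : B → B'`. -/
noncomputable def map {B' : Type y} [Ring B'] [Algebra k B'] (f : B →ₗ[k] B') (m : ℕ) :
    BaseChange k B W m →ₗ[k] BaseChange k B' W m :=
  LinearMap.rTensor (W m) f

variable {B W} in
/-- The bilinear operation `(b ⊗ a, b' ⊗ a') ↦ β(b, b') ⊗ μ(a, a')`. -/
noncomputable def bilin (β : B →ₗ[k] B →ₗ[k] B) {m n l : ℕ} (μ : W m →ₗ[k] W n →ₗ[k] W l) :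
    BaseChange k B W m →ₗ[k] BaseChange k B W n →ₗ[k] BaseChange k B W l :=
  TensorProduct.map₂ β μ

variable {B} in
/-- The subspace `S ⊗ W m` of `B ⊗ W m`. -/
noncomputable def sub (S : Submodule k B) (m : ℕ) : Submodule k (BaseChange k B W m) :=
  LinearMap.range (LinearMap.rTensor (W m) S.subtype)

variable {k B W}

@[simp] theorem lift_pure {m n : ℕ} (f : W m →ₗ[k] W n) (b : B) (a : W m) :
    lift k B f (pure b a) = pure b (f a) := rfl

@[simp] theorem bilin_pure (β : B →ₗ[k] B →ₗ[k] B) {m n l : ℕ} (μ : W m →ₗ[k] W n →ₗ[k] W l)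
    (b b' : B) (a : W m) (a' : W n) :
    bilin k β μ (pure b a) (pure b' a') = pure (β b b') (μ a a') := rfl

end BaseChange

open BaseChange

noncomputable instance [Wheelspace k W] : Wheelspace k (BaseChange k B W) where
  act σ τ := lift k B (act σ τ)
  act_refl a := by
    induction a using BaseChange.induction with
    | hp b a => rw [lift_pure, act_refl]
    | ha a b h h' => rw [map_add, h, h']
  act_trans σ τ σ' τ' a := by
    induction a using BaseChange.induction with
    | hp b a => simp only [lift_pure, act_trans]
    | ha a b h h' => simp only [map_add, h, h']
  contr i j := lift k B (contr i j)
  contr_act σ τ σ' τ' i j hσ hτ a := by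
    induction a using BaseChange.induction with
    | hp b a => simp only [lift_pure, contr_act σ τ σ' τ' i j hσ hτ]
    | ha a b h h' => simp only [map_add, h, h']
  contr_contr i j p q a := by
    induction a using BaseChange.induction with
    | hp b a => simp only [lift_pure]; rw [contr_contr]
    | ha a b h h' => simp only [map_add, h, h']

/-- The wheelgebra `B ⊗ W`, with all structure maps extended `B`-linearly, for an associative
algebra `B`. -/
noncomputable instance [Wheelgebra k W] : Wheelgebra k (BaseChange k B W) where
  mul := bilin k (LinearMap.mul k B) mul
  isWheelBilinear_mul :=
    { map_act := by
        intro m n m' n' σ τ σ' τ' a b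
        induction a using BaseChange.induction with
        | hp c a =>
          induction b using BaseChange.induction with
          | hp c' a' =>
            exact congrArg (BaseChange.pure (c * c')) (isWheelBilinear_mul.map_act σ τ σ' τ' a a')
          | ha a b h h' => simp only [map_add, h, h']
        | ha a b h h' => simp only [map_add, LinearMap.add_apply, h, h']
      map_contr_left := by
        intro m n i j a b
        induction a using BaseChange.induction with
        | hp c a =>
          induction b using BaseChange.induction with
          | hp c' a' =>
            exact congrArg (BaseChange.pure (c * c')) (isWheelBilinear_mul.map_contr_left i j a a')
          | ha a b h h' => simp only [map_add, h, h']
        | ha a b h h' => simp only [map_add, LinearMap.add_apply, h, h']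
      map_contr_right := by
        intro m n i j a b
        induction a using BaseChange.induction with
        | hp c a =>
          induction b using BaseChange.induction with
          | hp c' a' =>
            exact congrArg (BaseChange.pure (c * c')) (isWheelBilinear_mul.map_contr_right i j a a')
          | ha a b h h' => simp only [map_add, h, h']
        | ha a b h h' => simp only [map_add, LinearMap.add_apply, h, h'] }
  one := BaseChange.pure 1 (one k)
  one_mul := by
    intro m a
    induction a using BaseChange.induction with
    | hp b a =>
      exact congrArg₂ BaseChange.pure (_root_.one_mul b) (Wheelgebra.one_mul (k := k) a)
    | ha a b h h' => simp only [map_add, h, h']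
  mul_one := by
    intro m a
    induction a using BaseChange.induction with
    | hp b a =>
      exact congrArg₂ BaseChange.pure (_root_.mul_one b) (Wheelgebra.mul_one (k := k) a)
    | ha a b h h' => simp only [map_add, LinearMap.add_apply, h, h']
  mul_assoc := by
    intro m n p a b c
    induction a using BaseChange.induction with
    | hp d a =>
      induction b using BaseChange.induction with
      | hp d' a' =>
        induction c using BaseChange.induction with
        | hp d'' a'' =>
          exact congrArg₂ BaseChange.pure (_root_.mul_assoc d d' d'')
            (Wheelgebra.mul_assoc (k := k) a a' a'')
        | ha a b h h' => simp only [map_add, h, h']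
      | ha a b h h' => simp only [map_add, LinearMap.add_apply, h, h']
    | ha a b h h' => simp only [map_add, LinearMap.add_apply, h, h']

end BaseChange

/-! ### Representation algebras -/

section Representations

variable (k : Type u) [Field k] (V : Type v) [AddCommGroup V] [Module k V]

/-- The identity of `V`, as an element of `End(V) = V ⊗ V^*` in degree `1` of `WEnd V`. -/
noncomputable def WEnd.idElem [FiniteDimensional k V] : WEnd k V 1 :=
  TensorProduct.map
    (PiTensorProduct.subsingletonEquiv (R := k) (s := fun _ => V) (0 : Fin 1)).symm.toLinearMap
    (PiTensorProduct.subsingletonEquiv (R := k) (s := fun _ => Module.Dual k V)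
      (0 : Fin 1)).symm.toLinearMap
    (coevaluation k V 1)

/-- The diagonal action of `g ∈ GL(V)` on `End(V)^{⊗ m} = V^{⊗ m} ⊗ (V^*)^{⊗ m}`. -/
noncomputable def WEnd.gl (g : LinearMap.GeneralLinearGroup k V) (m : ℕ) :
    WEnd k V m →ₗ[k] WEnd k V m :=
  TensorProduct.map (PiTensorProduct.map fun _ => (g : V →ₗ[k] V))
    (PiTensorProduct.map fun _ => ((g⁻¹ : LinearMap.GeneralLinearGroup k V) : V →ₗ[k] V).dualMap)

variable {k} {W : ℕ → Type w} [∀ m, AddCommGroup (W m)] [∀ m, Module k (W m)] [Wheelgebra k W]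

/-- A representation in `B ⊗ WEnd V`: a morphism of wheelgebras `ρ : W → B ⊗ WEnd V` that sends
every element of the given set `U` of wheeled units to the identity `1 ⊗ Id_V`. -/
def IsRepresentation [FiniteDimensional k V] (U : Set (W 1)) {B : Type x} [Ring B] [Algebra k B]
    (ρ : WheelgebraHom k W (BaseChange k B (WEnd k V))) : Prop :=
  ∀ t ∈ U, ρ.app 1 t = BaseChange.pure 1 (WEnd.idElem k V)

/-- `(R, ev)` is the representation algebra of `W` on `V`: `ev` is a representation, and every
representation `ρ` of `W` in `B ⊗ WEnd V` is `(φ ⊗ Id) ∘ ev` for a unique algebra morphism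
`φ : R → B`. -/
def IsRepresentationAlgebra [FiniteDimensional k V] (U : Set (W 1)) {R : Type y} [Ring R]
    [Algebra k R] (ev : WheelgebraHom k W (BaseChange k R (WEnd k V))) : Prop :=
  IsRepresentation V U ev ∧
    ∀ (B : Type x) [Ring B] [Algebra k B] (ρ : WheelgebraHom k W (BaseChange k B (WEnd k V))),
      IsRepresentation V U ρ →
        ∃! φ : R →ₐ[k] B, ∀ (m : ℕ) (a : W m),
          ρ.app m a = BaseChange.map k (WEnd k V) φ.toLinearMap m (ev.app m a)

/-- Invariance of `x ∈ R ⊗ End(V)^{⊗ m}` under the action of `GL(V)` given by the action `Θ` on `R`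
and the diagonal action on `End(V)^{⊗ m}`. -/
def IsGLInvariant {R : Type y} [Ring R] [Algebra k R]
    (Θ : LinearMap.GeneralLinearGroup k V →* (R ≃ₐ[k] R)) {m : ℕ}
    (a : BaseChange k R (WEnd k V) m) : Prop :=
  ∀ g : LinearMap.GeneralLinearGroup k V,
    BaseChange.map k (WEnd k V) (Θ g).toLinearMap m
      (BaseChange.lift k R (WEnd.gl k V g m) a) = a

/-- The action `Θ` of `GL(V)` on `R` by algebra automorphisms is compatible with `ev`: together with
the diagonal action on `WEnd V` it fixes the image of `ev`. -/
def IsCompatibleAction {R : Type y} [Ring R] [Algebra k R]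
    (ev : WheelgebraHom k W (BaseChange k R (WEnd k V)))
    (Θ : LinearMap.GeneralLinearGroup k V →* (R ≃ₐ[k] R)) : Prop :=
  ∀ (m : ℕ) (a : W m), IsGLInvariant V Θ (ev.app m a)

/-- The identity `1 ⊗ Id_V` of degree `1`, as a family of subsets of `B ⊗ WEnd V`. -/
def identitySet (k : Type u) [Field k] (V : Type v) [AddCommGroup V] [Module k V]
    [FiniteDimensional k V] (B : Type x) [Ring B] [Algebra k B] :
    ∀ m : ℕ, Set (BaseChange k B (WEnd k V) m)
  | 1 => {BaseChange.pure 1 (WEnd.idElem k V)}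
  | _ => ∅

end Representations

universe z

set_option linter.unusedSectionVars false

/-! In a basis of `V`, a morphism from `W` to `B ⊗ WEnd V` is a family of matrix elements `a_{IJ}`
in `B`, linear in `a ∈ W m` and indexed by words `I`, `J` of length `m`. Permuting legs permutes
letters, a contraction sums over a repeated letter, and `(aa')_{II',JJ'} = a_{IJ} a'_{I'J'}`. These
symbols and identities, together with `t_{pq} = δ_{pq}` for `t ∈ U`, present the representation
algebra `R`. A product of matrix elements is a matrix element, so matrix elements span `R` linearly.
A linear map on `R` may be prescribed on them once the linear relations hold
(`IsRepresentationAlgebra.exists_linearMap`): `W` acts by right translation on the space of such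
prescriptions, the universal property extends this to an action of `R`, and evaluation at `1` gives
the linear map.

`GL(V)` acts on `WEnd V` by wheelgebra automorphisms fixing the identity. Composing `ev` with `g⁻¹`
is therefore a representation, and the endomorphism of `R` that classifies it is the action of `g`.

Invariants: `a'_{IJ} ⊗ a` arises by contracting the constant tensor `a ⊗ E_{JI}` with `ev a'`
(`BaseChange.join_mul_unit`). Since `ev a'` is invariant, averaging over the group only averages a
constant tensor. The result is an invariant tensor, hence a combination of permuted powers of the
identity. An invariant element is its own average, so it is generated by the image of `ev` and the
identity; if `U` is nonempty, the identity already lies in the image. The averaging is algebraic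
(`exists_reynolds`): pairing with `det ^ N`, as in Cayley's `Ω` process, is a relatively invariant
functional on polynomials in matrix entries, and on a finite-dimensional space of polynomials it is
a finite combination of evaluations at group elements. The first fundamental theorem follows Schur:
comparing coefficients for the generic matrix shows that an invariant tensor commutes with the whole
commutant of the symmetric group, and averaging over that group gives the double commutant property
(`mem_span_tensorPerm`).

The further structures are given by `{a_{IJ}, a'_{I'J'}} = {a, a'}_{II',JJ'}` and `Δ(a_{IJ}) =
(Δa)_{IJ}`, and their axioms are checked on matrix elements. Only the relation `t_{pq} = δ_{pq}` is
delicate. Joining `t` to itself gives `t`, so a derivation `D` satisfies `Dt = Dt + Dt` on matrix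
elements, that is `Dt = 0` (`IsCompatFamily.unit_eq_zero`). In the BV case wheeled units must also
have degree `0`: the degree `0` part of a wheeled unit is a central wheeled unit, and commuting
wheeled units coincide. -/

theorem Fin.append_comp_castAdd {α : Type*} {m n : ℕ} (f : Fin m → α) (g : Fin n → α) :
    Fin.append f g ∘ Fin.castAdd n = f :=
  funext fun _ => Fin.append_left _ _ _

theorem Fin.append_comp_natAdd {α : Type*} {m n : ℕ} (f : Fin m → α) (g : Fin n → α) :
    Fin.append f g ∘ Fin.natAdd m = g :=
  funext fun _ => Fin.append_right _ _ _

/-! ### Coordinates on `WEnd V` -/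

section Coordinates

variable {k : Type u} [Field k] {V : Type v} [AddCommGroup V] [Module k V]
  {ι : Type*} [Fintype ι] [DecidableEq ι] (b : Module.Basis ι k V)

/-- The coordinate function on `V^{⊗ m} ⊗ (V^*)^{⊗ m}` at basis vectors `I` and dual basis
vectors `J`. -/
noncomputable def tensorCoord {m : ℕ} (I J : Fin m → ι) :
    (⨂[k] _ : Fin m, V) ⊗[k] (⨂[k] _ : Fin m, Module.Dual k V) →ₗ[k] k :=
  (TensorProduct.lid k k).toLinearMap ∘ₗ
    TensorProduct.map
      (PiTensorProduct.lift
        ((MultilinearMap.mkPiAlgebra k (Fin m) k).compLinearMap fun a => b.coord (I a)))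
      (PiTensorProduct.lift
        ((MultilinearMap.mkPiAlgebra k (Fin m) k).compLinearMap
          fun a => Module.Dual.eval k V (b (J a))))

theorem tensorCoord_tprod {m : ℕ} (I J : Fin m → ι) (f : Fin m → V)
    (g : Fin m → Module.Dual k V) :
    tensorCoord b I J (PiTensorProduct.tprod k f ⊗ₜ[k] PiTensorProduct.tprod k g) =
      (∏ a, b.coord (I a) (f a)) * ∏ a, g a (b (J a)) := by
  simp [tensorCoord]

namespace WEnd

/-- The coordinate of an element of `WEnd V` at the pure tensor of basis vectors `I` and dual basis
vectors `J`. -/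
noncomputable def coord {m : ℕ} (I J : Fin m → ι) : WEnd k V m →ₗ[k] k :=
  tensorCoord b I J

theorem coord_pure {m : ℕ} (I J : Fin m → ι) (f : Fin m → V) (g : Fin m → Module.Dual k V) :
    coord b I J (pure k V f g) = (∏ a, b.coord (I a) (f a)) * ∏ a, g a (b (J a)) :=
  tensorCoord_tprod b I J f g

/-- The tensors of basis vectors and dual basis vectors. -/
noncomputable def unit {m : ℕ} (I J : Fin m → ι) : WEnd k V m :=
  pure k V (fun a => b (I a)) (fun a => b.coord (J a))

theorem coord_unit {m : ℕ} (I J I' J' : Fin m → ι) :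
    coord b I J (unit b I' J') = if I = I' ∧ J = J' then 1 else 0 := by
  rw [unit, coord_pure]
  simp only [Module.Basis.coord_apply, Module.Basis.repr_self]
  by_cases hI : I = I'
  · by_cases hJ : J = J'
    · subst hI hJ; simp
    · obtain ⟨a, ha⟩ := Function.ne_iff.1 hJ
      rw [if_neg (by tauto), Finset.prod_eq_zero (Finset.mem_univ a)
        (f := fun a => (Finsupp.single (J a) (1 : k)) (J' a))
        (Finsupp.single_eq_of_ne (Ne.symm ha)), mul_zero]
  · obtain ⟨a, ha⟩ := Function.ne_iff.1 hI
    rw [if_neg (by tauto), Finset.prod_eq_zero (Finset.mem_univ a)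
      (f := fun a => (Finsupp.single (I' a) (1 : k)) (I a))
        (Finsupp.single_eq_of_ne ha), zero_mul]

theorem sum_coord_smul_unit {m : ℕ} (a : WEnd k V m) :
    ∑ I : Fin m → ι, ∑ J : Fin m → ι, coord b I J a • unit b I J = a := by
  induction a using WEnd.induction with
  | hp f g =>
    have hf : PiTensorProduct.tprod k f = ∑ I : Fin m → ι,
        (∏ a, b.coord (I a) (f a)) • PiTensorProduct.tprod k (fun a => b (I a)) := by
      conv_lhs => rw [show f = fun a => ∑ i, b.coord i (f a) • b i from
        funext fun a => (b.sum_repr (f a)).symm]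
      rw [MultilinearMap.map_sum]
      exact Finset.sum_congr rfl fun I _ => MultilinearMap.map_smul_univ _ _ _
    have hg : PiTensorProduct.tprod k g = ∑ J : Fin m → ι,
        (∏ a, g a (b (J a))) • PiTensorProduct.tprod k (fun a => b.coord (J a)) := by
      conv_lhs => rw [show g = fun a => ∑ i, g a (b i) • b.coord i from
        funext fun a => (b.sum_dual_apply_smul_coord (g a)).symm]
      rw [MultilinearMap.map_sum]
      exact Finset.sum_congr rfl fun I _ => MultilinearMap.map_smul_univ _ _ _
    simp only [coord_pure]
    conv_rhs => unfold pure
    rw [hf, hg]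
    erw [TensorProduct.sum_tmul]
    refine Finset.sum_congr rfl fun I _ => ?_
    erw [TensorProduct.tmul_sum]
    refine Finset.sum_congr rfl fun J _ => ?_
    erw [TensorProduct.smul_tmul_smul]
    rfl
  | hs c a h =>
    conv_rhs => rw [← h]
    simp only [map_smul, Finset.smul_sum, smul_smul, smul_eq_mul]
  | ha a a' h h' =>
    conv_rhs => rw [← h, ← h']
    simp only [map_add, add_smul, Finset.sum_add_distrib]

theorem coord_ext {m : ℕ} {a a' : WEnd k V m} (h : ∀ I J, coord b I J a = coord b I J a') :
    a = a' := by
  rw [← sum_coord_smul_unit b a, ← sum_coord_smul_unit b a']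
  simp only [h]

theorem coord_act {m n : ℕ} (σ τ : Fin m ≃ Fin n) (a : WEnd k V m) (I J : Fin n → ι) :
    coord b I J (act (k := k) σ τ a) = coord b (I ∘ σ) (J ∘ τ) a := by
  induction a using WEnd.induction with
  | hp f g =>
    rw [act_pure, coord_pure, coord_pure]
    congr 1
    · exact Fintype.prod_equiv σ.symm _ _ (by simp)
    · exact Fintype.prod_equiv τ.symm _ _ (by simp)
  | hs c a h => simp only [map_smul, h]
  | ha a a' h h' => simp only [map_add, h, h']

theorem coord_contr {m : ℕ} (i j : Fin (m + 1)) (a : WEnd k V (m + 1)) (I J : Fin m → ι) :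
    coord b I J (contr (k := k) i j a) =
      ∑ c, coord b (j.insertNth c I) (i.insertNth c J) a := by
  induction a using WEnd.induction with
  | hp f g =>
    rw [contr_pure, map_smul, coord_pure]
    simp only [coord_pure, Fin.prod_univ_succAbove (fun a => b.coord _ (f a)) j,
      Fin.prod_univ_succAbove (fun a => g a (b _)) i,
      Fin.insertNth_apply_same, Fin.insertNth_apply_succAbove, Fin.removeNth]
    -- Expanding the contracted vector in the basis turns the trace pairing into a sum over the
    -- letter inserted in both words.
    conv_lhs => rw [show f j = ∑ c, b.coord c (f j) • b c from (b.sum_repr (f j)).symm, map_sum]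
    rw [smul_eq_mul, Finset.sum_mul]
    refine Finset.sum_congr rfl fun c _ => ?_
    rw [map_smul, smul_eq_mul]
    ring
  | hs c a h => simp only [map_smul, h, Finset.smul_sum]
  | ha a a' h h' => simp only [map_add, h, h', Finset.sum_add_distrib]

theorem coord_mul {m n : ℕ} (a : WEnd k V m) (a' : WEnd k V n) (I J : Fin (m + n) → ι) :
    coord b I J (mul (k := k) a a') =
      coord b (I ∘ Fin.castAdd n) (J ∘ Fin.castAdd n) a *
        coord b (I ∘ Fin.natAdd m) (J ∘ Fin.natAdd m) a' := by
  induction a using WEnd.induction with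
  | hp f g =>
    induction a' using WEnd.induction with
    | hp f' g' =>
      have : mul (k := k) (pure k V f g) (pure k V f' g') =
        pure k V (Fin.append f f') (Fin.append g g') := prod_pure k V f g f' g'
      rw [this]
      simp only [coord_pure, Fin.prod_univ_add, Fin.append_left, Fin.append_right,
        Function.comp_apply]
      ring
    | hs c a h => simp only [map_smul, h, smul_eq_mul]; ring
    | ha a a' h h' => simp only [map_add, h, h']; ring
  | hs c a h => simp only [map_smul, LinearMap.smul_apply, h, smul_eq_mul]; ring
  | ha a a' h h' => simp only [map_add, LinearMap.add_apply, h, h']; ring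

theorem coord_one (I J : Fin 0 → ι) : coord b I J (one k : WEnd k V 0) = 1 := by
  have : (one k : WEnd k V 0) = pure k V Fin.elim0 Fin.elim0 := rfl
  rw [this, coord_pure]
  simp

theorem coord_idElem [FiniteDimensional k V] (I J : Fin 1 → ι) :
    coord b I J (idElem k V) = if I 0 = J 0 then 1 else 0 := by
  -- The coevaluation is written in this basis, which need not be `b`; the two are compared by
  -- expanding `b (J 0)` in `b'`.
  let b' := Module.Basis.ofVectorSpace k V
  have h : idElem k V = ∑ i, pure k V (fun _ : Fin 1 => b' i) (fun _ : Fin 1 => b'.coord i) := by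
    unfold idElem
    rw [coevaluation_apply_one]
    dsimp only
    rw [map_sum]
    refine Finset.sum_congr rfl fun i _ => ?_
    erw [TensorProduct.map_tmul]
    simp only [LinearEquiv.coe_coe, PiTensorProduct.subsingletonEquiv_symm_apply']
    rfl
  rw [h, map_sum]
  simp only [coord_pure, Finset.univ_unique, Finset.prod_singleton, Fin.default_eq_zero]
  have := congrArg (b.coord (I 0)) (b'.sum_repr (b (J 0)))
  rw [map_sum] at this
  simp only [map_smul, smul_eq_mul, Module.Basis.coord_apply, Module.Basis.repr_self] at this ⊢
  rw [Finsupp.single_apply] at this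
  simp only [eq_comm (a := J 0)] at this
  rw [← this]
  exact Finset.sum_congr rfl fun _ _ => mul_comm _ _

end WEnd

namespace BaseChange

variable {A : Type x} [Ring A] [Algebra k A]

/-- The coordinate in `A` of an element of `A ⊗ WEnd V`. -/
noncomputable def coord {m : ℕ} (I J : Fin m → ι) : BaseChange k A (WEnd k V) m →ₗ[k] A :=
  (TensorProduct.rid k A).toLinearMap ∘ₗ LinearMap.lTensor A (WEnd.coord b I J)

theorem coord_pure {m : ℕ} (I J : Fin m → ι) (r : A) (a : WEnd k V m) :
    coord b I J (pure r a) = WEnd.coord b I J a • r := rfl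

/-- The element of `A ⊗ WEnd V` with given coordinates. -/
noncomputable def ofCoord {m : ℕ} (c : (Fin m → ι) → (Fin m → ι) → A) :
    BaseChange k A (WEnd k V) m :=
  ∑ I, ∑ J, pure (c I J) (WEnd.unit b I J)

theorem coord_ofCoord {m : ℕ} (c : (Fin m → ι) → (Fin m → ι) → A) (I J : Fin m → ι) :
    coord b I J (ofCoord b c) = c I J := by
  simp only [ofCoord, map_sum, coord_pure, WEnd.coord_unit]
  rw [Finset.sum_eq_single I, Finset.sum_eq_single J] <;> simp +contextual [eq_comm]

theorem ofCoord_coord {m : ℕ} (a : BaseChange k A (WEnd k V) m) :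
    ofCoord b (fun I J => coord b I J a) = a := by
  induction a using BaseChange.induction with
  | hp r a =>
    conv_rhs => rw [← WEnd.sum_coord_smul_unit b a]
    simp only [ofCoord, pure]
    erw [TensorProduct.tmul_sum]
    refine Finset.sum_congr rfl fun I _ => ?_
    erw [TensorProduct.tmul_sum]
    exact Finset.sum_congr rfl fun J _ => TensorProduct.smul_tmul _ _ _
  | ha a a' h h' =>
    conv_rhs => rw [← h, ← h']
    simp only [ofCoord, map_add, ← Finset.sum_add_distrib]
    exact Finset.sum_congr rfl fun I _ => Finset.sum_congr rfl fun J _ =>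
      TensorProduct.add_tmul _ _ _

theorem coord_ext {m : ℕ} {a a' : BaseChange k A (WEnd k V) m}
    (h : ∀ I J, coord b I J a = coord b I J a') : a = a' := by
  rw [← ofCoord_coord b a, ← ofCoord_coord b a']
  simp only [h]

theorem coord_act {m n : ℕ} (σ τ : Fin m ≃ Fin n) (a : BaseChange k A (WEnd k V) m)
    (I J : Fin n → ι) :
    coord b I J (act (k := k) σ τ a) = coord b (I ∘ σ) (J ∘ τ) a := by
  induction a using BaseChange.induction with
  | hp r a => exact congrArg (· • r) (WEnd.coord_act b σ τ a I J)
  | ha a a' h h' => simp only [map_add, h, h']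

theorem coord_contr {m : ℕ} (i j : Fin (m + 1)) (a : BaseChange k A (WEnd k V) (m + 1))
    (I J : Fin m → ι) :
    coord b I J (contr (k := k) i j a) =
      ∑ c, coord b (j.insertNth c I) (i.insertNth c J) a := by
  induction a using BaseChange.induction with
  | hp r a =>
    refine (congrArg (· • r) (WEnd.coord_contr b i j a I J)).trans ?_
    exact Finset.sum_smul
  | ha a a' h h' => simp only [map_add, h, h', Finset.sum_add_distrib]

theorem coord_bilin (β : A →ₗ[k] A →ₗ[k] A) {m n : ℕ} (a : BaseChange k A (WEnd k V) m)
    (a' : BaseChange k A (WEnd k V) n) (I J : Fin (m + n) → ι) :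
    coord b I J (bilin k β Wheelgebra.mul a a') =
      β (coord b (I ∘ Fin.castAdd n) (J ∘ Fin.castAdd n) a)
        (coord b (I ∘ Fin.natAdd m) (J ∘ Fin.natAdd m) a') := by
  induction a using BaseChange.induction with
  | hp r a =>
    induction a' using BaseChange.induction with
    | hp r' a' =>
      rw [bilin_pure, coord_pure, coord_pure, coord_pure, WEnd.coord_mul]
      simp only [map_smul, LinearMap.smul_apply, smul_smul]
      rw [mul_comm]
    | ha a a' h h' => simp only [map_add, h, h']
  | ha a a' h h' => simp only [map_add, LinearMap.add_apply, h, h']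

theorem coord_mul {m n : ℕ} (a : BaseChange k A (WEnd k V) m)
    (a' : BaseChange k A (WEnd k V) n) (I J : Fin (m + n) → ι) :
    coord b I J (Wheelgebra.mul (k := k) a a') =
      coord b (I ∘ Fin.castAdd n) (J ∘ Fin.castAdd n) a *
        coord b (I ∘ Fin.natAdd m) (J ∘ Fin.natAdd m) a' :=
  coord_bilin b (LinearMap.mul k A) a a' I J

theorem coord_one (I J : Fin 0 → ι) :
    coord b I J (Wheelgebra.one k : BaseChange k A (WEnd k V) 0) = 1 := by
  have : (Wheelgebra.one k : BaseChange k A (WEnd k V) 0) = pure 1 (Wheelgebra.one k) := rfl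
  rw [this, coord_pure, WEnd.coord_one, one_smul]

theorem coord_idElem [FiniteDimensional k V] (I J : Fin 1 → ι) :
    coord b I J (pure 1 (WEnd.idElem k V) : BaseChange k A (WEnd k V) 1) =
      if I 0 = J 0 then 1 else 0 := by
  rw [coord_pure, WEnd.coord_idElem]
  split_ifs <;> simp

theorem coord_map {A' : Type y} [Ring A'] [Algebra k A'] (φ : A →ₗ[k] A') {m : ℕ}
    (a : BaseChange k A (WEnd k V) m) (I J : Fin m → ι) :
    coord b I J (map k (WEnd k V) φ m a) = φ (coord b I J a) := by
  induction a using BaseChange.induction with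
  | hp r a =>
    rw [coord_pure, map_smul]; rfl
  | ha a a' h h' => simp only [map_add, h, h']

/-- `A ⊗ WEnd V` is free over `A` on the tensors `WEnd.unit`, so membership is tested coordinate by
coordinate. This is why spans of matrix elements give the smallest filtration and the only possible
grading. -/
theorem mem_sub_iff (S : Submodule k A) {m : ℕ} (a : BaseChange k A (WEnd k V) m) :
    a ∈ sub k (WEnd k V) S m ↔ ∀ I J, coord b I J a ∈ S := by
  constructor
  · rintro ⟨s, rfl⟩ I J
    let f : S ⊗[k] WEnd k V m →ₗ[k] A :=
      coord b I J ∘ₗ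
        (LinearMap.rTensor (WEnd k V m) S.subtype : _ →ₗ[k] BaseChange k A (WEnd k V) m)
    change f s ∈ S
    induction s using TensorProduct.induction_on with
    | zero => rw [map_zero]; exact S.zero_mem
    | tmul r a => exact S.smul_mem _ r.2
    | add s s' h h' => rw [map_add]; exact S.add_mem h h'
  · intro h
    rw [← ofCoord_coord b a]
    refine Submodule.sum_mem _ fun I _ => Submodule.sum_mem _ fun J _ => ?_
    exact ⟨(⟨_, h I J⟩ : S) ⊗ₜ[k] WEnd.unit b I J, rfl⟩

end BaseChange

variable {W : ℕ → Type w} [∀ m, AddCommGroup (W m)] [∀ m, Module k (W m)] [Wheelgebra k W]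
  {A : Type x} [Ring A] [Algebra k A]

/-! ### Matrix elements of morphisms -/

namespace WheelgebraHom

/-- The matrix elements of a morphism of wheelgebras with values in `A ⊗ WEnd V`. -/
noncomputable def entry (ρ : WheelgebraHom k W (BaseChange k A (WEnd k V))) {m : ℕ}
    (I J : Fin m → ι) : W m →ₗ[k] A :=
  BaseChange.coord b I J ∘ₗ ρ.app m

variable (ρ : WheelgebraHom k W (BaseChange k A (WEnd k V)))

theorem coord_app {m : ℕ} (a : W m) (I J : Fin m → ι) :
    BaseChange.coord b I J (ρ.app m a) = ρ.entry b I J a := rfl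

theorem entry_act {m n : ℕ} (σ τ : Fin m ≃ Fin n) (a : W m) (I J : Fin n → ι) :
    ρ.entry b I J (act (k := k) σ τ a) = ρ.entry b (I ∘ σ) (J ∘ τ) a := by
  rw [← coord_app, ρ.map_act, BaseChange.coord_act, coord_app]

theorem entry_recast {m n : ℕ} (h : m = n) (a : W m) (I J : Fin n → ι) :
    ρ.entry b I J (recast k h a) = ρ.entry b (I ∘ finCongr h) (J ∘ finCongr h) a :=
  ρ.entry_act b _ _ a I J

theorem entry_contr {m : ℕ} (i j : Fin (m + 1)) (a : W (m + 1)) (I J : Fin m → ι) :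
    ρ.entry b I J (contr (k := k) i j a) =
      ∑ c, ρ.entry b (j.insertNth c I) (i.insertNth c J) a := by
  rw [← coord_app, ρ.map_contr, BaseChange.coord_contr]; rfl

theorem entry_mul {m n : ℕ} (a : W m) (a' : W n) (I J : Fin (m + n) → ι) :
    ρ.entry b I J (Wheelgebra.mul (k := k) a a') =
      ρ.entry b (I ∘ Fin.castAdd n) (J ∘ Fin.castAdd n) a *
        ρ.entry b (I ∘ Fin.natAdd m) (J ∘ Fin.natAdd m) a' := by
  rw [← coord_app, ρ.map_mul, BaseChange.coord_mul]; rfl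

/-- The source of the linear nature of the representation algebra: matrix elements are closed under
products, so they span whatever algebra they generate. -/
theorem entry_mul_append {m n : ℕ} (a : W m) (a' : W n) (I J : Fin m → ι) (I' J' : Fin n → ι) :
    ρ.entry b (Fin.append I I') (Fin.append J J') (Wheelgebra.mul (k := k) a a') =
      ρ.entry b I J a * ρ.entry b I' J' a' := by
  rw [entry_mul]
  simp only [Fin.append_comp_castAdd, Fin.append_comp_natAdd]

theorem entry_one (I J : Fin 0 → ι) : ρ.entry b I J (Wheelgebra.one k) = 1 := by
  rw [← coord_app, ρ.map_one, BaseChange.coord_one]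

/-- The morphism of wheelgebras with given matrix elements. -/
noncomputable def ofEntry (r : ∀ {m : ℕ}, (Fin m → ι) → (Fin m → ι) → W m →ₗ[k] A)
    (h_act : ∀ {m n : ℕ} (σ τ : Fin m ≃ Fin n) (a : W m) (I J : Fin n → ι),
      r I J (act (k := k) σ τ a) = r (I ∘ σ) (J ∘ τ) a)
    (h_contr : ∀ {m : ℕ} (i j : Fin (m + 1)) (a : W (m + 1)) (I J : Fin m → ι),
      r I J (contr (k := k) i j a) = ∑ c, r (j.insertNth c I) (i.insertNth c J) a)
    (h_one : ∀ I J : Fin 0 → ι, r I J (Wheelgebra.one k) = 1)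
    (h_mul : ∀ {m n : ℕ} (a : W m) (a' : W n) (I J : Fin (m + n) → ι),
      r I J (Wheelgebra.mul (k := k) a a') =
        r (I ∘ Fin.castAdd n) (J ∘ Fin.castAdd n) a *
          r (I ∘ Fin.natAdd m) (J ∘ Fin.natAdd m) a') :
    WheelgebraHom k W (BaseChange k A (WEnd k V)) where
  app m :=
    { toFun := fun a => BaseChange.ofCoord b fun I J => r I J a
      map_add' := fun a a' => BaseChange.coord_ext b fun I J => by
        simp only [map_add, BaseChange.coord_ofCoord]
      map_smul' := fun c a => BaseChange.coord_ext b fun I J => by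
        simp only [map_smul, BaseChange.coord_ofCoord, RingHom.id_apply] }
  map_act σ τ a := BaseChange.coord_ext b fun I J => by
    simp only [LinearMap.coe_mk, AddHom.coe_mk, BaseChange.coord_act, BaseChange.coord_ofCoord,
      h_act]
  map_contr i j a := BaseChange.coord_ext b fun I J => by
    simp only [LinearMap.coe_mk, AddHom.coe_mk, BaseChange.coord_contr, BaseChange.coord_ofCoord,
      h_contr]
  map_one := BaseChange.coord_ext b fun I J => by
    simp only [LinearMap.coe_mk, AddHom.coe_mk, BaseChange.coord_one, BaseChange.coord_ofCoord,
      h_one]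
  map_mul a a' := BaseChange.coord_ext b fun I J => by
    simp only [LinearMap.coe_mk, AddHom.coe_mk, BaseChange.coord_mul, BaseChange.coord_ofCoord,
      h_mul]

theorem entry_ofEntry (r : ∀ {m : ℕ}, (Fin m → ι) → (Fin m → ι) → W m →ₗ[k] A)
    (h_act h_contr h_one h_mul) {m : ℕ} (I J : Fin m → ι) (a : W m) :
    (ofEntry (k := k) (V := V) b (A := A) r h_act h_contr h_one h_mul).entry b I J a = r I J a :=
  BaseChange.coord_ofCoord b _ I J

end WheelgebraHom

theorem isRepresentation_iff_entry [FiniteDimensional k V] (U : Set (W 1))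
    (ρ : WheelgebraHom k W (BaseChange k A (WEnd k V))) :
    IsRepresentation V U ρ ↔
      ∀ t ∈ U, ∀ I J : Fin 1 → ι, ρ.entry b I J t = if I 0 = J 0 then 1 else 0 := by
  refine forall₂_congr fun t _ => ⟨fun h I J => ?_, fun h => BaseChange.coord_ext b fun I J => ?_⟩
  · rw [← ρ.coord_app, h, BaseChange.coord_idElem]
  · rw [BaseChange.coord_idElem, ← h, ρ.coord_app]

theorem app_eq_map_iff_entry {A' : Type y} [Ring A'] [Algebra k A'] (φ : A →ₗ[k] A')
    (ρ : WheelgebraHom k W (BaseChange k A (WEnd k V)))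
    (ρ' : WheelgebraHom k W (BaseChange k A' (WEnd k V))) {m : ℕ} (a a' : W m) :
    ρ'.app m a' = BaseChange.map k (WEnd k V) φ m (ρ.app m a) ↔
      ∀ I J, ρ'.entry b I J a' = φ (ρ.entry b I J a) := by
  constructor
  · intro h I J
    rw [← ρ'.coord_app, h, BaseChange.coord_map]; rfl
  · intro h
    exact BaseChange.coord_ext b fun I J => by rw [BaseChange.coord_map]; exact h I J

end Coordinates

/-! ### Existence of the representation algebra -/

namespace RepAlgebra

variable {k : Type u} [Field k] {V : Type v} [AddCommGroup V] [Module k V]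
  {ι : Type v} [Fintype ι] [DecidableEq ι] (b : Module.Basis ι k V)
  {W : ℕ → Type w} [∀ m, AddCommGroup (W m)] [∀ m, Module k (W m)] [Wheelgebra k W]

variable (W ι) in
/-- The symbols for the matrix elements of the elements of `W`. -/
abbrev Symbol := Σ m : ℕ, W m × (Fin m → ι) × (Fin m → ι)

variable (k) in
/-- The free generator for the matrix element of `a` at `I` and `J`. -/
abbrev gen {m : ℕ} (I J : Fin m → ι) (a : W m) : FreeAlgebra k (Symbol ι W) :=
  FreeAlgebra.ι k ⟨m, a, I, J⟩

/-- The defining relations of the representation algebra. -/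
inductive Rel (U : Set (W 1)) : FreeAlgebra k (Symbol ι W) → FreeAlgebra k (Symbol ι W) → Prop
  | add {m : ℕ} (I J : Fin m → ι) (a a' : W m) :
      Rel U (gen k I J (a + a')) (gen k I J a + gen k I J a')
  | smul {m : ℕ} (I J : Fin m → ι) (c : k) (a : W m) :
      Rel U (gen k I J (c • a)) (c • gen k I J a)
  | act {m n : ℕ} (σ τ : Fin m ≃ Fin n) (a : W m) (I J : Fin n → ι) :
      Rel U (gen k I J (Wheelspace.act (k := k) σ τ a)) (gen k (I ∘ σ) (J ∘ τ) a)
  | contr {m : ℕ} (i j : Fin (m + 1)) (a : W (m + 1)) (I J : Fin m → ι) :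
      Rel U (gen k I J (Wheelspace.contr (k := k) i j a))
        (∑ c, gen k (j.insertNth (α := fun _ => ι) c I) (i.insertNth (α := fun _ => ι) c J) a)
  | one (I J : Fin 0 → ι) : Rel U (gen k I J (Wheelgebra.one k : W 0)) 1
  | mul {m n : ℕ} (a : W m) (a' : W n) (I J : Fin (m + n) → ι) :
      Rel U (gen k I J (Wheelgebra.mul (k := k) a a'))
        (gen k (I ∘ Fin.castAdd n) (J ∘ Fin.castAdd n) a *
          gen k (I ∘ Fin.natAdd m) (J ∘ Fin.natAdd m) a')
  | unit (t : W 1) (ht : t ∈ U) (I J : Fin 1 → ι) :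
      Rel U (gen k I J t) (if I 0 = J 0 then 1 else 0)

variable (k ι) in
/-- The representation algebra, by generators and relations. -/
abbrev Alg (U : Set (W 1)) := RingQuot (Rel (k := k) (ι := ι) U)

variable (U : Set (W 1))

theorem mk_eq {s t : FreeAlgebra k (Symbol ι W)} (h : Rel U s t) :
    RingQuot.mkAlgHom k (Rel U) s = RingQuot.mkAlgHom k (Rel U) t :=
  RingQuot.mkAlgHom_rel k h

/-- The matrix elements in the representation algebra. -/
noncomputable def elt {m : ℕ} (I J : Fin m → ι) : W m →ₗ[k] Alg k ι U where
  toFun a := RingQuot.mkAlgHom k (Rel U) (gen k I J a)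
  map_add' a a' := by rw [mk_eq U (.add I J a a'), map_add]
  map_smul' c a := by rw [mk_eq U (.smul I J c a), map_smul, RingHom.id_apply]

/-- The universal representation. -/
noncomputable def ev : WheelgebraHom k W (BaseChange k (Alg k ι U) (WEnd k V)) :=
  WheelgebraHom.ofEntry b (elt U)
    (fun σ τ a I J => mk_eq U (.act σ τ a I J))
    (fun i j a I J => (mk_eq U (.contr i j a I J)).trans (map_sum _ _ _))
    (fun I J => (mk_eq U (.one I J)).trans (map_one _))
    (fun a a' I J => (mk_eq U (.mul a a' I J)).trans (map_mul _ _ _))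

theorem entry_ev {m : ℕ} (I J : Fin m → ι) (a : W m) :
    (ev b U).entry b I J a = elt (k := k) U I J a :=
  WheelgebraHom.entry_ofEntry b _ _ _ _ _ I J a

/-- The relations in `Rel` are exactly the identities satisfied by the matrix elements of a
representation, so such matrix elements define a map from the quotient; it is unique because its
values on generators are forced. -/
theorem isRepresentationAlgebra_ev [FiniteDimensional k V] :
    IsRepresentationAlgebra.{u, v, w, x, max u v w} V U (ev (k := k) b U) := by
  constructor
  · rw [isRepresentation_iff_entry b]
    intro t ht I J
    rw [entry_ev]
    refine (mk_eq U (.unit t ht I J)).trans ?_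
    split_ifs <;> simp
  · intro B _ _ ρ hρ
    rw [isRepresentation_iff_entry b] at hρ
    simp only [app_eq_map_iff_entry b]
    let f : FreeAlgebra k (Symbol ι W) →ₐ[k] B :=
      FreeAlgebra.lift k fun s => ρ.entry b s.2.2.1 s.2.2.2 s.2.1
    have f_gen {m : ℕ} (I J : Fin m → ι) (a : W m) : f (gen k I J a) = ρ.entry b I J a :=
      FreeAlgebra.lift_ι_apply _ _
    have hf : ∀ ⦃s t⦄, Rel U s t → f s = f t := by
      intro s t h
      cases h with
      | add I J a a' => simp only [map_add, f_gen]
      | smul I J c a => simp only [map_smul, f_gen]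
      | act σ τ a I J => simp only [f_gen, ρ.entry_act b]
      | contr i j a I J => simp only [f_gen, map_sum, ρ.entry_contr b]
      | one I J => simp only [f_gen, map_one, ρ.entry_one b]
      | mul a a' I J => simp only [f_gen, map_mul, ρ.entry_mul b]
      | unit t ht I J =>
        rw [f_gen, hρ t ht]
        split_ifs <;> simp
    refine ⟨RingQuot.liftAlgHom k ⟨f, hf⟩, fun m a I J => ?_, fun ψ hψ => ?_⟩
    · rw [entry_ev]
      exact ((RingQuot.liftAlgHom_mkAlgHom_apply k f hf _).trans (f_gen I J a)).symm
    · refine RingQuot.ringQuot_ext' (S := k) (s := Rel U) _ _ (FreeAlgebra.hom_ext (funext ?_))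
      rintro ⟨m, a, I, J⟩
      have h := hψ m a I J
      rw [entry_ev] at h
      refine (h.symm.trans (f_gen I J a).symm).trans ?_
      exact (RingQuot.liftAlgHom_mkAlgHom_apply k f hf _).symm

end RepAlgebra

/-! ### Linear maps out of the representation algebra -/

theorem Fin.append_comp_blockSum {α : Type*} {m n m' n' : ℕ} (σ : Fin m ≃ Fin m')
    (σ' : Fin n ≃ Fin n') (f : Fin m' → α) (g : Fin n' → α) :
    Fin.append f g ∘ blockSum σ σ' = Fin.append (f ∘ σ) (g ∘ σ') := by
  funext a
  induction a using Fin.addCases <;> simp [blockSum]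

/-- Obtained from `Fin.removeNth_append_left`, since insertion inverts removal. It identifies the
words summed over when a contraction takes place inside a left factor. -/
theorem Fin.insertNth_append_left {α : Type*} {m n : ℕ} (i : Fin (m + 1)) (c : α) (f : Fin m → α)
    (g : Fin n → α) :
    (Fin.cast (Nat.succ_add m n) (Fin.castAdd n i)).insertNth (α := fun _ => α) c (Fin.append f g) ∘
        finCongr (Nat.succ_add m n) = Fin.append (i.insertNth (α := fun _ => α) c f) g := by
  have h := Fin.removeNth_append_left i (i.insertNth (α := fun _ => α) c f) g
  rw [Fin.removeNth_insertNth] at h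
  rw [← h]
  funext a
  have h' := Fin.insertNth_self_removeNth (α := fun _ => α)
    (Fin.cast (Nat.succ_add m n) (Fin.castAdd n i))
    (Fin.append (i.insertNth (α := fun _ => α) c f) g ∘ (finCongr (Nat.succ_add m n)).symm)
  have h'' : (Fin.append (i.insertNth (α := fun _ => α) c f) g ∘
      (finCongr (Nat.succ_add m n)).symm) (Fin.cast (Nat.succ_add m n) (Fin.castAdd n i)) = c := by
    simp
  rw [h''] at h'
  rw [h']
  simp

theorem Fin.insertNth_append_right {α : Type*} {m n : ℕ} (i : Fin (n + 1)) (c : α) (f : Fin m → α)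
    (g : Fin n → α) :
    Fin.insertNth (n := m + n) (α := fun _ => α) (Fin.natAdd m i) c (Fin.append f g) =
      (Fin.append f (i.insertNth (α := fun _ => α) c g) : Fin (m + (n + 1)) → α) := by
  have h := Fin.removeNth_append_right i f (i.insertNth (α := fun _ => α) c g)
  rw [Fin.removeNth_insertNth] at h
  rw [← h]
  have h' := Fin.insertNth_self_removeNth (n := m + n) (α := fun _ => α) (Fin.natAdd m i)
    (Fin.append f (i.insertNth (α := fun _ => α) c g) : Fin (m + (n + 1)) → α)
  have h'' : (Fin.append f (i.insertNth (α := fun _ => α) c g) : Fin (m + (n + 1)) → α)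
      (Fin.natAdd m i) = c := by
    rw [Fin.append_right]; simp
  rw [h''] at h'
  exact h'

theorem Fin.append_append_comp_finCongr {α : Type*} {m n p : ℕ} (f : Fin m → α) (g : Fin n → α)
    (h : Fin p → α) :
    Fin.append f (Fin.append g h) ∘ finCongr (Nat.add_assoc m n p) =
      Fin.append (Fin.append f g) h :=
  (Fin.append_assoc f g h).symm

/-! ### Permutations and contractions inside one factor of a product -/

section WheelIdentities

variable {k : Type u} [Field k] {W : ℕ → Type w} [∀ m, AddCommGroup (W m)] [∀ m, Module k (W m)]
  [Wheelgebra k W]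

theorem act_mul_left {m n m' : ℕ} (σ τ : Fin m ≃ Fin m') (a : W m) (a' : W n) :
    mul (k := k) (act (k := k) σ τ a) a' =
      act (k := k) (blockSum σ (Equiv.refl _)) (blockSum τ (Equiv.refl _)) (mul (k := k) a a') := by
  conv_lhs => rw [← act_refl (k := k) a']
  exact isWheelBilinear_mul.map_act σ τ _ _ a a'

theorem act_mul_right {m n n' : ℕ} (σ τ : Fin n ≃ Fin n') (a : W m) (a' : W n) :
    mul (k := k) a (act (k := k) σ τ a') =
      act (k := k) (blockSum (Equiv.refl _) σ) (blockSum (Equiv.refl _) τ) (mul (k := k) a a') := by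
  conv_lhs => rw [← act_refl (k := k) a]
  exact isWheelBilinear_mul.map_act _ _ σ τ a a'

theorem contr_mul_left {m n : ℕ} (i j : Fin (m + 1)) (a : W (m + 1)) (a' : W n) :
    mul (k := k) (contr (k := k) i j a) a' =
      contr (k := k) (Fin.cast (Nat.succ_add m n) (Fin.castAdd n i))
        (Fin.cast (Nat.succ_add m n) (Fin.castAdd n j))
        (recast k (Nat.succ_add m n) (mul (k := k) a a')) :=
  isWheelBilinear_mul.map_contr_left i j a a'

theorem contr_mul_right {m n : ℕ} (i j : Fin (n + 1)) (a : W m) (a' : W (n + 1)) :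
    mul (k := k) a (contr (k := k) i j a') =
      contr (k := k) (m := m + n) (Fin.natAdd m i) (Fin.natAdd m j) (mul (k := k) a a') :=
  isWheelBilinear_mul.map_contr_right i j a a'

end WheelIdentities

/-! ### Compatible families and right translation -/

section LinearMaps

variable {k : Type u} [Field k] {ι : Type v} [Fintype ι] [DecidableEq ι]
  {W : ℕ → Type w} [∀ m, AddCommGroup (W m)] [∀ m, Module k (W m)] [Wheelgebra k W]
  {P : Type y} [AddCommGroup P] [Module k P]

variable (k ι W P) in
/-- Families of linear functions of matrix elements. -/
abbrev EntryFamily := ∀ m : ℕ, (Fin m → ι) → (Fin m → ι) → W m →ₗ[k] P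

/-- The family `f` respects the linear relations between matrix elements. -/
structure IsCompatFamily (U : Set (W 1)) (f : EntryFamily k ι W P) : Prop where
  map_act : ∀ {m n : ℕ} (σ τ : Fin m ≃ Fin n) (a : W m) (I J : Fin n → ι),
    f n I J (act (k := k) σ τ a) = f m (I ∘ σ) (J ∘ τ) a
  map_contr : ∀ {m : ℕ} (i j : Fin (m + 1)) (a : W (m + 1)) (I J : Fin m → ι),
    f m I J (contr (k := k) i j a) = ∑ c, f (m + 1) (j.insertNth c I) (i.insertNth c J) a
  -- The relation `t_{pq} = δ_{pq}` generates a two-sided ideal, so a functional must respect it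
  -- between two arbitrary factors. The other relations need no such factors, because products
  -- commute with permutations and contractions in each argument.
  map_unit : ∀ t ∈ U, ∀ {m n : ℕ} (a : W m) (a' : W n) (I J : Fin m → ι) (p q : Fin 1 → ι)
    (I' J' : Fin n → ι),
    f (m + 1 + n) (Fin.append (Fin.append I p) I') (Fin.append (Fin.append J q) J')
        (mul (k := k) (mul (k := k) a t) a') =
      if p 0 = q 0 then f (m + n) (Fin.append I I') (Fin.append J J') (mul (k := k) a a') else 0

theorem IsCompatFamily.map_recast {U : Set (W 1)} {f : EntryFamily k ι W P}
    (hf : IsCompatFamily U f) {m n : ℕ} (h : m = n) (a : W m) (I J : Fin n → ι) :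
    f n I J (recast k h a) = f m (I ∘ finCongr h) (J ∘ finCongr h) a :=
  hf.map_act _ _ a I J

variable (k ι W P) in
/-- The space of compatible families. -/
def compatFamily (U : Set (W 1)) : Submodule k (EntryFamily k ι W P) where
  carrier := {f | IsCompatFamily U f}
  add_mem' {f g} hf hg :=
    { map_act := fun σ τ a I J => by
        simp only [Pi.add_apply, LinearMap.add_apply, hf.map_act, hg.map_act]
      map_contr := fun i j a I J => by
        simp only [Pi.add_apply, LinearMap.add_apply, hf.map_contr, hg.map_contr,
          Finset.sum_add_distrib]
      map_unit := fun t ht m n a a' I J p q I' J' => by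
        simp only [Pi.add_apply, LinearMap.add_apply, hf.map_unit t ht, hg.map_unit t ht]
        split_ifs <;> simp }
  zero_mem' :=
    { map_act := fun σ τ a I J => rfl
      map_contr := fun i j a I J => by simp
      map_unit := fun t ht m n a a' I J p q I' J' => by simp }
  smul_mem' c f hf :=
    { map_act := fun σ τ a I J => by
        simp only [Pi.smul_apply, LinearMap.smul_apply, hf.map_act]
      map_contr := fun i j a I J => by
        simp only [Pi.smul_apply, LinearMap.smul_apply, hf.map_contr, Finset.smul_sum]
      map_unit := fun t ht m n a a' I J p q I' J' => by
        simp only [Pi.smul_apply, LinearMap.smul_apply, hf.map_unit t ht]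
        split_ifs <;> simp }

/-- Right translation of a family by the matrix element of `a'` at `I'` and `J'`. -/
def EntryFamily.translate {n : ℕ} (I' J' : Fin n → ι) (a' : W n) (f : EntryFamily k ι W P) :
    EntryFamily k ι W P :=
  fun m I J => f (m + n) (Fin.append I I') (Fin.append J J') ∘ₗ (mul (k := k)).flip a'

/-- In `map_unit` the translating element `a'` is absorbed into the right-hand factor, which is
arbitrary; in the other fields it is carried along as a spectator. -/
theorem IsCompatFamily.translate {U : Set (W 1)} {f : EntryFamily k ι W P}
    (hf : IsCompatFamily U f) {n : ℕ} (I' J' : Fin n → ι) (a' : W n) :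
    IsCompatFamily U (f.translate I' J' a') where
  map_act σ τ a I J := by
    simp only [EntryFamily.translate, LinearMap.comp_apply, LinearMap.flip_apply]
    rw [act_mul_left, hf.map_act, Fin.append_comp_blockSum, Fin.append_comp_blockSum]
    rfl
  map_contr i j a I J := by
    simp only [EntryFamily.translate, LinearMap.comp_apply, LinearMap.flip_apply]
    rw [contr_mul_left, hf.map_contr]
    simp only [hf.map_recast, Fin.insertNth_append_left]
  map_unit t ht {m p} a c I J q q' I'' J'' := by
    simp only [EntryFamily.translate, LinearMap.comp_apply, LinearMap.flip_apply]
    have h := hf.map_unit t ht a (mul (k := k) c a') I J q q' (Fin.append I'' I')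
      (Fin.append J'' J')
    rw [← Wheelgebra.mul_assoc, ← Wheelgebra.mul_assoc, hf.map_recast, hf.map_recast] at h
    simpa only [Fin.append_append_comp_finCongr] using h

/-- Right translation as an operator on compatible families. -/
def translateEnd (U : Set (W 1)) {n : ℕ} (I' J' : Fin n → ι) :
    W n →ₗ[k] Module.End k (compatFamily k ι W P U) where
  toFun a' :=
    { toFun := fun f => ⟨EntryFamily.translate I' J' a' f.1, f.2.translate I' J' a'⟩
      map_add' := fun f g => rfl
      map_smul' := fun c f => rfl }
  map_add' a a' := by
    refine LinearMap.ext fun f => Subtype.ext ?_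
    funext m I J
    refine LinearMap.ext fun x => ?_
    change f.1 (m + n) _ _ (mul (k := k) x (a + a')) = _
    rw [map_add, map_add]
    rfl
  map_smul' c a := by
    refine LinearMap.ext fun f => Subtype.ext ?_
    funext m I J
    refine LinearMap.ext fun x => ?_
    change f.1 (m + n) _ _ (mul (k := k) x (c • a)) = _
    rw [map_smul, map_smul]
    rfl

theorem translateEnd_apply (U : Set (W 1)) {n : ℕ} (I' J' : Fin n → ι) (a' : W n)
    (f : compatFamily k ι W P U) {m : ℕ} (I J : Fin m → ι) (a : W m) :
    (translateEnd U I' J' a' f).1 m I J a =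
      f.1 (m + n) (Fin.append I I') (Fin.append J J') (mul (k := k) a a') := rfl

theorem compatFamily_end_ext (U : Set (W 1)) {s t : Module.End k (compatFamily k ι W P U)}
    (h : ∀ (f : compatFamily k ι W P U) (m : ℕ) (I J : Fin m → ι) (a : W m),
      (s f).1 m I J a = (t f).1 m I J a) : s = t :=
  LinearMap.ext fun f => Subtype.ext (funext fun m => funext fun I => funext fun J =>
    LinearMap.ext fun a => h f m I J a)

theorem Fin.append_of_isEmpty {α : Type*} {m : ℕ} (f : Fin m → α) (g : Fin 0 → α) :
    Fin.append f g = f := by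
  rw [show g = Fin.elim0 from Subsingleton.elim _ _, Fin.append_elim0]
  rfl

theorem Fin.append_castAdd_natAdd_comp {α : Type*} {m n : ℕ} (f : Fin (m + n) → α) :
    Fin.append (f ∘ Fin.castAdd n) (f ∘ Fin.natAdd m) = f :=
  Fin.append_castAdd_natAdd

variable {V : Type x} [AddCommGroup V] [Module k V] (b : Module.Basis ι k V)

/-- The action of `W` on compatible families, as a morphism to an endomorphism wheelgebra. -/
noncomputable def translateHom (U : Set (W 1)) :
    WheelgebraHom k W (BaseChange k (Module.End k (compatFamily k ι W P U)) (WEnd k V)) :=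
  WheelgebraHom.ofEntry b (translateEnd U)
    (fun σ τ a' I' J' => compatFamily_end_ext U fun f m I J a => by
      rw [translateEnd_apply, translateEnd_apply, act_mul_right, f.2.map_act,
        Fin.append_comp_blockSum, Fin.append_comp_blockSum]
      rfl)
    (fun i j a' I' J' => compatFamily_end_ext U fun f m I J a => by
      rw [translateEnd_apply, contr_mul_right, f.2.map_contr, LinearMap.sum_apply]
      rw [AddSubmonoidClass.coe_finsetSum]
      simp only [Finset.sum_apply, LinearMap.sum_apply, translateEnd_apply,
        Fin.insertNth_append_right]
      rfl)
    (fun I' J' => compatFamily_end_ext U fun f m I J a => by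
      rw [translateEnd_apply, Wheelgebra.mul_one, Fin.append_of_isEmpty, Fin.append_of_isEmpty]
      rfl)
    -- Translating by `a''` and then by `a'` evaluates `f` at `(a a') a''`, so right translation is
    -- a homomorphism and not an antihomomorphism.
    (fun a' a'' I' J' => compatFamily_end_ext U fun f m I J a => by
      rw [Module.End.mul_apply]
      simp only [translateEnd_apply]
      rw [← Wheelgebra.mul_assoc, f.2.map_recast]
      conv_lhs => rw [← Fin.append_castAdd_natAdd_comp I', ← Fin.append_castAdd_natAdd_comp J']
      simp only [Fin.append_append_comp_finCongr])

theorem isRepresentation_translateHom [FiniteDimensional k V] (U : Set (W 1)) :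
    IsRepresentation V U (translateHom (P := P) b U) := by
  rw [isRepresentation_iff_entry b]
  intro t ht I' J'
  rw [translateHom, WheelgebraHom.entry_ofEntry]
  refine compatFamily_end_ext U fun f m I J a => ?_
  rw [translateEnd_apply]
  -- With trivial right factor, `map_unit` says that translation by `t_{pq}` is the scalar `δ_{pq}`.
  have h := f.2.map_unit t ht a (Wheelgebra.one k) I J I' J' Fin.elim0 Fin.elim0
  rw [Wheelgebra.mul_one, Wheelgebra.mul_one] at h
  simp only [Fin.append_of_isEmpty] at h
  refine h.trans ?_
  split_ifs <;> rfl

end LinearMaps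

/-! ### Linear maps and spanning sets from the universal property -/

section UniversalProperty

variable {k : Type u} [Field k] {V : Type v} [AddCommGroup V] [Module k V]
  [FiniteDimensional k V] {ι : Type v} [Fintype ι] [DecidableEq ι] (b : Module.Basis ι k V)
  {W : ℕ → Type w} [∀ m, AddCommGroup (W m)] [∀ m, Module k (W m)] [Wheelgebra k W]
  {U : Set (W 1)} {R : Type z} [Ring R] [Algebra k R]
  {ev : WheelgebraHom k W (BaseChange k R (WEnd k V))}

/-- Compatible families define linear maps on the representation algebra. -/
theorem IsRepresentationAlgebra.exists_linearMap {P : Type y} [AddCommGroup P] [Module k P]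
    (hev : IsRepresentationAlgebra.{u, v, w, max v w y, z} V U ev) {f : EntryFamily k ι W P}
    (hf : IsCompatFamily U f) :
    ∃ L : R →ₗ[k] P, ∀ (m : ℕ) (I J : Fin m → ι) (a : W m), L (ev.entry b I J a) = f m I J a := by
  obtain ⟨φ, hφ, -⟩ := hev.2 _ (translateHom b U) (isRepresentation_translateHom (P := P) b U)
  -- `R` acts on compatible families through `φ`. Acting on `f` and evaluating at `1 ∈ W 0` sends
  -- `a_{IJ}` to the value of `f` at `1 · a = a`.
  refine ⟨{ toFun := fun r => (φ r ⟨f, hf⟩).1 0 Fin.elim0 Fin.elim0 (Wheelgebra.one k)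
            map_add' := fun r r' => by rw [map_add]; rfl
            map_smul' := fun c r => by rw [map_smul]; rfl }, fun m I J a => ?_⟩
  have h := (app_eq_map_iff_entry b φ.toLinearMap ev (translateHom b U) a a).1 (hφ m a) I J
  rw [translateHom, WheelgebraHom.entry_ofEntry] at h
  simp only [LinearMap.coe_mk, AddHom.coe_mk]
  rw [show φ (ev.entry b I J a) = translateEnd U I J a from h.symm, translateEnd_apply]
  conv_rhs => rw [← Wheelgebra.one_mul (k := k) a, hf.map_recast]
  rw [Fin.elim0_append, Fin.elim0_append]
  rfl

/-- The representation algebra is spanned by the matrix elements. -/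
theorem IsRepresentationAlgebra.span_entry
    (hev : IsRepresentationAlgebra.{u, v, w, z, z} V U ev) :
    Submodule.span k {r : R | ∃ (m : ℕ) (I J : Fin m → ι) (a : W m), ev.entry b I J a = r} = ⊤ := by
  set S := Submodule.span k {r : R | ∃ (m : ℕ) (I J : Fin m → ι) (a : W m), ev.entry b I J a = r}
    with hS
  have mem {m : ℕ} (I J : Fin m → ι) (a : W m) : ev.entry b I J a ∈ S :=
    Submodule.subset_span ⟨m, I, J, a, rfl⟩
  -- The span is a subalgebra by `entry_mul_append`, so `ev` factors through it as a representation
  -- `ρ`.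
  let S' : Subalgebra k R := S.toSubalgebra
    (by rw [← ev.entry_one b Fin.elim0 Fin.elim0]; exact mem _ _ _)
    (by
      intro r r' hr hr'
      refine Submodule.span_induction₂ (p := fun r r' _ _ => r * r' ∈ S) ?_ ?_ ?_ ?_ ?_ ?_ ?_ hr hr'
      · rintro _ _ ⟨m, I, J, a, rfl⟩ ⟨n, I', J', a', rfl⟩
        rw [← ev.entry_mul_append]
        exact mem _ _ _
      · intros; rw [zero_mul]; exact S.zero_mem
      · intros; rw [mul_zero]; exact S.zero_mem
      · intro _ _ _ _ _ _ h h'; rw [add_mul]; exact S.add_mem h h'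
      · intro _ _ _ _ _ _ h h'; rw [mul_add]; exact S.add_mem h h'
      · intro c _ _ _ _ h; rw [smul_mul_assoc]; exact S.smul_mem c h
      · intro c _ _ _ _ h; rw [mul_smul_comm]; exact S.smul_mem c h)
  let ρ : WheelgebraHom k W (BaseChange k S' (WEnd k V)) :=
    WheelgebraHom.ofEntry b (fun I J => (ev.entry b I J).codRestrict S fun a => mem I J a)
      (fun σ τ a I J => Subtype.ext (ev.entry_act b σ τ a I J))
      (fun i j a I J => Subtype.ext <| (ev.entry_contr b i j a I J).trans <|
        (map_sum S'.val
          (fun c => (⟨_, mem (j.insertNth c I) (i.insertNth c J) a⟩ : S')) Finset.univ).symm)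
      (fun I J => Subtype.ext (ev.entry_one b I J))
      (fun a a' I J => Subtype.ext (ev.entry_mul b a a' I J))
  have hρ (m : ℕ) (I J : Fin m → ι) (a : W m) : (ρ.entry b I J a : R) = ev.entry b I J a :=
    congrArg Subtype.val (WheelgebraHom.entry_ofEntry b _ _ _ _ _ I J a)
  have hrep := (isRepresentation_iff_entry b U ev).1 hev.1
  obtain ⟨φ, hφ, -⟩ := hev.2 S' ρ <| (isRepresentation_iff_entry b U ρ).2 fun t ht I J => by
    refine Subtype.ext ((hρ _ _ _ _).trans ((hrep t ht I J).trans ?_))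
    split_ifs <;> rfl
  -- Both maps carry `ev` to `ev`, so uniqueness identifies them, and every element of `R` lies in
  -- `S'`.
  have h : S'.val.comp φ = AlgHom.id k R := by
    refine (hev.2 R ev hev.1).unique (fun m a => ?_) fun m a => ?_
    · rw [app_eq_map_iff_entry b]
      intro I J
      exact (hρ m I J a).symm.trans (congrArg Subtype.val
        ((app_eq_map_iff_entry b φ.toLinearMap ev ρ a a).1 (hφ m a) I J))
    · rw [app_eq_map_iff_entry b]
      intro I J
      rfl
  rw [eq_top_iff]
  intro r _
  have := congrArg (fun ψ => ψ r) h
  exact (show (φ r : R) = r from this) ▸ (φ r).2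

end UniversalProperty

/-! ### The action of the general linear group -/

section GeneralLinear

variable {k : Type u} [Field k] {V : Type v} [AddCommGroup V] [Module k V]

local notation "GL" => LinearMap.GeneralLinearGroup k V

namespace WEnd

variable (k V) in
theorem gl_pure (g : GL) {m : ℕ} (f : Fin m → V) (f' : Fin m → Module.Dual k V) :
    gl k V g m (pure k V f f') =
      pure k V (fun a => (g : V →ₗ[k] V) (f a))
        (fun a => f' a ∘ₗ ((g⁻¹ : GL) : V →ₗ[k] V)) := by
  unfold gl pure
  erw [TensorProduct.map_tmul]
  erw [PiTensorProduct.map_tprod, PiTensorProduct.map_tprod]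
  rfl

theorem inv_apply_apply (g : GL) (x : V) :
    ((g⁻¹ : GL) : V →ₗ[k] V) ((g : V →ₗ[k] V) x) = x :=
  LinearMap.congr_fun (Units.inv_mul g) x

theorem gl_act (g : GL) {m n : ℕ} (σ τ : Fin m ≃ Fin n) (a : WEnd k V m) :
    gl k V g n (act (k := k) σ τ a) = act (k := k) σ τ (gl k V g m a) := by
  induction a using WEnd.induction with
  | hp f f' => rw [act_pure, gl_pure, gl_pure, act_pure]; rfl
  | hs c a h => simp only [map_smul, h]
  | ha a a' h h' => simp only [map_add, h, h']

theorem gl_contr (g : GL) {m : ℕ} (i j : Fin (m + 1)) (a : WEnd k V (m + 1)) :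
    gl k V g m (contr (k := k) i j a) = contr (k := k) i j (gl k V g (m + 1) a) := by
  induction a using WEnd.induction with
  | hp f f' =>
    rw [contr_pure, map_smul, gl_pure, gl_pure, contr_pure, LinearMap.comp_apply, inv_apply_apply]
    rfl
  | hs c a h => simp only [map_smul, h]
  | ha a a' h h' => simp only [map_add, h, h']

theorem gl_mul (g : GL) {m n : ℕ} (a : WEnd k V m) (a' : WEnd k V n) :
    gl k V g (m + n) (mul (k := k) a a') = mul (k := k) (gl k V g m a) (gl k V g n a') := by
  have mul_pure {m n : ℕ} (f f' h h') : mul (k := k) (pure k V (m := m) f f')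
      (pure k V (m := n) h h') = pure k V (Fin.append f h) (Fin.append f' h') :=
    prod_pure k V f f' h h'
  induction a using WEnd.induction with
  | hp f f' =>
    induction a' using WEnd.induction with
    | hp h h' =>
      rw [mul_pure, gl_pure, gl_pure, gl_pure, mul_pure]
      congr 1 <;> (funext i; induction i using Fin.addCases <;> simp)
    | hs c a h => simp only [map_smul, h]
    | ha a a' h h' => simp only [map_add, h, h']
  | hs c a h => simp only [map_smul, LinearMap.smul_apply, h]
  | ha a a' h h' => simp only [map_add, LinearMap.add_apply, h, h']

theorem gl_one (g : GL) : gl k V g 0 (one k) = one k := by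
  have h : (one k : WEnd k V 0) = pure k V Fin.elim0 Fin.elim0 := rfl
  rw [h, gl_pure]
  congr 1 <;> exact Subsingleton.elim _ _

theorem gl_group_mul (g h : GL) {m : ℕ} (a : WEnd k V m) :
    gl k V (g * h) m a = gl k V g m (gl k V h m a) := by
  induction a using WEnd.induction with
  | hp f f' =>
    rw [gl_pure, gl_pure, gl_pure, mul_inv_rev]
    rfl
  | hs c a h => simp only [map_smul, h]
  | ha a a' h h' => simp only [map_add, h, h']

theorem gl_group_one {m : ℕ} (a : WEnd k V m) : gl k V 1 m a = a := by
  induction a using WEnd.induction with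
  | hp f f' =>
    rw [gl_pure, inv_one]
    rfl
  | hs c a h => simp only [map_smul, h]
  | ha a a' h h' => simp only [map_add, h, h']

/-- The freedom to choose the basis is what makes the identity invariant under `GL(V)`. -/
theorem idElem_eq_sum [FiniteDimensional k V] {ι : Type*} [Fintype ι] [DecidableEq ι]
    (b : Module.Basis ι k V) :
    idElem k V = ∑ i, pure k V (fun _ : Fin 1 => b i) (fun _ : Fin 1 => b.coord i) := by
  refine coord_ext b fun I J => ?_
  rw [coord_idElem, map_sum]
  simp only [coord_pure, Finset.univ_unique, Finset.prod_singleton, Fin.default_eq_zero,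
    Module.Basis.coord_apply, Module.Basis.repr_self, Finsupp.single_apply]
  rw [Finset.sum_eq_single (J 0)] <;> simp +contextual [eq_comm]

theorem gl_idElem [FiniteDimensional k V] (g : GL) : gl k V g 1 (idElem k V) = idElem k V := by
  classical
  let b := Module.finBasis k V
  let e : V ≃ₗ[k] V := LinearMap.GeneralLinearGroup.generalLinearEquiv k V g
  conv_lhs => rw [idElem_eq_sum b, map_sum]
  -- The element `g` takes `b` and its dual basis to `b.map e` and its dual basis, so the two sums
  -- agree term by term.
  rw [idElem_eq_sum (b.map e)]
  refine Finset.sum_congr rfl fun i _ => ?_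
  rw [gl_pure]
  rfl

end WEnd

namespace BaseChange

variable {A : Type x} [Ring A] [Algebra k A] {A' : Type y} [Ring A'] [Algebra k A']
  {W : ℕ → Type w} [∀ m, AddCommGroup (W m)] [∀ m, Module k (W m)]

theorem map_pure (φ : A →ₗ[k] A') {m : ℕ} (r : A) (a : W m) :
    map k W φ m (pure r a) = pure (φ r) a := rfl

theorem map_lift (φ : A →ₗ[k] A') {m n : ℕ} (f : W m →ₗ[k] W n) (a : BaseChange k A W m) :
    map k W φ n (lift k A f a) = lift k A' f (map k W φ m a) := by
  induction a using BaseChange.induction with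
  | hp r a => rfl
  | ha a a' h h' => simp only [map_add, h, h']

variable [Wheelgebra k W]

theorem map_act (φ : A →ₗ[k] A') {m n : ℕ} (σ τ : Fin m ≃ Fin n) (a : BaseChange k A W m) :
    map k W φ n (act (k := k) σ τ a) = act (k := k) σ τ (map k W φ m a) :=
  map_lift φ _ a

theorem map_contr (φ : A →ₗ[k] A') {m : ℕ} (i j : Fin (m + 1)) (a : BaseChange k A W (m + 1)) :
    map k W φ m (contr (k := k) i j a) = contr (k := k) i j (map k W φ (m + 1) a) :=
  map_lift φ _ a

theorem map_mul (φ : A →ₐ[k] A') {m n : ℕ} (a : BaseChange k A W m) (a' : BaseChange k A W n) :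
    map k W φ.toLinearMap (m + n) (mul (k := k) a a') =
      mul (k := k) (map k W φ.toLinearMap m a) (map k W φ.toLinearMap n a') := by
  induction a using BaseChange.induction with
  | hp r a =>
    induction a' using BaseChange.induction with
    | hp r' a' => exact congrArg (pure · _) (_root_.map_mul φ r r')
    | ha a a' h h' => simp only [map_add, h, h']
  | ha a a' h h' => simp only [map_add, LinearMap.add_apply, h, h']

theorem map_one (φ : A →ₐ[k] A') :
    map k W φ.toLinearMap 0 (one k : BaseChange k A W 0) = one k :=
  congrArg (pure · _) (_root_.map_one φ)

variable (A) in
/-- The action of `GL(V)` on the second factor of `A ⊗ WEnd V`. -/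
noncomputable def gl (g : GL) (m : ℕ) :
    BaseChange k A (WEnd k V) m →ₗ[k] BaseChange k A (WEnd k V) m :=
  lift k A (WEnd.gl k V g m)

theorem gl_act (g : GL) {m n : ℕ} (σ τ : Fin m ≃ Fin n) (a : BaseChange k A (WEnd k V) m) :
    gl A g n (act (k := k) σ τ a) = act (k := k) σ τ (gl A g m a) := by
  induction a using BaseChange.induction with
  | hp r a => exact congrArg (pure r) (WEnd.gl_act g σ τ a)
  | ha a a' h h' => simp only [map_add, h, h']

theorem gl_contr (g : GL) {m : ℕ} (i j : Fin (m + 1)) (a : BaseChange k A (WEnd k V) (m + 1)) :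
    gl A g m (contr (k := k) i j a) = contr (k := k) i j (gl A g (m + 1) a) := by
  induction a using BaseChange.induction with
  | hp r a => exact congrArg (pure r) (WEnd.gl_contr g i j a)
  | ha a a' h h' => simp only [map_add, h, h']

theorem gl_mul (g : GL) {m n : ℕ} (a : BaseChange k A (WEnd k V) m)
    (a' : BaseChange k A (WEnd k V) n) :
    gl A g (m + n) (mul (k := k) a a') = mul (k := k) (gl A g m a) (gl A g n a') := by
  induction a using BaseChange.induction with
  | hp r a =>
    induction a' using BaseChange.induction with
    | hp r' a' => exact congrArg (pure _) (WEnd.gl_mul g a a')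
    | ha a a' h h' => simp only [map_add, h, h']
  | ha a a' h h' => simp only [map_add, LinearMap.add_apply, h, h']

theorem gl_one (g : GL) : gl A g 0 (one k) = one k :=
  congrArg (pure _) (WEnd.gl_one g)

theorem gl_idElem [FiniteDimensional k V] (g : GL) :
    gl A g 1 (pure 1 (WEnd.idElem k V)) = pure 1 (WEnd.idElem k V) :=
  congrArg (pure _) (WEnd.gl_idElem g)

theorem gl_group_mul (g h : GL) {m : ℕ} (a : BaseChange k A (WEnd k V) m) :
    gl A (g * h) m a = gl A g m (gl A h m a) := by
  induction a using BaseChange.induction with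
  | hp r a => exact congrArg (pure r) (WEnd.gl_group_mul g h a)
  | ha a a' h h' => simp only [map_add, h, h']

theorem gl_group_one {m : ℕ} (a : BaseChange k A (WEnd k V) m) : gl A 1 m a = a := by
  induction a using BaseChange.induction with
  | hp r a => exact congrArg (pure r) (WEnd.gl_group_one a)
  | ha a a' h h' => simp only [map_add, h, h']

theorem map_gl (φ : A →ₗ[k] A') (g : GL) {m : ℕ} (a : BaseChange k A (WEnd k V) m) :
    map k (WEnd k V) φ m (gl A g m a) = gl A' g m (map k (WEnd k V) φ m a) :=
  map_lift φ _ a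

theorem map_comp {A'' : Type z} [Ring A''] [Algebra k A''] (φ : A →ₗ[k] A') (ψ : A' →ₗ[k] A'')
    {m : ℕ} (a : BaseChange k A W m) :
    map k W ψ m (map k W φ m a) = map k W (ψ ∘ₗ φ) m a := by
  induction a using BaseChange.induction with
  | hp r a => rfl
  | ha a a' h h' => simp only [map_add, h, h']

theorem map_id {m : ℕ} (a : BaseChange k A W m) : map k W LinearMap.id m a = a := by
  induction a using BaseChange.induction with
  | hp r a => rfl
  | ha a a' h h' => simp only [map_add, h, h']

end BaseChange

variable {W : ℕ → Type w} [∀ m, AddCommGroup (W m)] [∀ m, Module k (W m)] [Wheelgebra k W]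

/-- The composite of a morphism `W → A ⊗ WEnd V` and the action of an element of `GL(V)`. -/
noncomputable def WheelgebraHom.glComp {A : Type x} [Ring A] [Algebra k A]
    (ρ : WheelgebraHom k W (BaseChange k A (WEnd k V))) (g : GL) :
    WheelgebraHom k W (BaseChange k A (WEnd k V)) where
  app m := BaseChange.gl A g m ∘ₗ ρ.app m
  map_act σ τ a := by
    simp only [LinearMap.comp_apply, ρ.map_act, BaseChange.gl_act]
  map_contr i j a := by
    simp only [LinearMap.comp_apply, ρ.map_contr, BaseChange.gl_contr]
  map_one := by
    simp only [LinearMap.comp_apply, ρ.map_one, BaseChange.gl_one]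
  map_mul a a' := by
    simp only [LinearMap.comp_apply, ρ.map_mul, BaseChange.gl_mul]

/-! ### Invariants form a sub-wheelgebra -/

section Invariants

variable {R : Type y} [Ring R] [Algebra k R]

theorem isGLInvariant_iff (Θ : GL →* (R ≃ₐ[k] R)) {m : ℕ} (a : BaseChange k R (WEnd k V) m) :
    IsGLInvariant V Θ a ↔
      ∀ g : GL, BaseChange.map k (WEnd k V) (Θ g).toLinearMap m (BaseChange.gl R g m a) = a :=
  Iff.rfl

/-- Both `Θ g` on coefficients and `g` on tensors respect every wheelgebra operation, so invariance
passes to everything generated by invariants. -/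
theorem isGLInvariant_of_wheelGenerated [FiniteDimensional k V] (Θ : GL →* (R ≃ₐ[k] R))
    {S : ∀ m, Set (BaseChange k R (WEnd k V) m)}
    (hS : ∀ m, ∀ a ∈ S m, IsGLInvariant V Θ a) {m : ℕ} {a : BaseChange k R (WEnd k V) m}
    (ha : WheelGenerated k S m a) : IsGLInvariant V Θ a := by
  rw [isGLInvariant_iff]
  intro g
  have hΘ : (Θ g).toLinearMap = ((Θ g : R →ₐ[k] R)).toLinearMap := rfl
  induction ha with
  | mem h => exact hS _ _ h g
  | zero => rw [map_zero, map_zero]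
  | add _ _ h h' => rw [map_add, map_add, h, h']
  | smul c _ h => rw [map_smul, map_smul, h]
  | act σ τ _ h => rw [BaseChange.gl_act, BaseChange.map_act, h]
  | contr i j _ h => rw [BaseChange.gl_contr, BaseChange.map_contr, h]
  | one => rw [BaseChange.gl_one, hΘ, BaseChange.map_one]
  | mul _ _ h h' => rw [BaseChange.gl_mul, hΘ, BaseChange.map_mul, ← hΘ, h, h']

theorem isGLInvariant_identitySet [FiniteDimensional k V] (Θ : GL →* (R ≃ₐ[k] R)) :
    ∀ (m : ℕ) (a : BaseChange k R (WEnd k V) m), a ∈ identitySet k V R m → IsGLInvariant V Θ a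
  | 0, _, ha => ha.elim
  | 1, a, ha => by
    rw [show a = BaseChange.pure 1 (WEnd.idElem k V) from ha, isGLInvariant_iff]
    intro g
    rw [BaseChange.gl_idElem, BaseChange.map_pure]
    exact congrArg (BaseChange.pure · _) (_root_.map_one (Θ g))
  | (_ + 2), _, ha => ha.elim

end Invariants

/-! ### The action on the representation algebra -/

section Action

variable [FiniteDimensional k V] {U : Set (W 1)} {R : Type y} [Ring R] [Algebra k R]
  {ev : WheelgebraHom k W (BaseChange k R (WEnd k V))}

/-- Invariance of `ev` forces `g` to act on coefficients as `g⁻¹` acts on tensors. Since `g⁻¹` acts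
on `WEnd V` by automorphisms fixing the identity, `ev.glComp g⁻¹` is a representation, and the
universal property supplies exactly one such endomorphism of `R`. -/
theorem IsRepresentationAlgebra.exists_action
    (hev : IsRepresentationAlgebra.{u, v, w, y, y} V U ev) :
    ∃ Θ : GL →* (R ≃ₐ[k] R), IsCompatibleAction V ev Θ ∧
      ∀ Θ' : GL →* (R ≃ₐ[k] R), IsCompatibleAction V ev Θ' → Θ' = Θ := by
  have hrep (g : GL) : IsRepresentation V U (ev.glComp g) := fun t ht => by
    change BaseChange.gl R g 1 (ev.app 1 t) = _
    rw [hev.1 t ht, BaseChange.gl_idElem]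
  choose φ hφ hφu using fun g : GL => hev.2 R (ev.glComp g⁻¹) (hrep g⁻¹)
  replace hφ (g : GL) {m : ℕ} (a : W m) :
      BaseChange.map k (WEnd k V) (φ g).toLinearMap m (ev.app m a) =
        BaseChange.gl R g⁻¹ m (ev.app m a) := (hφ g m a).symm
  have ext {ψ ψ' : R →ₐ[k] R} {g : GL}
      (h : ∀ (m : ℕ) (a : W m), BaseChange.map k (WEnd k V) ψ.toLinearMap m (ev.app m a) =
        BaseChange.gl R g⁻¹ m (ev.app m a))
      (h' : ∀ (m : ℕ) (a : W m), BaseChange.map k (WEnd k V) ψ'.toLinearMap m (ev.app m a) =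
        BaseChange.gl R g⁻¹ m (ev.app m a)) : ψ = ψ' :=
    (hφu g ψ fun m a => (h m a).symm).trans (hφu g ψ' fun m a => (h' m a).symm).symm
  have h_one : φ 1 = AlgHom.id k R := by
    refine ext (g := 1) (fun m a => hφ 1 a) fun m a => ?_
    rw [inv_one, BaseChange.gl_group_one]
    exact BaseChange.map_id _
  -- Operators on coefficients commute with operators on tensors, which reverses the order of
  -- composition; the inverse in `glComp g⁻¹` reverses it back.
  have h_mul (g h : GL) : φ (g * h) = (φ g).comp (φ h) := by
    refine ext (g := g * h) (fun m a => hφ _ a) fun m a => ?_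
    have := BaseChange.map_comp (φ h).toLinearMap (φ g).toLinearMap (ev.app m a)
    refine this.symm.trans ?_
    rw [hφ, BaseChange.map_gl, hφ, mul_inv_rev, BaseChange.gl_group_mul]
  let Θ : GL →* (R ≃ₐ[k] R) :=
    { toFun := fun g => AlgEquiv.ofAlgHom (φ g) (φ g⁻¹)
        (by rw [← h_mul, mul_inv_cancel, h_one]) (by rw [← h_mul, inv_mul_cancel, h_one])
      map_one' := AlgEquiv.ext fun r => congrArg (fun ψ => ψ r) h_one
      map_mul' := fun g h => AlgEquiv.ext fun r => congrArg (fun ψ => ψ r) (h_mul g h) }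
  refine ⟨Θ, fun m a g => ?_, fun Θ' hΘ' => ?_⟩
  · change BaseChange.map k (WEnd k V) (φ g).toLinearMap m (BaseChange.gl R g m (ev.app m a)) = _
    rw [BaseChange.map_gl, hφ, ← BaseChange.gl_group_mul, mul_inv_cancel, BaseChange.gl_group_one]
  · refine MonoidHom.ext fun g => AlgEquiv.ext fun r => ?_
    have : ((Θ' g : R ≃ₐ[k] R) : R →ₐ[k] R) = φ g := by
      refine ext (g := g) (fun m a => ?_) fun m a => hφ g a
      have h := congrArg (BaseChange.gl R g⁻¹ m) (hΘ' m a g)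
      change BaseChange.gl R g⁻¹ m (BaseChange.map k (WEnd k V) (Θ' g).toLinearMap m
        (BaseChange.gl R g m (ev.app m a))) = _ at h
      rw [← h, ← BaseChange.map_gl, ← BaseChange.gl_group_mul, inv_mul_cancel,
        BaseChange.gl_group_one]
      rfl
    exact congrArg (fun ψ => ψ r) this

end Action

end GeneralLinear

/-! ### The Fischer pairing -/

namespace MvPolynomial

variable {k : Type u} [Field k] {σ : Type*} [Fintype σ] [DecidableEq σ]

/-- The Fischer pairing `∑ α! p_α q_α` of polynomials. -/
noncomputable def fischer (q : MvPolynomial σ k) : MvPolynomial σ k →ₗ[k] k :=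
  (basisMonomials σ k).constr k fun α => (∏ i, ((α i).factorial : k)) * coeff α q

theorem fischer_monomial (q : MvPolynomial σ k) (α : σ →₀ ℕ) :
    fischer q (monomial α 1) = (∏ i, ((α i).factorial : k)) * coeff α q := by
  have h := (basisMonomials σ k).constr_basis k
    (fun α => (∏ i, ((α i).factorial : k)) * coeff α q) α
  rwa [coe_basisMonomials] at h

theorem fischer_one (q : MvPolynomial σ k) : fischer q 1 = coeff 0 q := by
  rw [show (1 : MvPolynomial σ k) = monomial 0 1 from rfl, fischer_monomial]
  simp

/-- Multiplication by a variable is adjoint to differentiation: the factor `α_i + 1` produced by the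
derivative is the quotient of `(α_i + 1)!` by `α_i !`. This is the purpose of the factorial weights.
-/
theorem fischer_mul_X (p q : MvPolynomial σ k) (i : σ) :
    fischer q (p * X i) = fischer (pderiv i q) p := by
  induction p using MvPolynomial.induction_on' with
  | add p p' h h' => rw [add_mul, map_add, map_add, h, h']
  | monomial α c =>
    rw [X, monomial_mul, _root_.mul_one, ← _root_.mul_one c, ← smul_eq_mul, ← smul_monomial,
      ← smul_monomial,
      map_smul, map_smul, fischer_monomial, fischer_monomial, coeff_pderiv]
    congr 1
    rw [← Finset.mul_prod_erase _ _ (Finset.mem_univ i),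
      ← Finset.mul_prod_erase _ _ (Finset.mem_univ i)]
    have : ∀ j ∈ Finset.univ.erase i,
        (((α + Finsupp.single i 1 : σ →₀ ℕ) j).factorial : k) = ((α j).factorial : k) := by
      intro j hj
      rw [Finsupp.add_apply, Finsupp.single_eq_of_ne (Finset.ne_of_mem_erase hj), add_zero]
    rw [Finset.prod_congr rfl this]
    simp only [Finsupp.add_apply, Finsupp.single_eq_same, Nat.factorial_succ, Nat.cast_mul,
      Nat.cast_add, Nat.cast_one]
    ring

theorem fischer_add_left (q q' p : MvPolynomial σ k) :
    fischer (q + q') p = fischer q p + fischer q' p := by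
  induction p using MvPolynomial.induction_on' with
  | add p p' h h' => simp only [map_add, h, h']; ring
  | monomial α c =>
    rw [← _root_.mul_one c, ← smul_eq_mul, ← smul_monomial, map_smul, map_smul, map_smul,
      fischer_monomial, fischer_monomial, fischer_monomial, coeff_add]
    simp only [smul_eq_mul]
    ring

theorem fischer_smul_left (c : k) (q p : MvPolynomial σ k) :
    fischer (c • q) p = c * fischer q p := by
  induction p using MvPolynomial.induction_on' with
  | add p p' h h' => simp only [map_add, h, h']; ring
  | monomial α d =>
    rw [← _root_.mul_one d, ← smul_eq_mul, ← smul_monomial, map_smul, map_smul,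
      fischer_monomial, fischer_monomial, coeff_smul]
    simp only [smul_eq_mul]
    ring

theorem fischer_sum_left {κ : Type*} (s : Finset κ) (q : κ → MvPolynomial σ k)
    (p : MvPolynomial σ k) : fischer (∑ j ∈ s, q j) p = ∑ j ∈ s, fischer (q j) p := by
  classical
  induction s using Finset.induction_on with
  | empty =>
    have := fischer_smul_left (0 : k) 0 p
    rw [zero_smul, zero_mul] at this
    simpa using this
  | insert j s hj h => rw [Finset.sum_insert hj, Finset.sum_insert hj, fischer_add_left, h]

/-- For integer coefficients the value is the image of the integer `∑ α! q_α²`, which is positive.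
Over a general field `k` a sum of squares could vanish, hence the restriction to polynomials defined
over `ℤ`. -/
theorem fischer_self_ne_zero [CharZero k] {q : MvPolynomial σ ℤ} (hq : q ≠ 0) :
    fischer (map (Int.castRingHom k) q) (map (Int.castRingHom k) q) ≠ 0 := by
  have h : fischer (map (Int.castRingHom k) q) (map (Int.castRingHom k) q) =
      ((∑ α ∈ q.support, (∏ i, ((α i).factorial : ℤ)) * coeff α q ^ 2 : ℤ) : k) := by
    conv_lhs => enter [2]; rw [q.as_sum, map_sum]
    rw [map_sum, Int.cast_sum]
    refine Finset.sum_congr rfl fun α _ => ?_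
    rw [map_monomial, ← _root_.mul_one ((Int.castRingHom k) (coeff α q)), ← smul_eq_mul,
      ← smul_monomial,
      map_smul, fischer_monomial, coeff_map]
    simp only [smul_eq_mul, eq_intCast, Int.cast_mul, Int.cast_pow, Int.cast_prod, Int.cast_natCast]
    ring
  rw [h, Int.cast_ne_zero]
  refine ne_of_gt (Finset.sum_pos (fun α hα => ?_) (support_nonempty.2 hq))
  refine mul_pos (Finset.prod_pos fun i _ => ?_) ?_
  · exact_mod_cast Nat.factorial_pos _
  · exact (sq_pos_of_ne_zero (mem_support_iff.1 hα))
end MvPolynomial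

/-! ### The generic matrix and Cayley's `Ω` process -/

section GenericMatrix

open MvPolynomial Matrix

variable {k : Type u} [Field k] {ι : Type*} [Fintype ι] [DecidableEq ι]

/-- The substitution of `h * X` for the generic matrix `X`. -/
noncomputable def substMul (h : Matrix ι ι k) :
    MvPolynomial (ι × ι) k →ₐ[k] MvPolynomial (ι × ι) k :=
  aeval fun p => (h.map C * mvPolynomialX ι ι k : Matrix ι ι (MvPolynomial (ι × ι) k)) p.1 p.2

theorem substMul_X (h : Matrix ι ι k) (i j : ι) :
    substMul h (X (i, j)) = ∑ l, C (h i l) * X (l, j) := by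
  simp [substMul, Matrix.mul_apply]

theorem substMul_mvPolynomialX (h : Matrix ι ι k) :
    (substMul h).mapMatrix (mvPolynomialX ι ι k) = h.map C * mvPolynomialX ι ι k := by
  ext1 i j
  simp [substMul]

theorem substMul_C (h : Matrix ι ι k) (c : k) : substMul h (C c) = C c :=
  (substMul h).commutes c

/-- The chain rule. With the transpose, the coefficients `h i l` are those of `substMul_X`, so that
multiplication by a substituted variable and differentiation after the transposed substitution match
in `fischer_substMul`. -/
theorem pderiv_substMul_transpose (h : Matrix ι ι k) (q : MvPolynomial (ι × ι) k) (i j : ι) :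
    pderiv (i, j) (substMul hᵀ q) = ∑ l, C (h i l) * substMul hᵀ (pderiv (l, j) q) := by
  induction q using MvPolynomial.induction_on with
  | C c => simp
  | add q q' hq hq' => simp only [map_add, hq, hq', mul_add, Finset.sum_add_distrib]
  | mul_X q p hq =>
    obtain ⟨a, c⟩ := p
    have hX : pderiv (i, j) (substMul hᵀ (X (a, c))) =
        ∑ l, C (h i l) * substMul hᵀ (pderiv (l, j) (X (a, c))) := by
      rw [substMul_X, map_sum]
      simp only [pderiv_C_mul, pderiv_X, Pi.single_apply, Prod.mk.injEq, transpose_apply]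
      by_cases hc : c = j
      · subst hc
        simp [eq_comm, apply_ite (substMul hᵀ)]
      · simp [hc]
    rw [map_mul, pderiv_mul, hX, hq, Finset.sum_mul, Finset.mul_sum, ← Finset.sum_add_distrib]
    refine Finset.sum_congr rfl fun l _ => ?_
    rw [pderiv_mul, map_add, map_mul, map_mul]
    ring

theorem coeff_zero_substMul (h : Matrix ι ι k) (q : MvPolynomial (ι × ι) k) :
    coeff 0 (substMul h q) = coeff 0 q := by
  induction q using MvPolynomial.induction_on with
  | C c => rw [substMul_C]
  | add q q' hq hq' => simp only [map_add, coeff_add, hq, hq']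
  | mul_X q p hq =>
    simp only [← constantCoeff_eq, map_mul] at hq ⊢
    rw [substMul_X]
    simp

/-- Adjointness of the substitutions by `h` and by its transpose, by induction on `p`: each variable
is moved across the pairing as a derivative. The induction must allow `q` to vary, since `q` gets
differentiated. -/
theorem fischer_substMul (h : Matrix ι ι k) (p q : MvPolynomial (ι × ι) k) :
    fischer q (substMul h p) = fischer (substMul hᵀ q) p := by
  induction p using MvPolynomial.induction_on generalizing q with
  | C c =>
    rw [substMul_C, C_eq_smul_one, map_smul, map_smul, fischer_one, fischer_one,
      coeff_zero_substMul]
  | add p p' hp hp' => simp only [map_add, hp, hp']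
  | mul_X p a hp =>
    obtain ⟨i, j⟩ := a
    rw [map_mul, substMul_X, Finset.mul_sum, map_sum, fischer_mul_X, pderiv_substMul_transpose,
      fischer_sum_left]
    refine Finset.sum_congr rfl fun l _ => ?_
    rw [mul_left_comm, ← smul_eq_C_mul, ← smul_eq_C_mul, map_smul, fischer_mul_X, hp,
      fischer_smul_left, smul_eq_mul]

/-- The determinant of the generic matrix. -/
noncomputable abbrev genericDet (k : Type u) [Field k] (ι : Type*) [Fintype ι] [DecidableEq ι] :
    MvPolynomial (ι × ι) k :=
  (mvPolynomialX ι ι k).det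

theorem substMul_genericDet (h : Matrix ι ι k) :
    substMul h (genericDet k ι) = C h.det * genericDet k ι := by
  rw [genericDet, AlgHom.map_det, substMul_mvPolynomialX, det_mul]
  congr 1
  exact (RingHom.map_det C h).symm

/-- The functional on polynomial functions of matrices given by Cayley's `Ω` process. -/
noncomputable def cayley (k : Type u) [Field k] (ι : Type*) [Fintype ι] [DecidableEq ι] (N : ℕ) :
    MvPolynomial (ι × ι) k →ₗ[k] k :=
  (fischer (genericDet k ι ^ N) (genericDet k ι ^ N))⁻¹ • fischer (genericDet k ι ^ N)

theorem cayley_genericDet_pow [CharZero k] (N : ℕ) : cayley k ι N (genericDet k ι ^ N) = 1 := by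
  refine inv_mul_cancel₀ ?_
  -- The generic determinant is defined over `ℤ`, so its powers have nonzero Fischer norm in
  -- characteristic zero.
  have h : genericDet k ι = map (Int.castRingHom k) (mvPolynomialX ι ι ℤ).det := by
    rw [RingHom.map_det]
    refine congrArg Matrix.det (Matrix.ext fun i j => ?_)
    simp
  rw [h, ← map_pow]
  exact fischer_self_ne_zero (pow_ne_zero N (det_mvPolynomialX_ne_zero ι ℤ))

/-- `genericDet ^ N` is an eigenvector of the transposed substitution with eigenvalue `det h ^ N`;
adjointness turns this into relative invariance of the functional. -/
theorem cayley_substMul (N : ℕ) (h : Matrix ι ι k) (p : MvPolynomial (ι × ι) k) :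
    cayley k ι N (substMul h p) = h.det ^ N * cayley k ι N p := by
  simp only [cayley, LinearMap.smul_apply, smul_eq_mul]
  rw [fischer_substMul, map_pow (substMul hᵀ), substMul_genericDet, det_transpose, mul_pow,
    ← map_pow C, ← smul_eq_C_mul, fischer_smul_left]
  ring

/-- After multiplication by the determinant, `p` vanishes at all matrices, so the product is zero
over an infinite field; the generic determinant is not a zero divisor. -/
theorem eq_zero_of_eval_invertible_eq_zero [Infinite k] {p : MvPolynomial (ι × ι) k}
    (h : ∀ A : Matrix ι ι k, A.det ≠ 0 → eval (fun q => A q.1 q.2) p = 0) : p = 0 := by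
  have h' : p * genericDet k ι = 0 := by
    refine MvPolynomial.funext fun s => ?_
    rw [map_mul, eval_det_mvPolynomialX, map_zero]
    by_cases hs : (Matrix.of fun i j => s (i, j)).det = 0
    · exact mul_eq_zero_of_right _ hs
    · exact mul_eq_zero_of_left (h _ hs) _
  exact (mul_eq_zero.1 h').resolve_right (det_mvPolynomialX_ne_zero ι k)

/-- On a finite-dimensional space of polynomials every functional is a combination of
evaluations. -/
theorem exists_eval_combination {σ T : Type*} (e : T → σ → k)
    (he : ∀ p : MvPolynomial σ k, (∀ t, eval (e t) p = 0) → p = 0)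
    (S : Submodule k (MvPolynomial σ k)) [FiniteDimensional k S] (L : MvPolynomial σ k →ₗ[k] k) :
    ∃ c : T →₀ k, ∀ p ∈ S, L p = c.sum fun t a => a * eval (e t) p := by
  let Φ : T → Module.Dual k S := fun t => (aeval (e t)).toLinearMap ∘ₗ S.subtype
  have hΦ (t : T) (p : S) : Φ t p = eval (e t) p.1 := by
    change aeval (e t) p.1 = _
    rw [aeval_eq_eval]
  -- No nonzero polynomial in `S` is killed by all evaluations, so by finite-dimensional duality the
  -- evaluations span the dual of `S`.
  have h0 : (Submodule.span k (Set.range Φ)).dualCoannihilator = ⊥ := by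
    rw [eq_bot_iff]
    intro p hp
    rw [Submodule.mem_dualCoannihilator] at hp
    refine Subtype.ext (he p.1 fun t => ?_)
    rw [← hΦ]
    exact hp _ (Submodule.subset_span ⟨t, rfl⟩)
  have h1 : Submodule.span k (Set.range Φ) = ⊤ := by
    rw [← Subspace.dualCoannihilator_dualAnnihilator_eq (W := Submodule.span k (Set.range Φ)), h0,
      Submodule.dualAnnihilator_bot]
  have h2 : L ∘ₗ S.subtype ∈ Submodule.span k (Set.range Φ) := h1 ▸ Submodule.mem_top
  obtain ⟨c, hc⟩ := Finsupp.mem_span_range_iff_exists_finsupp.1 h2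
  refine ⟨c, fun p hp => ?_⟩
  have h3 := LinearMap.congr_fun hc ⟨p, hp⟩
  rw [LinearMap.comp_apply] at h3
  refine h3.symm.trans ?_
  rw [Finsupp.sum, LinearMap.sum_apply]
  exact Finset.sum_congr rfl fun t _ => congrArg (c t * ·) (hΦ t _)

end GenericMatrix

/-! ### The Reynolds operator -/

section Reynolds

open MvPolynomial Matrix

/-- The entries of the tensor power of a matrix. -/
def kroneckerPow {S : Type*} [CommRing S] {ι : Type*} {n : ℕ} (A : Matrix ι ι S)
    (I J : Fin n → ι) : S :=
  ∏ a, A (I a) (J a)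

section

variable {S S' : Type*} [CommRing S] [CommRing S'] {ι : Type*} [Fintype ι] [DecidableEq ι] {n : ℕ}

theorem kroneckerPow_mul (A B : Matrix ι ι S) (I J : Fin n → ι) :
    kroneckerPow (A * B) I J = ∑ K, kroneckerPow A I K * kroneckerPow B K J := by
  simp only [kroneckerPow, Matrix.mul_apply, Fintype.prod_sum, Finset.prod_mul_distrib]

theorem kroneckerPow_one (I J : Fin n → ι) :
    kroneckerPow (1 : Matrix ι ι S) I J = if I = J then 1 else 0 := by
  split_ifs with h
  · subst h; simp [kroneckerPow]
  · obtain ⟨a, ha⟩ := Function.ne_iff.1 h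
    exact Finset.prod_eq_zero (Finset.mem_univ a) (Matrix.one_apply_ne ha)

theorem kroneckerPow_smul (c : S) (A : Matrix ι ι S) (I J : Fin n → ι) :
    kroneckerPow (c • A) I J = c ^ n * kroneckerPow A I J := by
  simp [kroneckerPow, Finset.prod_mul_distrib]

theorem map_kroneckerPow (f : S →+* S') (A : Matrix ι ι S) (I J : Fin n → ι) :
    f (kroneckerPow A I J) = kroneckerPow (f.mapMatrix A) I J := by
  simp [kroneckerPow]

end

variable {k : Type u} [Field k] {ι : Type*} [Fintype ι] [DecidableEq ι]

/-- The polynomial whose value at an invertible matrix `A` is `det A ^ N` times the coefficient of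
the action of `A` on tensors in `WEnd`. -/
noncomputable def actionPolynomial (k : Type u) [Field k] (N : ℕ) {n : ℕ} (I J I' J' : Fin n → ι) :
    MvPolynomial (ι × ι) k :=
  genericDet k ι ^ (N - n) * (kroneckerPow (mvPolynomialX ι ι k) I I' *
    kroneckerPow (mvPolynomialX ι ι k).adjugate J' J)

/-- The inverse matrix is not polynomial, but `n` factors of the adjugate equal `det A ^ n` times
`n` factors of the inverse. The power `N - n` fills this up to an exponent independent of `n`, so
one functional serves all degrees `n ≤ N`. -/
theorem eval_actionPolynomial {N n : ℕ} (hn : n ≤ N) (I J I' J' : Fin n → ι) {A A' : Matrix ι ι k}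
    (hA : A * A' = 1) :
    eval (fun q => A q.1 q.2) (actionPolynomial k N I J I' J') =
      A.det ^ N * (kroneckerPow A I I' * kroneckerPow A' J' J) := by
  have hX : (eval (fun q : ι × ι => A q.1 q.2)).mapMatrix (mvPolynomialX ι ι k) = A :=
    mvPolynomialX_mapMatrix_eval A
  have hadj : A.adjugate = A.det • A' := by
    rw [← _root_.mul_one A.adjugate, ← hA, ← _root_.mul_assoc, adjugate_mul, smul_mul_assoc,
      _root_.one_mul]
  rw [actionPolynomial, map_mul, map_mul, map_pow, map_kroneckerPow, map_kroneckerPow,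
    RingHom.map_det, RingHom.map_adjugate, hX, hadj, kroneckerPow_smul]
  rw [show A.det ^ N = A.det ^ (N - n) * A.det ^ n by rw [← pow_add, Nat.sub_add_cancel hn]]
  ring

/-- Tensor powers are multiplicative and the adjugate reverses products, so substituting `h * X`
lets `h` act on the outer indices `I`, `J` and leaves `I'`, `J'` alone. -/
theorem substMul_actionPolynomial {N n : ℕ} (hn : n ≤ N) (I J I' J' : Fin n → ι)
    {h h' : Matrix ι ι k} (hh : h * h' = 1) :
    substMul h (actionPolynomial k N I J I' J') =
      ∑ K, ∑ L, (h.det ^ N * (kroneckerPow h I K * kroneckerPow h' L J)) •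
        actionPolynomial k N K L I' J' := by
  have hadj : h.adjugate = h.det • h' := by
    rw [← _root_.mul_one h.adjugate, ← hh, ← _root_.mul_assoc, adjugate_mul, smul_mul_assoc,
      _root_.one_mul]
  have hX : (substMul h : _ →+* _).mapMatrix (mvPolynomialX ι ι k) =
      (C : k →+* MvPolynomial (ι × ι) k).mapMatrix h * mvPolynomialX ι ι k :=
    substMul_mvPolynomialX h
  have hs (p : MvPolynomial (ι × ι) k) : substMul h p = (substMul h : _ →+* _) p := rfl
  have hdet := substMul_genericDet h
  rw [hs] at hdet ⊢
  rw [actionPolynomial, map_mul, map_mul, map_pow, map_kroneckerPow, map_kroneckerPow, hdet,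
    RingHom.map_adjugate, hX, adjugate_mul_distrib, ← RingHom.map_adjugate, hadj, kroneckerPow_mul,
    kroneckerPow_mul, Finset.sum_mul_sum, Finset.mul_sum]
  refine Finset.sum_congr rfl fun K _ => ?_
  rw [Finset.mul_sum]
  refine Finset.sum_congr rfl fun L _ => ?_
  rw [← map_kroneckerPow, ← map_kroneckerPow, kroneckerPow_smul, smul_eq_C_mul, actionPolynomial,
    show h.det ^ N = h.det ^ (N - n) * h.det ^ n by rw [← pow_add, Nat.sub_add_cancel hn]]
  simp only [map_mul, map_pow]
  ring

variable {V : Type v} [AddCommGroup V] [Module k V] (b : Module.Basis ι k V)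

local notation "GL" => LinearMap.GeneralLinearGroup k V

theorem WEnd.coord_gl (g : GL) {n : ℕ} (a : WEnd k V n) (I J : Fin n → ι) :
    coord b I J (gl k V g n a) = ∑ I', ∑ J',
      kroneckerPow (LinearMap.toMatrix b b g) I I' *
        kroneckerPow (LinearMap.toMatrix b b (g⁻¹ : GL)) J' J * coord b I' J' a := by
  conv_lhs => rw [← sum_coord_smul_unit b a]
  simp only [map_sum, map_smul]
  refine Finset.sum_congr rfl fun I' _ => Finset.sum_congr rfl fun J' _ => ?_
  rw [unit, gl_pure, coord_pure, smul_eq_mul, mul_comm]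
  simp only [kroneckerPow, LinearMap.toMatrix_apply, LinearMap.comp_apply, Module.Basis.coord_apply]

theorem toMatrix_mul_toMatrix_inv (g : GL) :
    LinearMap.toMatrix b b g * LinearMap.toMatrix b b (g⁻¹ : GL) = 1 := by
  rw [← LinearMap.toMatrix_mul, ← LinearMap.toMatrix_one b]
  exact congrArg _ (Units.mul_inv g)

theorem toMatrix_inv_mul_toMatrix (g : GL) :
    LinearMap.toMatrix b b (g⁻¹ : GL) * LinearMap.toMatrix b b g = 1 := by
  rw [← LinearMap.toMatrix_mul, ← LinearMap.toMatrix_one b]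
  exact congrArg _ (Units.inv_mul g)

theorem eq_zero_of_eval_toMatrix_eq_zero [Infinite k] {p : MvPolynomial (ι × ι) k}
    (h : ∀ g : GL, eval (fun q => LinearMap.toMatrix b b g q.1 q.2) p = 0) : p = 0 := by
  refine eq_zero_of_eval_invertible_eq_zero fun A hA => ?_
  have hu : IsUnit (LinearMap.toMatrix b b |>.symm A) := by
    rw [LinearMap.toMatrix_symm]
    exact ((Matrix.isUnit_iff_isUnit_det A).2 hA.isUnit).map (Matrix.toLinAlgEquiv b)
  have := h hu.unit
  rwa [IsUnit.unit_spec, LinearEquiv.apply_symm_apply] at this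

theorem exists_eval_toMatrix_combination [Infinite k] (S : Submodule k (MvPolynomial (ι × ι) k))
    [FiniteDimensional k S] (L : MvPolynomial (ι × ι) k →ₗ[k] k) :
    ∃ c : GL →₀ k, ∀ p ∈ S, L p =
      c.sum fun g x => x * eval (fun q => LinearMap.toMatrix b b g q.1 q.2) p :=
  exists_eval_combination _ (fun _ hp => eq_zero_of_eval_toMatrix_eq_zero b hp) S L

theorem Finset.sum_sum_comm_pairs {α β M : Type*} [Fintype α] [Fintype β] [AddCommMonoid M]
    (f : α → α → β → β → M) :
    ∑ K, ∑ L, ∑ I, ∑ J, f K L I J = ∑ I, ∑ J, ∑ K, ∑ L, f K L I J := by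
  have h (f : α → α → β → β → M) :
      ∑ K, ∑ L, ∑ I, ∑ J, f K L I J = ∑ x : α × α, ∑ y : β × β, f x.1 x.2 y.1 y.2 := by
    simp only [Fintype.sum_prod_type]
  have h' (f : β → β → α → α → M) :
      ∑ I, ∑ J, ∑ K, ∑ L, f I J K L = ∑ x : β × β, ∑ y : α × α, f x.1 x.2 y.1 y.2 := by
    simp only [Fintype.sum_prod_type]
  rw [h, h' fun I J K L => f K L I J]
  exact Finset.sum_comm

/-- A finite combination of elements of `GL(V)` that acts on all tensors of degree at most `N` as a
projection to the invariants. -/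
theorem exists_reynolds_of_basis (b : Module.Basis ι k V) [CharZero k] (N : ℕ) :
    ∃ (s : Finset GL) (c : GL → k), ∑ g ∈ s, c g = 1 ∧ ∀ n ≤ N, ∀ (a : WEnd k V n) (h : GL),
      WEnd.gl k V h n (∑ g ∈ s, c g • WEnd.gl k V g n a) = ∑ g ∈ s, c g • WEnd.gl k V g n a := by
  let index := Σ n : Fin (N + 1), (Fin n → ι) × (Fin n → ι) × (Fin n → ι) × (Fin n → ι)
  let q : index → MvPolynomial (ι × ι) k :=
    fun s => actionPolynomial k N s.2.1 s.2.2.1 s.2.2.2.1 s.2.2.2.2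
  -- There are finitely many action polynomials of degree at most `N`, so on their span the Cayley
  -- functional is a combination of evaluations at group elements.
  let S := Submodule.span k (Set.range q)
  have : FiniteDimensional k S := FiniteDimensional.span_of_finite k (Set.finite_range q)
  have hS {n : ℕ} (hn : n ≤ N) (I J I' J' : Fin n → ι) : actionPolynomial k N I J I' J' ∈ S :=
    Submodule.subset_span ⟨⟨⟨n, Nat.lt_succ_of_le hn⟩, I, J, I', J'⟩, rfl⟩
  obtain ⟨c, hc⟩ := exists_eval_toMatrix_combination b S (cayley k ι N)
  -- Evaluating an action polynomial at `g` gives `det g ^ N` times a coefficient of the action of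
  -- `g`, so this factor enters the weights of the average.
  let D : GL → k := fun g => (LinearMap.toMatrix b b g).det ^ N
  have D_ne (g : GL) : D g ≠ 0 := by
    refine pow_ne_zero N fun h0 => ?_
    have := congrArg Matrix.det (toMatrix_mul_toMatrix_inv b g)
    rw [det_mul, h0, zero_mul, det_one] at this
    exact zero_ne_one this
  have average {n : ℕ} (hn : n ≤ N) (a : WEnd k V n) (I J : Fin n → ι) :
      WEnd.coord b I J (∑ g ∈ c.support, (c g * D g) • WEnd.gl k V g n a) =
        ∑ I', ∑ J', cayley k ι N (actionPolynomial k N I J I' J') * WEnd.coord b I' J' a := by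
    simp only [hc _ (hS hn _ _ _ _), Finsupp.sum, map_sum, map_smul, smul_eq_mul, WEnd.coord_gl,
      Finset.mul_sum, Finset.sum_mul]
    rw [Finset.sum_comm]
    refine Finset.sum_congr rfl fun I' _ => ?_
    rw [Finset.sum_comm]
    refine Finset.sum_congr rfl fun J' _ => Finset.sum_congr rfl fun g _ => ?_
    rw [eval_actionPolynomial hn I J I' J' (toMatrix_mul_toMatrix_inv b g)]
    ring
  refine ⟨c.support, fun g => c g * D g, ?_, fun n hn a h => WEnd.coord_ext b fun I J => ?_⟩
  -- In degree `0` the action polynomial is `genericDet ^ N`, where the functional equals `1`; its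
  -- evaluations add up to the total weight.
  · have h1 := hc _ (hS (Nat.zero_le N) Fin.elim0 Fin.elim0 Fin.elim0 Fin.elim0)
    have h2 : actionPolynomial k N (Fin.elim0 : Fin 0 → ι) Fin.elim0 Fin.elim0 Fin.elim0 =
        genericDet k ι ^ N := by
      simp [actionPolynomial, kroneckerPow]
    rw [h2, cayley_genericDet_pow] at h1
    rw [h1, Finsupp.sum]
    refine Finset.sum_congr rfl fun g _ => ?_
    rw [map_pow, eval_det_mvPolynomialX]
    rfl
  · rw [WEnd.coord_gl]
    simp only [average hn]
    -- Invariance of the average: apply the Cayley functional to the action polynomial with `h * X`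
    -- substituted, compute it in two ways, and cancel `det h ^ N`.
    have key (I' J' : Fin n → ι) : ∑ K, ∑ L, kroneckerPow (LinearMap.toMatrix b b h) I K *
        kroneckerPow (LinearMap.toMatrix b b (h⁻¹ : GL)) L J *
          cayley k ι N (actionPolynomial k N K L I' J') =
        cayley k ι N (actionPolynomial k N I J I' J') := by
      have h1 := cayley_substMul N (LinearMap.toMatrix b b h) (actionPolynomial k N I J I' J')
      rw [substMul_actionPolynomial hn I J I' J' (toMatrix_mul_toMatrix_inv b h)] at h1
      refine mul_left_cancel₀ (D_ne h) (Eq.trans ?_ h1)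
      simp only [map_sum, map_smul, smul_eq_mul, Finset.mul_sum]
      refine Finset.sum_congr rfl fun K _ => Finset.sum_congr rfl fun L _ => ?_
      ring
    simp only [← key, Finset.mul_sum, Finset.sum_mul]
    rw [Finset.sum_sum_comm_pairs]
    refine Finset.sum_congr rfl fun K _ => Finset.sum_congr rfl fun L _ =>
      Finset.sum_congr rfl fun I' _ => Finset.sum_congr rfl fun J' _ => ?_
    ring

theorem exists_reynolds [FiniteDimensional k V] [CharZero k] (N : ℕ) :
    ∃ (s : Finset GL) (c : GL → k), ∑ g ∈ s, c g = 1 ∧ ∀ n ≤ N, ∀ (a : WEnd k V n) (h : GL),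
      WEnd.gl k V h n (∑ g ∈ s, c g • WEnd.gl k V g n a) = ∑ g ∈ s, c g • WEnd.gl k V g n a :=
  exists_reynolds_of_basis (Module.finBasis k V) N

end Reynolds

/-! ### The first fundamental theorem of invariant theory -/

section FirstFundamentalTheorem

open MvPolynomial Matrix

/-- Fibres of equal size are in bijection, and these bijections glue to a permutation. Thus letter
counts determine a word up to permutation of positions. -/
theorem exists_perm_comp_eq {α β : Type*} [Fintype α] [DecidableEq β] {f f' : α → β}
    (h : ∀ x, (Finset.univ.filter fun a => f a = x).card =
      (Finset.univ.filter fun a => f' a = x).card) :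
    ∃ σ : Equiv.Perm α, f' ∘ σ = f := by
  have e (x : β) : {a // f a = x} ≃ {a // f' a = x} :=
    Fintype.equivOfCardEq (by rw [Fintype.card_subtype, Fintype.card_subtype, h])
  refine ⟨(Equiv.sigmaFiberEquiv f).symm.trans
    ((Equiv.sigmaCongrRight e).trans (Equiv.sigmaFiberEquiv f')), funext fun a => ?_⟩
  exact (e (f a) ⟨a, rfl⟩).2

/-! ### The double commutant of the symmetric group -/

section Commutant

variable {k : Type u} [Field k] {ι : Type*} [Fintype ι] [DecidableEq ι] {n : ℕ}

/-- The operator on tensors permuting the factors. -/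
def tensorPerm (k : Type u) [Field k] (σ : Equiv.Perm (Fin n)) :
    Matrix (Fin n → ι) (Fin n → ι) k :=
  Matrix.of fun I J => if I ∘ σ = J then 1 else 0

theorem tensorPerm_mul_apply (σ : Equiv.Perm (Fin n)) (A : Matrix (Fin n → ι) (Fin n → ι) k)
    (I J : Fin n → ι) :
    (tensorPerm k σ * A : Matrix (Fin n → ι) (Fin n → ι) k) I J = A (I ∘ σ) J := by
  simp [tensorPerm, Matrix.mul_apply]

theorem tensorPerm_one : tensorPerm k (1 : Equiv.Perm (Fin n)) = (1 : Matrix (Fin n → ι) _ k) := by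
  ext1 I J
  simp [tensorPerm, Matrix.one_apply]

theorem tensorPerm_mul (σ τ : Equiv.Perm (Fin n)) :
    (tensorPerm k σ * tensorPerm k τ : Matrix (Fin n → ι) _ k) = tensorPerm k (σ * τ) := by
  ext1 I J
  rw [tensorPerm_mul_apply]
  rfl

/-- A matrix that commutes with all operators commuting with permutations of the factors is a
combination of permutations of the factors. -/
theorem mem_span_tensorPerm [CharZero k] {T : Matrix (Fin n → ι) (Fin n → ι) k}
    (hT : ∀ S : Matrix (Fin n → ι) (Fin n → ι) k,
      (∀ (σ : Equiv.Perm (Fin n)) I J, S (I ∘ σ) (J ∘ σ) = S I J) → S * T = T * S) :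
    T ∈ Submodule.span k (Set.range (tensorPerm (ι := ι) (n := n) k)) := by
  set M := Submodule.span k (Set.range (tensorPerm (ι := ι) (n := n) k)) with hM
  have mem (σ : Equiv.Perm (Fin n)) : tensorPerm k σ ∈ M := Submodule.subset_span ⟨σ, rfl⟩
  have mul_mem (σ : Equiv.Perm (Fin n)) {A : Matrix (Fin n → ι) (Fin n → ι) k} (hA : A ∈ M) :
      tensorPerm k σ * A ∈ M := by
    induction hA using Submodule.span_induction with
    | mem A hA => obtain ⟨τ, rfl⟩ := hA; rw [tensorPerm_mul]; exact mem _
    | zero => rw [mul_zero]; exact M.zero_mem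
    | add A B _ _ h h' => rw [mul_add]; exact M.add_mem h h'
    | smul c A _ h => rw [mul_smul_comm]; exact M.smul_mem c h
  -- Maschke's argument: average a linear retraction onto `M` over the symmetric group to obtain a
  -- retraction `Q` that commutes with left multiplication by permutations.
  obtain ⟨q, hq⟩ := M.subtype.exists_leftInverse_of_injective M.ker_subtype
  have hq' {A : Matrix (Fin n → ι) (Fin n → ι) k} (hA : A ∈ M) : (q A : Matrix _ _ k) = A :=
    congrArg Subtype.val (LinearMap.congr_fun hq ⟨A, hA⟩)
  let N : k := (Fintype.card (Equiv.Perm (Fin n)) : k)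
  have hN : N ≠ 0 := Nat.cast_ne_zero.2 Fintype.card_ne_zero
  let Q : Matrix (Fin n → ι) (Fin n → ι) k →ₗ[k] Matrix (Fin n → ι) (Fin n → ι) k :=
    N⁻¹ • ∑ σ : Equiv.Perm (Fin n), LinearMap.mulLeft k (tensorPerm k σ⁻¹) ∘ₗ M.subtype ∘ₗ q ∘ₗ
      LinearMap.mulLeft k (tensorPerm k σ)
  have Q_apply (A : Matrix (Fin n → ι) (Fin n → ι) k) :
      Q A = N⁻¹ • ∑ σ : Equiv.Perm (Fin n), tensorPerm k σ⁻¹ * (q (tensorPerm k σ * A)).1 := by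
    simp [Q]
  have Q_mem (A : Matrix (Fin n → ι) (Fin n → ι) k) : Q A ∈ M := by
    rw [Q_apply]
    exact M.smul_mem _ (M.sum_mem fun σ _ => mul_mem _ (q _).2)
  have Q_one : Q 1 = 1 := by
    rw [Q_apply]
    have (σ : Equiv.Perm (Fin n)) :
        tensorPerm k σ⁻¹ * (q (tensorPerm k σ * 1)).1 = (1 : Matrix (Fin n → ι) _ k) := by
      rw [_root_.mul_one, hq' (mem σ), tensorPerm_mul, inv_mul_cancel, tensorPerm_one]
    simp only [this, Finset.sum_const, Finset.card_univ]
    rw [← Nat.cast_smul_eq_nsmul k, smul_smul, inv_mul_cancel₀ hN, one_smul]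
  have Q_mul (τ : Equiv.Perm (Fin n)) (A : Matrix (Fin n → ι) (Fin n → ι) k) :
      Q (tensorPerm k τ * A) = tensorPerm k τ * Q A := by
    rw [Q_apply, Q_apply, mul_smul_comm, Finset.mul_sum]
    congr 1
    refine Fintype.sum_equiv (Equiv.mulRight τ) _ _ fun σ => ?_
    rw [Equiv.coe_mulRight, ← _root_.mul_assoc, tensorPerm_mul, ← _root_.mul_assoc, tensorPerm_mul,
      _root_.mul_inv_rev, mul_inv_cancel_left]
  -- The blocks of `Q`: column `J` of `Q A` is the sum over `J'` of `S J J'` applied to column `J'`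
  -- of `A`. Equivariance of `Q` says that each block commutes with permutations, so `T` commutes
  -- with it.
  let S (J J' : Fin n → ι) : Matrix (Fin n → ι) (Fin n → ι) k :=
    Matrix.of fun I L => Q (Matrix.single L J' 1) I J
  have Q_eq (A : Matrix (Fin n → ι) (Fin n → ι) k) (I J : Fin n → ι) :
      Q A I J = ∑ J', (S J J' * A) I J' := by
    conv_lhs => rw [Matrix.matrix_eq_sum_single A]
    simp only [map_sum, Matrix.sum_apply, Matrix.mul_apply]
    rw [Finset.sum_comm]
    refine Finset.sum_congr rfl fun J' _ => Finset.sum_congr rfl fun L _ => ?_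
    rw [← _root_.mul_one (A L J'), ← smul_eq_mul, ← Matrix.smul_single, map_smul, Matrix.smul_apply,
      smul_eq_mul, smul_eq_mul, _root_.mul_one, mul_comm]
    rfl
  have S_symm (J J' : Fin n → ι) (σ : Equiv.Perm (Fin n)) (I L : Fin n → ι) :
      S J J' (I ∘ σ) (L ∘ σ) = S J J' I L := by
    change Q (Matrix.single (L ∘ σ) J' 1) (I ∘ σ) J = Q (Matrix.single L J' 1) I J
    have h := tensorPerm_mul_apply σ (Q (Matrix.single (L ∘ σ) J' 1)) I J
    rw [← Q_mul] at h
    rw [← h]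
    refine congrArg (fun A => Q A I J) ?_
    ext1 K K'
    rw [tensorPerm_mul_apply, Matrix.single_apply, Matrix.single_apply]
    have : L ∘ σ = K ∘ σ ↔ L = K := σ.surjective.injective_comp_right.eq_iff
    simp only [this]
  -- As `T` commutes with the blocks, `Q T = T * Q 1 = T`; and `Q` takes values in `M`.
  have h : Q T = T := by
    conv_rhs => rw [← _root_.mul_one T, ← Q_one]
    ext1 I J
    rw [Q_eq, Matrix.mul_apply]
    simp only [Q_eq, Finset.mul_sum]
    rw [Finset.sum_comm]
    refine Finset.sum_congr rfl fun J' _ => ?_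
    rw [hT _ (S_symm J J'), _root_.mul_one, Matrix.mul_apply]
  rw [← h]
  exact Q_mem T

theorem kroneckerPow_mvPolynomialX (I J : Fin n → ι) :
    kroneckerPow (mvPolynomialX ι ι k) I J =
      monomial (∑ a, Finsupp.single (I a, J a) 1) 1 := by
  simp only [kroneckerPow, mvPolynomialX_apply, X]
  exact (monomial_sum_one _ _).symm

/-- A matrix that commutes with the tensor powers of invertible matrices commutes with all
operators commuting with permutations of the factors. -/
theorem commute_of_commute_kroneckerPow [Infinite k] {T : Matrix (Fin n → ι) (Fin n → ι) k}
    (hT : ∀ A : Matrix ι ι k, A.det ≠ 0 → ∀ I J,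
      ∑ K, kroneckerPow A I K * T K J = ∑ K, T I K * kroneckerPow A K J)
    (S : Matrix (Fin n → ι) (Fin n → ι) k)
    (hS : ∀ (σ : Equiv.Perm (Fin n)) I J, S (I ∘ σ) (J ∘ σ) = S I J) : S * T = T * S := by
  -- The exponent of the monomial at position `(I, J)` of the tensor power of the generic matrix.
  -- Positions with equal exponent form one orbit of the symmetric group, so a symmetric `S` is a
  -- combination of the coefficient matrices of these monomials.
  let μ : (Fin n → ι) → (Fin n → ι) → (ι × ι →₀ ℕ) :=
    fun I J => ∑ a, Finsupp.single (I a, J a) 1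
  have hpoly (I J : Fin n → ι) :
      ∑ K, C (T K J) * kroneckerPow (mvPolynomialX ι ι k) I K -
        ∑ K, C (T I K) * kroneckerPow (mvPolynomialX ι ι k) K J = 0 := by
    refine eq_zero_of_eval_invertible_eq_zero fun A hA => ?_
    have hX : (eval (fun q : ι × ι => A q.1 q.2)).mapMatrix (mvPolynomialX ι ι k) = A :=
      mvPolynomialX_mapMatrix_eval A
    simp only [map_sub, map_sum, map_mul, map_kroneckerPow, hX, eval_C]
    simp only [mul_comm (T _ J)]
    rw [hT A hA, sub_self]
  -- Commutation with invertible `A` is a polynomial identity; its coefficient at `α` is commutation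
  -- of `T` with the indicator matrix of one orbit.
  have hcoeff (I J : Fin n → ι) (α : ι × ι →₀ ℕ) :
      ∑ K, T K J * (if μ I K = α then 1 else 0) = ∑ K, T I K * (if μ K J = α then 1 else 0) := by
    have := congrArg (coeff α) (sub_eq_zero.1 (hpoly I J))
    simp only [coeff_sum, coeff_C_mul, kroneckerPow_mvPolynomialX,
      coeff_monomial] at this
    exact this
  have hμ (I J I' J' : Fin n → ι) (h : μ I J = μ I' J') : S I J = S I' J' := by
    obtain ⟨σ, hσ⟩ := exists_perm_comp_eq (f := fun a => (I a, J a)) (f' := fun a => (I' a, J' a))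
      fun x => by
        have h' := DFunLike.congr_fun h x
        simp only [μ, Finsupp.finsetSum_apply, Finsupp.single_apply] at h'
        rwa [Finset.card_filter, Finset.card_filter]
    have hI : I' ∘ σ = I := funext fun a => congrArg Prod.fst (congrFun hσ a)
    have hJ : J' ∘ σ = J := funext fun a => congrArg Prod.snd (congrFun hσ a)
    rw [← hI, ← hJ, hS]
  -- The constant value of `S` on the orbit with exponent `α`, and `0` if `α` does not occur.
  let F : (ι × ι →₀ ℕ) → k := fun α =>
    open Classical in if h : ∃ p : (Fin n → ι) × (Fin n → ι), μ p.1 p.2 = α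
      then S h.choose.1 h.choose.2 else 0
  have hF (I J : Fin n → ι) : F (μ I J) = S I J := by
    have h : ∃ p : (Fin n → ι) × (Fin n → ι), μ p.1 p.2 = μ I J := ⟨(I, J), rfl⟩
    simp only [F, dif_pos h]
    exact hμ _ _ _ _ h.choose_spec
  let A : Finset (ι × ι →₀ ℕ) := Finset.univ.image fun p : (Fin n → ι) × (Fin n → ι) => μ p.1 p.2
  have hSF (I J : Fin n → ι) : S I J = ∑ α ∈ A, F α * (if μ I J = α then 1 else 0) := by
    rw [← hF, Finset.sum_eq_single (μ I J)]
    · simp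
    · intro α _ h; simp [h.symm]
    · intro h; exact (h (Finset.mem_image_of_mem _ (Finset.mem_univ (I, J)))).elim
  ext1 I J
  rw [Matrix.mul_apply, Matrix.mul_apply]
  simp only [hSF, Finset.sum_mul, Finset.mul_sum]
  rw [Finset.sum_comm, Finset.sum_comm (s := Finset.univ) (t := A)]
  refine Finset.sum_congr rfl fun α _ => ?_
  have := congrArg (F α * ·) (hcoeff I J α)
  simp only [Finset.mul_sum] at this
  refine (Finset.sum_congr rfl fun K _ => ?_).trans
    (this.trans (Finset.sum_congr rfl fun K _ => ?_))
  · ring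
  · ring

end Commutant

/-! ### Invariant tensors -/

section Generation

variable {k : Type u} [Field k] {V : Type v} [AddCommGroup V] [Module k V] [FiniteDimensional k V]
  {A : Type x} [Ring A] [Algebra k A]

local notation "GL" => LinearMap.GeneralLinearGroup k V

variable (k V A) in
/-- The tensor powers of the identity of `V`. -/
noncomputable def BaseChange.idPow : ∀ n : ℕ, BaseChange k A (WEnd k V) n
  | 0 => Wheelgebra.one k
  | n + 1 => Wheelgebra.mul (k := k) (idPow n) (BaseChange.pure 1 (WEnd.idElem k V))

theorem BaseChange.coord_idPow {ι : Type*} [Fintype ι] [DecidableEq ι] (b : Module.Basis ι k V)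
    {n : ℕ} (I J : Fin n → ι) :
    BaseChange.coord b I J (idPow k V A n) = if I = J then 1 else 0 := by
  induction n with
  | zero =>
    rw [idPow, BaseChange.coord_one, if_pos (Subsingleton.elim _ _)]
  | succ n ih =>
    rw [idPow, BaseChange.coord_mul, ih, BaseChange.coord_idElem]
    have h : I = J ↔ I ∘ Fin.castAdd 1 = J ∘ Fin.castAdd 1 ∧
        (I ∘ Fin.natAdd n) 0 = (J ∘ Fin.natAdd n) (0 : Fin 1) := by
      constructor
      · rintro rfl; exact ⟨rfl, rfl⟩
      · rintro ⟨h, h'⟩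
        refine funext fun a => ?_
        induction a using Fin.addCases with
        | left a => exact congrFun h a
        | right a => rw [Subsingleton.elim a 0]; exact h'
    simp only [h, ite_and]
    split_ifs <;> simp

theorem BaseChange.wheelGenerated_idPow {S : ∀ m, Set (BaseChange k A (WEnd k V) m)}
    (hS : BaseChange.pure 1 (WEnd.idElem k V) ∈ S 1) (n : ℕ) :
    WheelGenerated k S n (idPow k V A n) := by
  induction n with
  | zero => exact .one
  | succ n ih => exact .mul ih (.mem hS)

theorem WheelGenerated.sum {W : ℕ → Type w} [∀ m, AddCommGroup (W m)] [∀ m, Module k (W m)]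
    [Wheelgebra k W] {S : ∀ m, Set (W m)} {m : ℕ} {κ : Type*} (s : Finset κ) (f : κ → W m)
    (h : ∀ j ∈ s, WheelGenerated k S m (f j)) : WheelGenerated k S m (∑ j ∈ s, f j) := by
  classical
  induction s using Finset.induction_on with
  | empty => exact .zero
  | insert j s hj ih =>
    rw [Finset.sum_insert hj]
    exact .add (h j (Finset.mem_insert_self _ _))
      (ih fun i hi => h i (Finset.mem_insert_of_mem hi))

/-- The coordinate matrix `T` of an invariant tensor satisfies `K * T * K⁻¹ = T` for every tensor
power `K` of an invertible matrix, so it commutes with these and the commutant results apply. -/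
theorem WEnd.coord_mem_span_tensorPerm [CharZero k] {ι : Type*} [Fintype ι] [DecidableEq ι]
    (b : Module.Basis ι k V) {n : ℕ} {a : WEnd k V n} (ha : ∀ g : GL, WEnd.gl k V g n a = a) :
    (Matrix.of fun I J => WEnd.coord b I J a) ∈
      Submodule.span k (Set.range (tensorPerm (ι := ι) (n := n) k)) := by
  refine mem_span_tensorPerm (commute_of_commute_kroneckerPow fun A hA => ?_)
  have hu : IsUnit (LinearMap.toMatrix b b |>.symm A) := by
    rw [LinearMap.toMatrix_symm]
    exact ((Matrix.isUnit_iff_isUnit_det A).2 hA.isUnit).map (Matrix.toLinAlgEquiv b)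
  let g : GL := hu.unit
  have hg : LinearMap.toMatrix b b g = A := by
    rw [IsUnit.unit_spec, LinearEquiv.apply_symm_apply]
  set A' := LinearMap.toMatrix b b (g⁻¹ : GL) with hA'
  have hAA : A' * A = 1 := by rw [← hg]; exact toMatrix_inv_mul_toMatrix b g
  let T : Matrix (Fin n → ι) (Fin n → ι) k := Matrix.of fun I J => WEnd.coord b I J a
  let K : Matrix (Fin n → ι) (Fin n → ι) k := Matrix.of (kroneckerPow A)
  let K' : Matrix (Fin n → ι) (Fin n → ι) k := Matrix.of (kroneckerPow A')
  have h1 : K' * K = 1 := by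
    ext1 I J
    rw [Matrix.mul_apply, Matrix.one_apply, ← kroneckerPow_one, ← hAA, kroneckerPow_mul]
    rfl
  have h2 : K * T * K' = T := by
    ext1 I J
    have := congrArg (WEnd.coord b I J) (ha g)
    rw [WEnd.coord_gl, hg, Finset.sum_comm] at this
    refine Eq.trans ?_ this
    rw [Matrix.mul_apply]
    refine Finset.sum_congr rfl fun J' _ => ?_
    rw [Matrix.mul_apply, Finset.sum_mul]
    refine Finset.sum_congr rfl fun I' _ => ?_
    change kroneckerPow A I I' * WEnd.coord b I' J' a * kroneckerPow A' J' J = _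
    ring
  have h3 : K * T = T * K := by
    conv_rhs => rw [← h2, _root_.mul_assoc, h1, _root_.mul_one]
  intro I J
  have := congrFun (congrFun h3 I) J
  rwa [Matrix.mul_apply, Matrix.mul_apply] at this

/-- The first fundamental theorem: invariant tensors are generated by the identity of `V`. -/
theorem BaseChange.wheelGenerated_pure_one_of_invariant [CharZero k]
    {S : ∀ m, Set (BaseChange k A (WEnd k V) m)} (hS : BaseChange.pure 1 (WEnd.idElem k V) ∈ S 1)
    {n : ℕ} {a : WEnd k V n} (ha : ∀ g : GL, WEnd.gl k V g n a = a) :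
    WheelGenerated k S n (BaseChange.pure (1 : A) a) := by
  let ι := Fin (Module.finrank k V)
  let b : Module.Basis ι k V := Module.finBasis k V
  obtain ⟨c, hc⟩ := (Submodule.mem_span_range_iff_exists_fun k).1
    (WEnd.coord_mem_span_tensorPerm b ha)
  -- The `n`-th power of the identity with inputs permuted by `σ` has coordinate matrix `tensorPerm
  -- k σ`.
  have h : BaseChange.pure (1 : A) a = ∑ σ : Equiv.Perm (Fin n), c σ •
      Wheelspace.act (k := k) σ (Equiv.refl _) (BaseChange.idPow k V A n) := by
    refine BaseChange.coord_ext b fun I J => ?_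
    have hIJ := congrFun (congrFun hc I) J
    rw [Matrix.of_apply, Matrix.sum_apply] at hIJ
    rw [BaseChange.coord_pure, ← hIJ, map_sum, Finset.sum_smul]
    refine Finset.sum_congr rfl fun σ _ => ?_
    rw [map_smul, BaseChange.coord_act, BaseChange.coord_idPow, Matrix.smul_apply, smul_assoc]
    congr 1
    change (if I ∘ σ = J then (1 : k) else 0) • (1 : A) = if I ∘ σ = J then 1 else 0
    split_ifs <;> simp
  rw [h]
  exact WheelGenerated.sum _ _ fun σ _ => .smul _ (.act _ _ (wheelGenerated_idPow hS n))

end Generation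

end FirstFundamentalTheorem

/-! ### Invariants are generated by the image of a representation -/

section InvariantGeneration

theorem Fin.append_comp_finAddFlip {α : Type*} {m n : ℕ} (f : Fin m → α) (g : Fin n → α) :
    Fin.append f g ∘ finAddFlip = Fin.append g f := by
  funext a
  induction a using Fin.addCases <;> simp

/-- Joining each of the last `p` outputs to the corresponding input. -/
def contrLast (k : Type u) [Field k] {W : ℕ → Type w} [∀ m, AddCommGroup (W m)]
    [∀ m, Module k (W m)] [Wheelspace k W] (m : ℕ) : ∀ p : ℕ, W (m + p) →ₗ[k] W m
  | 0 => LinearMap.id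
  | p + 1 => contrLast k m p ∘ₗ contr (k := k) (m := m + p) (Fin.last _) (Fin.last _)

theorem WheelGenerated.contrLast {k : Type u} [Field k] {W : ℕ → Type w}
    [∀ m, AddCommGroup (W m)] [∀ m, Module k (W m)] [Wheelgebra k W] {S : ∀ m, Set (W m)}
    {m p : ℕ} {a : W (m + p)} (ha : WheelGenerated k S (m + p) a) :
    WheelGenerated k S m (contrLast k m p a) := by
  induction p with
  | zero => exact ha
  | succ p ih => exact ih (.contr _ _ ha)

variable {k : Type u} [Field k] {V : Type v} [AddCommGroup V] [Module k V]

local notation "GL" => LinearMap.GeneralLinearGroup k V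

/-! ### Contracting a tensor with an element of `A ⊗ WEnd V` -/

namespace BaseChange

variable {A : Type x} [Ring A] [Algebra k A]

theorem coord_contrLast {ι : Type*} [Fintype ι] [DecidableEq ι] (b : Module.Basis ι k V)
    {m p : ℕ} (a : BaseChange k A (WEnd k V) (m + p)) (I J : Fin m → ι) :
    coord b I J (contrLast k m p a) =
      ∑ K : Fin p → ι, coord b (Fin.append I K) (Fin.append J K) a := by
  induction p with
  | zero =>
    rw [Fintype.sum_unique, Fin.append_of_isEmpty, Fin.append_of_isEmpty]
    rfl
  | succ p ih =>
    rw [contrLast, LinearMap.comp_apply, ih]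
    simp only [coord_contr]
    rw [← (Fin.insertNthEquiv (fun _ => ι) (Fin.last p)).sum_comp, Fintype.sum_prod_type,
      Finset.sum_comm]
    refine Finset.sum_congr rfl fun c _ => Finset.sum_congr rfl fun K _ => ?_
    have h (I : Fin m → ι) := Fin.insertNth_append_right (Fin.last p) c I K
    exact congrArg₂ (fun I' J' => coord b I' J' a) (h I) (h J)

/-- The diagonal action of `g` on `A ⊗ WEnd V`, where `g` acts on `A` by `φ`. -/
noncomputable def diag (φ : A →ₐ[k] A) (g : GL) (m : ℕ) :
    BaseChange k A (WEnd k V) m →ₗ[k] BaseChange k A (WEnd k V) m :=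
  map k (WEnd k V) φ.toLinearMap m ∘ₗ gl A g m

theorem diag_act (φ : A →ₐ[k] A) (g : GL) {m n : ℕ} (σ τ : Fin m ≃ Fin n)
    (a : BaseChange k A (WEnd k V) m) :
    diag φ g n (act (k := k) σ τ a) = act (k := k) σ τ (diag φ g m a) := by
  simp only [diag, LinearMap.comp_apply, gl_act, map_act]

theorem diag_mul (φ : A →ₐ[k] A) (g : GL) {m n : ℕ} (a : BaseChange k A (WEnd k V) m)
    (a' : BaseChange k A (WEnd k V) n) :
    diag φ g (m + n) (mul (k := k) a a') = mul (k := k) (diag φ g m a) (diag φ g n a') := by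
  simp only [diag, LinearMap.comp_apply, gl_mul, map_mul]

theorem diag_contrLast (φ : A →ₐ[k] A) (g : GL) {m p : ℕ}
    (a : BaseChange k A (WEnd k V) (m + p)) :
    diag φ g m (contrLast k m p a) = contrLast k m p (diag φ g (m + p) a) := by
  induction p with
  | zero => rfl
  | succ p ih =>
    rw [contrLast, LinearMap.comp_apply, ih, LinearMap.comp_apply]
    congr 1
    simp only [diag, LinearMap.comp_apply, gl_contr, map_contr]
    rfl

/-- Joining the last legs of a tensor crosswise to the legs of an element. -/
noncomputable def join (m n : ℕ) :
    WEnd k V (m + n) →ₗ[k] BaseChange k A (WEnd k V) n →ₗ[k] BaseChange k A (WEnd k V) m :=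
  ((mul (k := k) (W := BaseChange k A (WEnd k V)) (m := m + n) (n := n)).compr₂
    (contrLast k m (n + n) ∘ₗ act (k := k) (finCongr (Nat.add_assoc m n n))
      ((finCongr (Nat.add_assoc m n n)).trans (blockSum (Equiv.refl _) finAddFlip)))) ∘ₗ
    TensorProduct.mk k A (WEnd k V (m + n)) 1

theorem join_apply {m n : ℕ} (a : WEnd k V (m + n)) (a' : BaseChange k A (WEnd k V) n) :
    join m n a a' = contrLast k m (n + n) (act (k := k) (finCongr (Nat.add_assoc m n n))
      ((finCongr (Nat.add_assoc m n n)).trans (blockSum (Equiv.refl _) finAddFlip))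
        (mul (k := k) (pure (1 : A) a) a')) := rfl

/-- `join` is composed of wheelgebra operations, which the diagonal action respects, and the tensor
enters with coefficient `1`, which `φ` fixes. -/
theorem diag_join (φ : A →ₐ[k] A) (g : GL) {m n : ℕ} (a : WEnd k V (m + n))
    (a' : BaseChange k A (WEnd k V) n) :
    diag φ g m (join m n a a') = join m n (WEnd.gl k V g (m + n) a) (diag φ g n a') := by
  rw [join_apply, diag_contrLast, diag_act, diag_mul, join_apply]
  congr 4
  exact congrArg (pure · _) (_root_.map_one φ)

theorem wheelGenerated_join {S : ∀ m, Set (BaseChange k A (WEnd k V) m)} {m n : ℕ}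
    {a : WEnd k V (m + n)} (ha : WheelGenerated k S (m + n) (pure (1 : A) a))
    {a' : BaseChange k A (WEnd k V) n} (ha' : WheelGenerated k S n a') :
    WheelGenerated k S m (join m n a a') :=
  .contrLast (.act _ _ (.mul ha ha'))

/-- The flip of the last two blocks of outputs makes `contrLast` join the extra inputs of the tensor
to the outputs of `a'` and conversely; hence the order `L`, `K` in the coordinate of `a'`. -/
theorem coord_join {ι : Type*} [Fintype ι] [DecidableEq ι] (b : Module.Basis ι k V) {m n : ℕ}
    (a : WEnd k V (m + n)) (a' : BaseChange k A (WEnd k V) n) (I J : Fin m → ι) :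
    coord b I J (join m n a a') = ∑ K : Fin n → ι, ∑ L : Fin n → ι,
      WEnd.coord b (Fin.append I K) (Fin.append J L) a • coord b L K a' := by
  rw [join_apply, coord_contrLast, ← (Fin.appendEquiv n n).sum_comp, Fintype.sum_prod_type]
  refine Finset.sum_congr rfl fun K _ => Finset.sum_congr rfl fun L _ => ?_
  simp only [Fin.appendEquiv, Equiv.coe_fn_mk]
  rw [coord_act, Equiv.coe_trans, ← Function.comp_assoc, Fin.append_comp_blockSum,
    Fin.append_comp_finAddFlip, Fin.append_append_comp_finCongr, Equiv.coe_refl,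
    Function.comp_id, Fin.append_append_comp_finCongr, coord_mul]
  simp only [Fin.append_comp_castAdd, Fin.append_comp_natAdd]
  rw [coord_pure, smul_mul_assoc, _root_.one_mul]

/-- A coefficient in `A` is traded for extra legs. When `a'` lies in the image of `ev` and so is
invariant, the group then acts on the constant tensor only. -/
theorem join_mul_unit {ι : Type*} [Fintype ι] [DecidableEq ι] (b : Module.Basis ι k V) {m n : ℕ}
    (a : WEnd k V m) (a' : BaseChange k A (WEnd k V) n) (K L : Fin n → ι) :
    join m n (mul (k := k) a (WEnd.unit b K L)) a' = pure (coord b L K a') a := by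
  refine coord_ext b fun I J => ?_
  rw [coord_join, Finset.sum_eq_single K, Finset.sum_eq_single L, WEnd.coord_mul, coord_pure]
  · simp only [Fin.append_comp_castAdd, Fin.append_comp_natAdd]
    rw [WEnd.coord_unit, if_pos ⟨rfl, rfl⟩, _root_.mul_one]
  · intro L' _ h
    rw [WEnd.coord_mul]
    simp only [Fin.append_comp_castAdd, Fin.append_comp_natAdd]
    rw [WEnd.coord_unit, if_neg (fun h' => h h'.2), mul_zero, zero_smul]
  · simp
  · intro K' _ h
    refine Finset.sum_eq_zero fun L' _ => ?_
    rw [WEnd.coord_mul]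
    simp only [Fin.append_comp_castAdd, Fin.append_comp_natAdd]
    rw [WEnd.coord_unit, if_neg (fun h' => h h'.1), mul_zero, zero_smul]
  · simp

end BaseChange

variable [FiniteDimensional k V] [CharZero k]
  {W : ℕ → Type w} [∀ m, AddCommGroup (W m)] [∀ m, Module k (W m)] [Wheelgebra k W]
  {U : Set (W 1)} {R : Type max u v w} [Ring R] [Algebra k R]
  {ev : WheelgebraHom k W (BaseChange k R (WEnd k V))}

/-- The invariants are generated by the image of the universal representation and the identity. -/
theorem IsRepresentationAlgebra.wheelGenerated_of_isGLInvariant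
    (hev : IsRepresentationAlgebra.{u, v, w, max u v w, max u v w} V U ev)
    {Θ : GL →* (R ≃ₐ[k] R)} (hΘ : IsCompatibleAction V ev Θ)
    {S : ∀ m, Set (BaseChange k R (WEnd k V) m)}
    (hS : BaseChange.pure 1 (WEnd.idElem k V) ∈ S 1) (hS' : ∀ m a, ev.app m a ∈ S m)
    {m : ℕ} {y : BaseChange k R (WEnd k V) m} (hy : IsGLInvariant V Θ y) :
    WheelGenerated k S m y := by
  classical
  let b := Module.Free.chooseBasis k V
  let D (g : GL) : BaseChange k R (WEnd k V) m →ₗ[k] BaseChange k R (WEnd k V) m :=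
    BaseChange.diag (Θ g : R →ₐ[k] R) g m
  -- Any `y` is a finite sum of terms `a'_{IJ} ⊗ a`, each turned into a constant tensor of some
  -- degree. The threshold `N₀` bounds these degrees, so that a single average handles the whole
  -- sum.
  have averaged (y : BaseChange k R (WEnd k V) m) :
      ∃ N₀ : ℕ, ∀ N ≥ N₀, ∀ (s : Finset GL) (c : GL → k),
        (∀ n ≤ N, ∀ (a : WEnd k V n) (h : GL),
          WEnd.gl k V h n (∑ g ∈ s, c g • WEnd.gl k V g n a) = ∑ g ∈ s, c g • WEnd.gl k V g n a) →
        WheelGenerated k S m (∑ g ∈ s, c g • D g y) := by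
    have add {y y' : BaseChange k R (WEnd k V) m} (s : Finset GL) (c : GL → k) :
        ∑ g ∈ s, c g • D g (y + y') = ∑ g ∈ s, c g • D g y + ∑ g ∈ s, c g • D g y' := by
      simp only [map_add, smul_add, Finset.sum_add_distrib]
    induction y using BaseChange.induction with
    | hp r a =>
      have hr : r ∈ Submodule.span k {r : R | ∃ (m : ℕ) (I J : Fin m → _) (a : W m),
          ev.entry b I J a = r} := hev.span_entry b ▸ Submodule.mem_top
      induction hr using Submodule.span_induction with
      | mem r h =>
        obtain ⟨n, I, J, a', rfl⟩ := h
        refine ⟨m + n, fun N hN s c hc => ?_⟩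
        have hD (g : GL) : D g (BaseChange.pure (ev.entry b I J a') a) =
            BaseChange.join m n (WEnd.gl k V g (m + n) (mul (k := k) (W := WEnd k V) a (WEnd.unit b J I)))
              (ev.app n a') := by
          rw [← ev.coord_app, ← BaseChange.join_mul_unit]
          refine (BaseChange.diag_join _ g _ _).trans ?_
          congr 1
          exact hΘ n a' g
        have h : ∑ g ∈ s, c g • D g (BaseChange.pure (ev.entry b I J a') a) =
            BaseChange.join m n (∑ g ∈ s, c g • WEnd.gl k V g (m + n)
              (mul (k := k) (W := WEnd k V) a (WEnd.unit b J I))) (ev.app n a') := by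
          simp only [hD, map_sum, map_smul, LinearMap.sum_apply, LinearMap.smul_apply]
        rw [h]
        exact BaseChange.wheelGenerated_join
          (BaseChange.wheelGenerated_pure_one_of_invariant hS fun h => hc _ hN _ h)
          (.mem (hS' n a'))
      | zero =>
        refine ⟨0, fun N _ s c _ => ?_⟩
        have h0 : (BaseChange.pure (0 : R) a : BaseChange k R (WEnd k V) m) = 0 :=
          TensorProduct.zero_tmul _ _
        simp only [h0, map_zero, smul_zero, Finset.sum_const_zero]
        exact .zero
      | add r r' _ _ h h' =>
        obtain ⟨N₁, h₁⟩ := h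
        obtain ⟨N₂, h₂⟩ := h'
        refine ⟨max N₁ N₂, fun N hN s c hc => ?_⟩
        have h0 : (BaseChange.pure (r + r') a : BaseChange k R (WEnd k V) m) =
            BaseChange.pure r a + BaseChange.pure r' a :=
          TensorProduct.add_tmul _ _ _
        rw [h0, add]
        exact .add (h₁ N (le_trans (le_max_left _ _) hN) s c hc)
          (h₂ N (le_trans (le_max_right _ _) hN) s c hc)
      | smul x r _ h =>
        obtain ⟨N₁, h₁⟩ := h
        refine ⟨N₁, fun N hN s c hc => ?_⟩
        have h0 : (BaseChange.pure (x • r) a : BaseChange k R (WEnd k V) m) =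
            x • BaseChange.pure r a :=
          (TensorProduct.smul_tmul' x r a).symm
        simp only [h0, map_smul, smul_comm _ x]
        rw [← Finset.smul_sum]
        exact .smul x (h₁ N hN s c hc)
    | ha y y' h h' =>
      obtain ⟨N₁, h₁⟩ := h
      obtain ⟨N₂, h₂⟩ := h'
      refine ⟨max N₁ N₂, fun N hN s c hc => ?_⟩
      rw [add]
      exact .add (h₁ N (le_trans (le_max_left _ _) hN) s c hc)
        (h₂ N (le_trans (le_max_right _ _) hN) s c hc)
  obtain ⟨N, hN⟩ := averaged y
  obtain ⟨s, c, hc, hs⟩ := exists_reynolds (k := k) (V := V) N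
  have h := hN N le_rfl s c hs
  -- Every translate of the invariant `y` is `y` and the weights add up to `1`, so the average is
  -- `y`.
  have hy' (g : GL) : D g y = y := hy g
  simp only [hy'] at h
  rwa [← Finset.sum_smul, hc, one_smul] at h

end InvariantGeneration

/-! ### Structures induced on the representation algebra -/

theorem Fin.append_comp_blockSwap {α : Type*} {m n p : ℕ} (f : Fin m → α) (g : Fin n → α)
    (h : Fin p → α) :
    Fin.append f (Fin.append g h) ∘ blockSwap n m p = Fin.append g (Fin.append f h) := by
  have h1 : (blockSwap n m p : Fin (n + (m + p)) → Fin (m + (n + p))) =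
      finCongr (Nat.add_assoc m n p) ∘
        (blockSum (finAddFlip : Fin (n + m) ≃ Fin (m + n)) (Equiv.refl (Fin p))) ∘
          (finCongr (Nat.add_assoc n m p).symm) := rfl
  rw [h1, ← Function.comp_assoc, Fin.append_append_comp_finCongr, ← Function.comp_assoc,
    Fin.append_comp_blockSum, Fin.append_comp_finAddFlip, Equiv.coe_refl, Function.comp_id,
    ← Fin.append_append_comp_finCongr]
  rfl

theorem Fin.append_comp_blockRotate {α : Type*} {m n p : ℕ} (f : Fin m → α) (g : Fin n → α)
    (h : Fin p → α) :
    Fin.append (Fin.append g h) f ∘ blockRotate m n p = Fin.append (Fin.append f g) h := by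
  have h1 : (blockRotate m n p : Fin (m + n + p) → Fin (n + p + m)) =
      finAddFlip ∘ finCongr (Nat.add_assoc m n p) := rfl
  rw [h1, ← Function.comp_assoc, Fin.append_comp_finAddFlip, Fin.append_append_comp_finCongr]

section Structures

variable {k : Type u} [Field k] {V : Type v} [AddCommGroup V] [Module k V]
  [FiniteDimensional k V] {ι : Type v} [Fintype ι] [DecidableEq ι] {b : Module.Basis ι k V}
  {W : ℕ → Type w} [∀ m, AddCommGroup (W m)] [∀ m, Module k (W m)] [Wheelgebra k W]
  {U : Set (W 1)} {R : Type max u v w} [Ring R] [Algebra k R]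
  {ev : WheelgebraHom k W (BaseChange k R (WEnd k V))}

/-- A predicate closed under linear combinations holds on the representation algebra if it holds
for matrix elements. -/
theorem IsRepresentationAlgebra.induction_on
    (hev : IsRepresentationAlgebra.{u, v, w, max u v w, max u v w} V U ev)
    (b : Module.Basis ι k V) {p : R → Prop}
    (entry : ∀ (m : ℕ) (I J : Fin m → ι) (a : W m), p (ev.entry b I J a)) (zero : p 0)
    (add : ∀ r r', p r → p r' → p (r + r')) (smul : ∀ (c : k) r, p r → p (c • r)) (r : R) :
    p r := by
  have hr : r ∈ Submodule.span k {r : R | ∃ (m : ℕ) (I J : Fin m → ι) (a : W m),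
      ev.entry b I J a = r} := hev.span_entry b ▸ Submodule.mem_top
  induction hr using Submodule.span_induction with
  | mem r h => obtain ⟨m, I, J, a, rfl⟩ := h; exact entry m I J a
  | zero => exact zero
  | add r r' _ _ h h' => exact add r r' h h'
  | smul c r _ h => exact smul c r h

theorem IsRepresentationAlgebra.linearMap_ext
    (hev : IsRepresentationAlgebra.{u, v, w, max u v w, max u v w} V U ev)
    (b : Module.Basis ι k V) {P : Type*} [AddCommGroup P] [Module k P] {L L' : R →ₗ[k] P}
    (h : ∀ (m : ℕ) (I J : Fin m → ι) (a : W m), L (ev.entry b I J a) = L' (ev.entry b I J a)) :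
    L = L' :=
  LinearMap.ext fun r => hev.induction_on b (p := fun r => L r = L' r) h
    (by rw [map_zero, map_zero]) (fun r r' h h' => by rw [map_add, map_add, h, h'])
    (fun c r h => by rw [map_smul, map_smul, h]) r

theorem IsRepresentationAlgebra.mul_comm_of_isCommWheelgebra
    (hev : IsRepresentationAlgebra.{u, v, w, max u v w, max u v w} V U ev)
    (hW : IsCommWheelgebra k W) (r r' : R) : r * r' = r' * r := by
  classical
  let b := Module.Free.chooseBasis k V
  refine hev.induction_on b (p := fun r => r * r' = r' * r) (fun m I J a => ?_) (by simp)
    (fun r r' h h' => by rw [add_mul, mul_add, h, h']) (fun c r h => by simp [h]) r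
  refine hev.induction_on b (p := fun r' => _ * r' = r' * _) (fun m I' J' a' => ?_) (by simp)
    (fun r r' h h' => by rw [add_mul, mul_add, h, h']) (fun c r h => by simp [h]) r'
  rw [← ev.entry_mul_append, ← ev.entry_mul_append, hW a a', ev.entry_act,
    Fin.append_comp_finAddFlip, Fin.append_comp_finAddFlip]

theorem WheelgebraHom.entry_flip_mul (ev : WheelgebraHom k W (BaseChange k R (WEnd k V)))
    {m n : ℕ} (I J : Fin m → ι) (a : W m) (I' J' : Fin n → ι) (a' : W n) :
    ev.entry b (Fin.append I' I) (Fin.append J' J)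
      (act (k := k) finAddFlip finAddFlip (mul (k := k) a a')) =
        ev.entry b I J a * ev.entry b I' J' a' := by
  rw [ev.entry_act, Fin.append_comp_finAddFlip, Fin.append_comp_finAddFlip, ev.entry_mul_append]

/-! ### Almost commutative algebras -/

variable (b ev) in
/-- The span of the matrix elements of a family of subspaces. -/
def entrySpan (F : ∀ m, Submodule k (W m)) : Submodule k R :=
  Submodule.span k {r : R | ∃ (m : ℕ) (I J : Fin m → ι) (a : W m), a ∈ F m ∧ ev.entry b I J a = r}

theorem entry_mem_entrySpan {F : ∀ m, Submodule k (W m)} {m : ℕ} (I J : Fin m → ι) {a : W m}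
    (ha : a ∈ F m) : ev.entry b I J a ∈ entrySpan b ev F :=
  Submodule.subset_span ⟨m, I, J, a, ha, rfl⟩

/-- A linear map sends `entrySpan` to a subspace if it does so for the spanning matrix elements. -/
theorem map_mem_of_mem_entrySpan {F : ∀ m, Submodule k (W m)} {P : Type*} [AddCommGroup P]
    [Module k P] (L : R →ₗ[k] P) (S : Submodule k P)
    (h : ∀ (m : ℕ) (I J : Fin m → ι) (a : W m), a ∈ F m → L (ev.entry b I J a) ∈ S) {r : R}
    (hr : r ∈ entrySpan b ev F) : L r ∈ S := by
  refine (Submodule.span_le (p := S.comap L)).2 ?_ hr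
  rintro _ ⟨m, I, J, a, ha, rfl⟩
  exact h m I J a ha

theorem map₂_mem_of_mem_entrySpan {F F' : ∀ m, Submodule k (W m)} {P : Type*} [AddCommGroup P]
    [Module k P] (T : R →ₗ[k] R →ₗ[k] P) (S : Submodule k P)
    (h : ∀ (m n : ℕ) (I J : Fin m → ι) (I' J' : Fin n → ι) (a : W m) (a' : W n), a ∈ F m →
      a' ∈ F' n → T (ev.entry b I J a) (ev.entry b I' J' a') ∈ S) {r r' : R}
    (hr : r ∈ entrySpan b ev F) (hr' : r' ∈ entrySpan b ev F') : T r r' ∈ S :=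
  map_mem_of_mem_entrySpan (T.flip r') S (fun m I J a ha =>
    map_mem_of_mem_entrySpan (T (ev.entry b I J a)) S
      (fun n I' J' a' ha' => h m n I J I' J' a a' ha ha') hr') hr

theorem map₂_eq_of_mem_entrySpan {F F' : ∀ m, Submodule k (W m)} {P : Type*} [AddCommGroup P]
    [Module k P] (T T' : R →ₗ[k] R →ₗ[k] P)
    (h : ∀ (m n : ℕ) (I J : Fin m → ι) (I' J' : Fin n → ι) (a : W m) (a' : W n), a ∈ F m →
      a' ∈ F' n → T (ev.entry b I J a) (ev.entry b I' J' a') =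
        T' (ev.entry b I J a) (ev.entry b I' J' a')) {r r' : R}
    (hr : r ∈ entrySpan b ev F) (hr' : r' ∈ entrySpan b ev F') : T r r' = T' r r' := by
  refine sub_eq_zero.1 ((Submodule.mem_bot k).1
    (map₂_mem_of_mem_entrySpan (T - T') ⊥ (fun m n I J I' J' a a' ha ha' => ?_) hr hr'))
  rw [LinearMap.sub_apply, LinearMap.sub_apply, h m n I J I' J' a a' ha ha', sub_self]
  exact Submodule.zero_mem _

theorem entrySpan_mul_mem {F F' F'' : ∀ m, Submodule k (W m)}
    (h : ∀ {m n : ℕ} {a : W m} {a' : W n}, a ∈ F m → a' ∈ F' n → mul (k := k) a a' ∈ F'' (m + n))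
    {r r' : R} (hr : r ∈ entrySpan b ev F) (hr' : r' ∈ entrySpan b ev F') :
    r * r' ∈ entrySpan b ev F'' := by
  refine map₂_mem_of_mem_entrySpan (LinearMap.mul k R) _
    (fun m n I J I' J' a a' ha ha' => ?_) hr hr'
  rw [LinearMap.mul_apply', ← ev.entry_mul_append]
  exact entry_mem_entrySpan _ _ (h ha ha')

/-- Any admissible `F_i` must contain the matrix elements of `W_{≤ i}`, so their span is the
smallest candidate. Products and commutators of matrix elements are matrix elements of products and
twisted commutators, which gives the axioms. -/
theorem IsRepresentationAlgebra.exists_filtration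
    (hev : IsRepresentationAlgebra.{u, v, w, max u v w, max u v w} V U ev)
    {F : ℕ → ∀ m, Submodule k (W m)} (hF : IsAlmostCommWheelgebra k F) :
    ∃ F' : ℕ → Submodule k R, IsAlmostCommAlgebra k F' ∧
      IsLeast {G : ℕ → Submodule k R | ∀ (i m : ℕ) (a : W m), a ∈ F i m →
        ev.app m a ∈ BaseChange.sub k (WEnd k V) (G i) m} F' := by
  classical
  let b := Module.Free.chooseBasis k V
  have mono {i j : ℕ} (hij : i ≤ j) : entrySpan b ev (F i) ≤ entrySpan b ev (F j) := by
    refine Submodule.span_mono ?_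
    rintro _ ⟨m, I, J, a, ha, rfl⟩
    exact ⟨m, I, J, a, hF.mono hij m ha, rfl⟩
  have commutator_mem (F₁ F₂ F₃ : ∀ m, Submodule k (W m))
      (h : ∀ {m n : ℕ} {a : W m} {a' : W n}, a ∈ F₁ m → a' ∈ F₂ n →
        mul (k := k) a' a - act (k := k) finAddFlip finAddFlip (mul (k := k) a a') ∈ F₃ (n + m))
      {r r' : R} (hr : r ∈ entrySpan b ev F₁) (hr' : r' ∈ entrySpan b ev F₂) :
      r' * r - r * r' ∈ entrySpan b ev F₃ := by
    refine map₂_mem_of_mem_entrySpan ((LinearMap.mul k R).flip - LinearMap.mul k R) _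
      (fun m n I J I' J' a a' ha ha' => ?_) hr hr'
    rw [LinearMap.sub_apply, LinearMap.sub_apply, LinearMap.flip_apply, LinearMap.mul_apply',
      LinearMap.mul_apply', ← ev.entry_mul_append, ← ev.entry_flip_mul, ← map_sub]
    exact entry_mem_entrySpan _ _ (h ha ha')
  refine ⟨fun i => entrySpan b ev (F i), ⟨mono, fun r => ?_, ?_, ?_, ?_, ?_⟩, ?_, ?_⟩
  · refine hev.induction_on b (p := fun r => ∃ i, r ∈ entrySpan b ev (F i)) ?_ ?_ ?_ ?_ r
    · intro m I J a
      obtain ⟨i, hi⟩ := hF.exhaustive a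
      exact ⟨i, entry_mem_entrySpan I J hi⟩
    · exact ⟨0, Submodule.zero_mem _⟩
    · rintro r r' ⟨i, hi⟩ ⟨j, hj⟩
      exact ⟨max i j, Submodule.add_mem _ (mono (le_max_left i j) hi) (mono (le_max_right i j) hj)⟩
    · rintro c r ⟨i, hi⟩
      exact ⟨i, Submodule.smul_mem _ c hi⟩
  · rw [← ev.entry_one b Fin.elim0 Fin.elim0]
    exact entry_mem_entrySpan _ _ hF.one_mem
  · intro i j r r' hr hr'
    exact entrySpan_mul_mem hF.mul_mem hr hr'
  · intro r r' hr hr'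
    -- The zero subspace plays the role of the filtration step of index `-1`.
    have h := commutator_mem (F 0) (F 0) (fun _ => ⊥) (fun ha ha' => hF.comm_zero ha ha') hr hr'
    have h0 : entrySpan b ev (fun m => (⊥ : Submodule k (W m))) = ⊥ := by
      refine eq_bot_iff.2 (Submodule.span_le.2 ?_)
      rintro _ ⟨m, I, J, a, ha, rfl⟩
      rw [(Submodule.mem_bot k).1 ha, map_zero]
      exact Submodule.zero_mem _
    rwa [h0] at h
  · intro i j l r r' hl hr hr'
    exact commutator_mem (F i) (F j) (F l) (fun ha ha' => hF.comm_succ hl ha ha') hr hr'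
  · intro i m a ha
    rw [BaseChange.mem_sub_iff b]
    exact fun I J => entry_mem_entrySpan I J ha
  · intro G hG i
    refine Submodule.span_le.2 ?_
    rintro _ ⟨m, I, J, a, ha, rfl⟩
    exact (BaseChange.mem_sub_iff b (G i) _).1 (hG i m a ha) I J

end Structures

/-! ### Poisson brackets -/

section Units

variable {k : Type u} [Field k] {ι : Type v} [Fintype ι] [DecidableEq ι]
  {W : ℕ → Type w} [∀ m, AddCommGroup (W m)] [∀ m, Module k (W m)] [Wheelgebra k W]

theorem Fin.insertNth_natAdd_zero {α : Type*} (c : α) (p : Fin 1 → α) :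
    Fin.insertNth (n := 1 + 0) (α := fun _ => α) (Fin.natAdd 1 (0 : Fin 1)) c p =
      (Fin.append p (fun _ : Fin 1 => c) : Fin (1 + 1) → α) := by
  funext a
  fin_cases a <;> rfl

theorem Fin.insertNth_castAdd_zero {α : Type*} (c : α) (p : Fin 1 → α) :
    Fin.insertNth (n := 1 + 0) (α := fun _ => α) (Fin.castAdd 1 (0 : Fin 1)) c p =
      (Fin.append (fun _ : Fin 1 => c) p : Fin (1 + 1) → α) := by
  funext a
  fin_cases a <;> rfl

/-- A family which acts as a derivation on the product of a wheeled unit with itself vanishes on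
this unit. -/
theorem IsCompatFamily.unit_eq_zero {R : Type*} [Ring R] [Algebra k R] {f : EntryFamily k ι W R}
    (hf : IsCompatFamily ∅ f) {t : W 1} (ht : IsWheelUnit k t)
    (hmul : ∀ p q p' q' : Fin 1 → ι,
      f (1 + 1) (Fin.append p p') (Fin.append q q') (mul (k := k) t t) =
        (if p' 0 = q' 0 then f 1 p q t else 0) + (if p 0 = q 0 then f 1 p' q' t else 0))
    (p q : Fin 1 → ι) : f 1 p q t = 0 := by
  -- Joining `t` to itself gives `t`. Expanding `t t` by `hmul` and summing over the joined letter,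
  -- each Kronecker delta leaves one copy of `f 1 p q t`, so `f 1 p q t` equals twice itself.
  have h := congrArg (f (1 + 0) p q) (ht (m := 0) t).1
  rw [hf.map_contr, hf.map_recast] at h
  have hc (r : Fin 1 → ι) : (fun _ : Fin 1 => r 0) = r := by
    funext a; rw [Subsingleton.elim a 0]
  have h1 : ∀ c : ι, f (1 + 0 + 1)
      (Fin.insertNth (n := 1 + 0) (α := fun _ => ι) (Fin.natAdd 1 (0 : Fin 1)) c p)
      (Fin.insertNth (n := 1 + 0) (α := fun _ => ι) (Fin.castAdd 1 (0 : Fin 1)) c q)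
      (mul (k := k) t t) =
        (if c = q 0 then f 1 p (fun _ => c) t else 0) +
          (if p 0 = c then f 1 (fun _ => c) q t else 0) := by
    intro c
    rw [Fin.insertNth_natAdd_zero, Fin.insertNth_castAdd_zero]
    exact hmul p (fun _ => c) (fun _ => c) q
  rw [Finset.sum_congr rfl fun c _ => h1 c, Finset.sum_add_distrib] at h
  simp only [Finset.sum_ite_eq, Finset.sum_ite_eq', Finset.mem_univ, if_true, hc] at h
  exact add_eq_left.1 h

/-- Compatibility with wheeled units can be checked on products `a t`, if the wheeled units are
central. -/
theorem IsCompatFamily.of_mul_unit {P : Type*} [AddCommGroup P] [Module k P]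
    {f : EntryFamily k ι W P} (hf : IsCompatFamily ∅ f) {U : Set (W 1)}
    (hcomm : ∀ t ∈ U, ∀ {m : ℕ} (a : W m),
      mul (k := k) t a = act (k := k) finAddFlip finAddFlip (mul (k := k) a t))
    (hunit : ∀ t ∈ U, ∀ {m : ℕ} (a : W m) (I J : Fin m → ι) (p q : Fin 1 → ι),
      f (m + 1) (Fin.append I p) (Fin.append J q) (mul (k := k) a t) =
        if p 0 = q 0 then f m I J a else 0) :
    IsCompatFamily U f where
  map_act := hf.map_act
  map_contr := hf.map_contr
  map_unit t ht {m n} a a' I J p q I' J' := by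
    have h := hf.map_recast (Nat.add_assoc m 1 n) (mul (k := k) (mul (k := k) a t) a')
      (Fin.append I (Fin.append p I')) (Fin.append J (Fin.append q J'))
    rw [Fin.append_append_comp_finCongr, Fin.append_append_comp_finCongr] at h
    -- Centrality moves `t` past `a'` to the right end, where `hunit` applies to the product `a a'`.
    rw [← h, Wheelgebra.mul_assoc, hcomm t ht, act_mul_right, hf.map_act,
      Fin.append_comp_blockSum, Fin.append_comp_blockSum, Fin.append_comp_finAddFlip,
      Fin.append_comp_finAddFlip, Equiv.coe_refl, Function.comp_id,
      Function.comp_id, ← Wheelgebra.mul_assoc, hf.map_recast, Fin.append_append_comp_finCongr,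
      Fin.append_append_comp_finCongr, hunit t ht]

end Units

section Poisson

variable {k : Type u} [Field k] {V : Type v} [AddCommGroup V] [Module k V]
  [FiniteDimensional k V] {ι : Type v} [Fintype ι] [DecidableEq ι] {b : Module.Basis ι k V}
  {W : ℕ → Type w} [∀ m, AddCommGroup (W m)] [∀ m, Module k (W m)] [Wheelgebra k W]
  {U : Set (W 1)}

section Operators

variable {R : Type*} [Ring R] [Algebra k R]
  (ev : WheelgebraHom k W (BaseChange k R (WEnd k V)))

/-- Matrix elements of a family of operators which raise the degree by `m`, equivariant and
compatible with contractions, give a compatible family. -/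
theorem isCompatFamily_entry_comp {m : ℕ} (T : ∀ n, W n →ₗ[k] W (m + n))
    (hact : ∀ {n n' : ℕ} (σ τ : Fin n ≃ Fin n') (a : W n), T n' (act (k := k) σ τ a) =
      act (k := k) (blockSum (Equiv.refl _) σ) (blockSum (Equiv.refl _) τ) (T n a))
    (hcontr : ∀ {n : ℕ} (i j : Fin (n + 1)) (a : W (n + 1)), T n (contr (k := k) i j a) =
      contr (k := k) (m := m + n) (Fin.natAdd m i) (Fin.natAdd m j) (T (n + 1) a))
    (I J : Fin m → ι) :
    IsCompatFamily ∅ (fun n I' J' => ev.entry b (Fin.append I I') (Fin.append J J') ∘ₗ T n) where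
  map_act σ τ a I' J' := by
    simp only [LinearMap.comp_apply]
    rw [hact, ev.entry_act, Fin.append_comp_blockSum, Fin.append_comp_blockSum]
    rfl
  map_contr i j a I' J' := by
    simp only [LinearMap.comp_apply]
    rw [hcontr, ev.entry_contr]
    simp only [Fin.insertNth_append_right]
  map_unit t ht := ht.elim

end Operators

variable {R : Type max u v w} [Ring R] [Algebra k R]
  {ev : WheelgebraHom k W (BaseChange k R (WEnd k V))}

/-- The matrix elements of the two terms of a Leibniz rule in `W`. The reordering of blocks in each
term exactly undoes the displacement of the words, so the rule becomes the ordinary one. -/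
theorem WheelgebraHom.entry_leibniz (ev : WheelgebraHom k W (BaseChange k R (WEnd k V)))
    {m n p : ℕ} (x : W (m + n)) (c : W p) (a : W n) (y : W (m + p)) (I J : Fin m → ι)
    (I' J' : Fin n → ι) (I'' J'' : Fin p → ι) :
    ev.entry b (Fin.append I (Fin.append I' I'')) (Fin.append J (Fin.append J' J''))
        (recast k (Nat.add_assoc m n p) (mul (k := k) x c)) =
      ev.entry b (Fin.append I I') (Fin.append J J') x * ev.entry b I'' J'' c ∧
    ev.entry b (Fin.append I (Fin.append I' I'')) (Fin.append J (Fin.append J' J''))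
        (act (k := k) (blockSwap n m p) (blockSwap n m p) (mul (k := k) a y)) =
      ev.entry b I' J' a * ev.entry b (Fin.append I I'') (Fin.append J J'') y := by
  constructor
  · rw [ev.entry_recast, Fin.append_append_comp_finCongr, Fin.append_append_comp_finCongr,
      ev.entry_mul_append]
  · rw [ev.entry_act, Fin.append_comp_blockSwap, Fin.append_comp_blockSwap, ev.entry_mul_append]

/-- The bracket on the representation algebra, on matrix elements. -/
theorem IsRepresentationAlgebra.exists_bracket
    (hev : IsRepresentationAlgebra.{u, v, w, max u v w, max u v w} V U ev)
    (hU : ∀ t ∈ U, IsWheelUnit k t) (b : Module.Basis ι k V)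
    {br : ∀ m n : ℕ, W m →ₗ[k] W n →ₗ[k] W (m + n)} (hbr : IsPoissonWheelgebra k br) :
    ∃ β : R →ₗ[k] R →ₗ[k] R, ∀ (m n : ℕ) (I J : Fin m → ι) (I' J' : Fin n → ι) (a : W m)
      (a' : W n), β (ev.entry b I J a) (ev.entry b I' J' a') =
        ev.entry b (Fin.append I I') (Fin.append J J') (br m n a a') := by
  have hrep := (isRepresentation_iff_entry b U ev).1 hev.1
  have hunit {t : W 1} (ht : t ∈ U) {m : ℕ} (I J : Fin m → ι) (a : W m) (p q : Fin 1 → ι) :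
      ev.entry b (Fin.append I p) (Fin.append J q) (mul (k := k) a t) =
        if p 0 = q 0 then ev.entry b I J a else 0 := by
    rw [ev.entry_mul_append, hrep t ht, mul_ite, _root_.mul_one, mul_zero]
  have hcomm {t : W 1} {m : ℕ} (a : W m) :
      mul (k := k) t a = act (k := k) finAddFlip finAddFlip (mul (k := k) a t) := hbr.comm a t
  have step {m : ℕ} (I J : Fin m → ι) (a : W m) : ∃ L : R →ₗ[k] R, ∀ (n : ℕ) (I' J' : Fin n → ι)
      (a' : W n), L (ev.entry b I' J' a') =
        ev.entry b (Fin.append I I') (Fin.append J J') (br m n a a') := by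
    have hf := isCompatFamily_entry_comp (b := b) ev (fun n => br m n a)
      (fun σ τ a' => by
        conv_lhs => rw [← act_refl (k := k) a]
        exact hbr.isWheelBilinear.map_act _ _ σ τ a a')
      (fun i j a' => hbr.isWheelBilinear.map_contr_right i j a a') I J
    refine hev.exists_linearMap b (hf.of_mul_unit (U := U) (fun t _ _ a => hcomm a) ?_)
    have hleib {n p : ℕ} (I' J' : Fin n → ι) (I'' J'' : Fin p → ι) (a' : W n) (c : W p) :
        ev.entry b (Fin.append I (Fin.append I' I'')) (Fin.append J (Fin.append J' J''))
          (br m (n + p) a (mul (k := k) a' c)) =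
        ev.entry b (Fin.append I I') (Fin.append J J') (br m n a a') * ev.entry b I'' J'' c +
          ev.entry b I' J' a' *
            ev.entry b (Fin.append I I'') (Fin.append J J'') (br m p a c) := by
      rw [hbr.leibniz, map_add, (ev.entry_leibniz _ _ a' (br m p a c) I J I' J' I'' J'').1,
        (ev.entry_leibniz (br m n a a') c _ _ I J I' J' I'' J'').2]
    intro t ht n a' I' J' p q
    -- The bracket with `a` is a derivation, so its matrix elements vanish on `t`; Leibniz then
    -- shows that it respects multiplication by `t`.
    have h0 := hf.unit_eq_zero (hU t ht) (fun p q p' q' => by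
      simp only [LinearMap.comp_apply]
      rw [hleib, hrep t ht, hrep t ht, mul_ite, _root_.mul_one, mul_zero, ite_mul,
        _root_.one_mul, zero_mul]) p q
    simp only [LinearMap.comp_apply] at h0 ⊢
    rw [hleib, h0, mul_zero, add_zero, hrep t ht, mul_ite, _root_.mul_one, mul_zero]
  choose L hL using @step
  -- Each `L I J a` was chosen separately, with no control on the dependence on `a`. Skew symmetry
  -- makes that dependence linear and compatible, by exchanging the arguments on matrix elements.
  have hskew {m n : ℕ} (I J : Fin m → ι) (a : W m) (I' J' : Fin n → ι) (a' : W n) :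
      L I J a (ev.entry b I' J' a') = -L I' J' a' (ev.entry b I J a) := by
    rw [hL, hL, hbr.skew a a', map_neg, ev.entry_act, Fin.append_comp_finAddFlip,
      Fin.append_comp_finAddFlip, neg_neg]
  let g : EntryFamily k ι W (R →ₗ[k] R) := fun m I J =>
    { toFun := L I J
      map_add' := fun a a' => hev.linearMap_ext b fun n I' J' c => by
        rw [hskew, map_add, map_add, neg_add, ← hskew, ← hskew, LinearMap.add_apply]
      map_smul' := fun s a => hev.linearMap_ext b fun n I' J' c => by
        rw [hskew, map_smul, map_smul, ← smul_neg, ← hskew, RingHom.id_apply,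
          LinearMap.smul_apply] }
  have hg {m : ℕ} (I J : Fin m → ι) (a : W m) {n : ℕ} (I' J' : Fin n → ι) (c : W n) :
      g m I J a (ev.entry b I' J' c) = -L I' J' c (ev.entry b I J a) := hskew I J a I' J' c
  have hg0 : IsCompatFamily ∅ g :=
    { map_act := fun σ τ a I J => hev.linearMap_ext b fun n I' J' c => by
        rw [hg, hg, ev.entry_act]
      map_contr := fun i j a I J => hev.linearMap_ext b fun n I' J' c => by
        rw [LinearMap.sum_apply, hg, ev.entry_contr, map_sum, ← Finset.sum_neg_distrib]
        exact Finset.sum_congr rfl fun d _ => (hg _ _ _ _ _ _).symm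
      map_unit := fun t ht => ht.elim }
  obtain ⟨β, hβ⟩ := hev.exists_linearMap b (hg0.of_mul_unit (U := U) (fun t _ _ a => hcomm a)
    fun t ht m a I J p q => hev.linearMap_ext b fun n I' J' c => by
      rw [hg, hunit ht]
      split_ifs
      · rw [hg]
      · rw [map_zero, neg_zero, LinearMap.zero_apply])
  exact ⟨β, fun m n I J I' J' a a' => by rw [hβ]; exact hL I J a n I' J' a'⟩

theorem IsRepresentationAlgebra.existsUnique_bracket
    (hev : IsRepresentationAlgebra.{u, v, w, max u v w, max u v w} V U ev)
    (hU : ∀ t ∈ U, IsWheelUnit k t)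
    {br : ∀ m n : ℕ, W m →ₗ[k] W n →ₗ[k] W (m + n)} (hbr : IsPoissonWheelgebra k br) :
    ∃! β : R →ₗ[k] R →ₗ[k] R, IsPoissonAlgebra k β ∧
      ∀ (m n : ℕ) (a : W m) (a' : W n), ev.app (m + n) (br m n a a') =
        BaseChange.bilin k β Wheelgebra.mul (ev.app m a) (ev.app n a') := by
  classical
  let b := Module.Free.chooseBasis k V
  obtain ⟨β, hβ⟩ := hev.exists_bracket hU b hbr
  have heq {β' : R →ₗ[k] R →ₗ[k] R} (h : ∀ (m n : ℕ) (a : W m) (a' : W n),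
      ev.app (m + n) (br m n a a') =
        BaseChange.bilin k β' Wheelgebra.mul (ev.app m a) (ev.app n a')) : β' = β :=
    hev.linearMap_ext b fun m I J a => hev.linearMap_ext b fun n I' J' a' => by
      have h' := congrArg (BaseChange.coord b (Fin.append I I') (Fin.append J J')) (h m n a a')
      rw [BaseChange.coord_bilin, Fin.append_comp_castAdd, Fin.append_comp_castAdd,
        Fin.append_comp_natAdd, Fin.append_comp_natAdd] at h'
      rw [hβ]
      exact h'.symm
  -- Exchanging arguments lets each axiom be stated as an equality of multilinear maps, which may be
  -- tested on matrix elements one argument at a time.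
  let swap : (R →ₗ[k] R →ₗ[k] R) →ₗ[k] (R →ₗ[k] R →ₗ[k] R) := LinearMap.lflip.toLinearMap
  refine ⟨β, ⟨⟨hev.mul_comm_of_isCommWheelgebra hbr.comm, fun r r' => ?_, fun r r' r'' => ?_,
    fun r r' r'' => ?_⟩, fun m n a a' => ?_⟩, fun β' h => heq h.2⟩
  · have : β.flip = -β :=
      hev.linearMap_ext b fun m I J a => hev.linearMap_ext b fun n I' J' a' => by
      rw [LinearMap.flip_apply, LinearMap.neg_apply, LinearMap.neg_apply, hβ, hβ, hbr.skew a a',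
        map_neg, ev.entry_act, Fin.append_comp_finAddFlip, Fin.append_comp_finAddFlip]
    exact congrArg (fun T => T r r') this
  · let M : R →ₗ[k] R →ₗ[k] R →ₗ[k] R := β.compr₂ β
    have : M + swap ∘ₗ M.flip + (swap ∘ₗ M).flip = 0 :=
      hev.linearMap_ext b fun m I J a => hev.linearMap_ext b fun n I' J' a' =>
        hev.linearMap_ext b fun p I'' J'' a'' => by
          change β (β _ _) _ + β (β _ _) _ + β (β _ _) _ = 0
          rw [hβ, hβ, hβ, hβ, hβ, hβ]
          have h := congrArg (ev.entry b (Fin.append (Fin.append I I') I'')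
            (Fin.append (Fin.append J J') J'')) (hbr.jacobi a a' a'')
          rw [map_add, map_add, map_zero, ev.entry_act, ev.entry_act, Fin.append_comp_blockRotate,
            Fin.append_comp_blockRotate, ← Fin.append_comp_blockRotate I,
            ← Fin.append_comp_blockRotate J, Function.comp_assoc, Function.comp_assoc,
            Equiv.self_comp_symm, Function.comp_id, Function.comp_id] at h
          rw [← Fin.append_comp_blockRotate I, ← Fin.append_comp_blockRotate J]
          exact h
    exact congrArg (fun T => T r r' r'') this
  · have : (swap ∘ₗ (LinearMap.mul k R).compr₂ β.flip).flip =
        β.compr₂ (LinearMap.mul k R) + swap ∘ₗ β.compr₂ (LinearMap.mul k R).flip :=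
      hev.linearMap_ext b fun m I J a => hev.linearMap_ext b fun n I' J' a' =>
        hev.linearMap_ext b fun p I'' J'' a'' => by
          change β _ (_ * _) = β _ _ * _ + _ * β _ _
          rw [← ev.entry_mul_append, hβ, hβ, hβ, hbr.leibniz, map_add,
            (ev.entry_leibniz _ _ a' (br m p a a'') I J I' J' I'' J'').1,
            (ev.entry_leibniz (br m n a a') a'' _ _ I J I' J' I'' J'').2]
    exact congrArg (fun T => T r r' r'') this
  · refine BaseChange.coord_ext b fun I J => ?_
    rw [BaseChange.coord_bilin]
    refine Eq.trans ?_ (hβ m n (I ∘ Fin.castAdd n) (J ∘ Fin.castAdd n) (I ∘ Fin.natAdd m)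
      (J ∘ Fin.natAdd m) a a').symm
    rw [Fin.append_castAdd_natAdd_comp, Fin.append_castAdd_natAdd_comp]
    rfl

end Poisson

/-! ### Gradings -/

section Gradings

variable {k : Type u} [Field k] {M : Type*} [AddCommGroup M] [Module k M] {A : ℤ → Submodule k M}

theorem DirectSum.IsInternal.exists_projections (hA : DirectSum.IsInternal A) :
    ∃ π : ℤ → M →ₗ[k] M, (∀ d, ∀ x ∈ A d, π d x = x) ∧
      ∀ d e, e ≠ d → ∀ x ∈ A e, π d x = 0 := by
  classical
  let E := LinearEquiv.ofBijective (DirectSum.coeLinearMap A) hA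
  have hE {e : ℤ} {x : M} (hx : x ∈ A e) :
      E.symm x = DirectSum.lof k ℤ (fun d => A d) e ⟨x, hx⟩ := by
    rw [LinearEquiv.symm_apply_eq]
    exact (DirectSum.coeLinearMap_lof A e ⟨x, hx⟩).symm
  refine ⟨fun d => (A d).subtype ∘ₗ DirectSum.component k ℤ (fun d => A d) d ∘ₗ
    E.symm.toLinearMap, fun d x hx => ?_, fun d e hde x hx => ?_⟩
  · change ((DirectSum.component k ℤ (fun d => A d) d (E.symm x) : A d) : M) = x
    rw [hE hx, DirectSum.component.lof_self]
  · change ((DirectSum.component k ℤ (fun d => A d) d (E.symm x) : A d) : M) = 0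
    rw [hE hx, DirectSum.component.of, dif_neg hde, ZeroMemClass.coe_zero]

theorem DirectSum.IsInternal.homogeneous_induction (hA : DirectSum.IsInternal A) {p : M → Prop}
    (homogeneous : ∀ d, ∀ x ∈ A d, p x) (add : ∀ x y, p x → p y → p (x + y)) (x : M) : p x := by
  have hx : x ∈ ⨆ d, A d := hA.submodule_iSup_eq_top ▸ Submodule.mem_top
  induction hx using Submodule.iSup_induction' with
  | mem d x hx => exact homogeneous d x hx
  | zero => exact homogeneous 0 0 (Submodule.zero_mem _)
  | add x y _ _ hx hy => exact add x y hx hy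

theorem DirectSum.isInternal_of_projections (π : ℤ → M →ₗ[k] M) (h : ∀ d, ∀ x ∈ A d, π d x = x)
    (h' : ∀ d e, e ≠ d → ∀ x ∈ A e, π d x = 0) (hA : ⨆ d, A d = ⊤) : DirectSum.IsInternal A := by
  refine DirectSum.isInternal_submodule_of_iSupIndep_of_iSup_eq_top (fun d => ?_) hA
  rw [Submodule.disjoint_def]
  intro x hx hx'
  have hle : ⨆ e, ⨆ (_ : e ≠ d), A e ≤ LinearMap.ker (π d) :=
    iSup₂_le fun e he y hy => h' d e he y hy
  rw [← h d x hx]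
  exact hle hx'

/-- Decompose `x ∈ B d` along `A`: the projection of `B` to degree `d` fixes `x`, and it kills the
components in `A e ≤ B e` for `e ≠ d`, so only the component in `A d` is left. -/
theorem DirectSum.IsInternal.eq_of_le {B : ℤ → Submodule k M} (hA : DirectSum.IsInternal A)
    (hB : DirectSum.IsInternal B) (hAB : ∀ d, A d ≤ B d) : A = B := by
  obtain ⟨π, hπ, hπ'⟩ := hB.exists_projections
  refine funext fun d => le_antisymm (hAB d) fun x hx => ?_
  rw [← hπ d x hx]
  refine hA.homogeneous_induction (p := fun x => π d x ∈ A d) (fun e y hy => ?_)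
    (fun y z hy hz => by rw [map_add]; exact Submodule.add_mem _ hy hz) x
  rcases eq_or_ne e d with rfl | he
  · rwa [hπ e y (hAB e hy)]
  · rw [hπ' d e he y (hAB e hy)]
    exact Submodule.zero_mem _

theorem LinearMap.map_negOnePow_smul {N : Type*} [AddCommGroup N] [Module k N] (f : M →ₗ[k] N)
    (d : ℤ) (x : M) : f (d.negOnePow • x) = d.negOnePow • f x := by
  rw [Units.smul_def, Units.smul_def, map_zsmul]

end Gradings

/-! ### Projections and wheeled units in BV wheelgebras -/

section BVWheelgebras

variable {k : Type u} [Field k] {W : ℕ → Type w} [∀ m, AddCommGroup (W m)] [∀ m, Module k (W m)]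
  [Wheelgebra k W] {𝒢 : ℤ → ∀ m, Submodule k (W m)} {Δ : ∀ m, W m →ₗ[k] W m}

/-- Wheeled units which commute are equal. -/
theorem IsWheelUnit.eq_of_commute {t t' : W 1} (ht : IsWheelUnit k t) (ht' : IsWheelUnit k t')
    (h : mul (k := k) t' t = act (k := k) finAddFlip finAddFlip (mul (k := k) t t')) : t = t' := by
  have h1 := (ht (m := 0) t').1
  have h2 := (ht' (m := 0) t).2
  -- Both `h1` and `h2` join the output of `t` to the input of `t'`, in `t t'` and in `t' t`
  -- respectively; the flip identifies the two contractions.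
  have h3 := contr_act (k := k) (W := W) (m := 1) (n := 1) (finAddFlip : Fin (1 + 1) ≃ Fin (1 + 1))
    finAddFlip (Equiv.refl _) (Equiv.refl _) 0 1 (by decide) (by decide) (mul (k := k) t t')
  rw [act_refl, ← h] at h3
  have h4 : recast k (Nat.add_comm 0 1) t = recast k (Nat.add_comm 0 1) t' :=
    h2.symm.trans (h3.trans h1)
  have h5 (s : W 1) : recast k (Nat.add_comm 0 1) s = s := act_refl s
  rwa [h5, h5] at h4

/-- `π d` is the projection to the homogeneous component of degree `d`. -/
structure IsGradedProjection (𝒢 : ℤ → ∀ m, Submodule k (W m)) (π : ℤ → ∀ m, W m →ₗ[k] W m) :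
    Prop where
  eq_self : ∀ {d : ℤ} {m : ℕ} {a : W m}, a ∈ 𝒢 d m → π d m a = a
  eq_zero : ∀ {d e : ℤ} {m : ℕ} {a : W m}, e ≠ d → a ∈ 𝒢 e m → π d m a = 0

/-- The linear map `b ↦ wheelBracketOf k Δ d a b`. -/
def wheelBracketMap (Δ : ∀ m, W m →ₗ[k] W m) (d : ℤ) {m : ℕ} (a : W m) (n : ℕ) :
    W n →ₗ[k] W (m + n) :=
  Δ (m + n) ∘ₗ mul (k := k) a - mul (k := k) (Δ m a) -
    (d.negOnePow : ℤ) • (mul (k := k) a ∘ₗ Δ n)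

theorem wheelBracketMap_apply (Δ : ∀ m, W m →ₗ[k] W m) (d : ℤ) {m n : ℕ} (a : W m) (a' : W n) :
    wheelBracketMap Δ d a n a' = wheelBracketOf k Δ d a a' := rfl

namespace IsBVWheelgebra

theorem exists_projections (h : IsBVWheelgebra k 𝒢 Δ) :
    ∃ π : ℤ → ∀ m, W m →ₗ[k] W m, IsGradedProjection 𝒢 π := by
  choose π h1 h2 using fun m => (h.isInternal m).exists_projections
  exact ⟨fun d m => π m d, fun ha => h1 _ _ _ ha, fun he ha => h2 _ _ _ he _ ha⟩

theorem proj_mem (h : IsBVWheelgebra k 𝒢 Δ) {π : ℤ → ∀ m, W m →ₗ[k] W m}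
    (hπ : IsGradedProjection 𝒢 π) (d : ℤ) {m : ℕ} (a : W m) : π d m a ∈ 𝒢 d m := by
  refine (h.isInternal m).homogeneous_induction (p := fun a => π d m a ∈ 𝒢 d m) (fun e x hx => ?_)
    (fun x y hx hy => by rw [map_add]; exact Submodule.add_mem _ hx hy) a
  rcases eq_or_ne e d with rfl | he
  · rwa [hπ.eq_self hx]
  · rw [hπ.eq_zero he hx]
    exact Submodule.zero_mem _

/-- Linear maps which preserve degrees commute with projections. -/
theorem proj_comm (h : IsBVWheelgebra k 𝒢 Δ) {π : ℤ → ∀ m, W m →ₗ[k] W m}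
    (hπ : IsGradedProjection 𝒢 π) {m n : ℕ} (T : W m →ₗ[k] W n)
    (hT : ∀ d, ∀ a ∈ 𝒢 d m, T a ∈ 𝒢 d n) (d : ℤ) (a : W m) : π d n (T a) = T (π d m a) := by
  refine (h.isInternal m).homogeneous_induction (p := fun a => π d n (T a) = T (π d m a))
    (fun e x hx => ?_) (fun x y hx hy => by rw [map_add, map_add, map_add, map_add, hx, hy]) a
  rcases eq_or_ne e d with rfl | he
  · rw [hπ.eq_self hx, hπ.eq_self (hT e x hx)]
  · rw [hπ.eq_zero he hx, hπ.eq_zero he (hT e x hx), map_zero]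

/-- Elements of degree `0` are central. -/
theorem mul_comm_of_mem_zero (h : IsBVWheelgebra k 𝒢 Δ) {n : ℕ} {a' : W n} (ha' : a' ∈ 𝒢 0 n)
    {m : ℕ} (a : W m) :
    mul (k := k) a' a = act (k := k) finAddFlip finAddFlip (mul (k := k) a a') := by
  refine (h.isInternal m).homogeneous_induction (p := fun a =>
    mul (k := k) a' a = act (k := k) finAddFlip finAddFlip (mul (k := k) a a')) (fun d x hx => ?_)
    (fun x y hx hy => by rw [map_add, hx, hy, map_add, LinearMap.add_apply, map_add]) a
  rw [h.supercomm hx ha', mul_zero, Int.negOnePow_zero, one_smul]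

/-- Contractions preserve degrees. In the identity for `t` and a homogeneous `x`, the part of the
degree of `x` involves only the degree `0` component of `t`. -/
theorem isWheelUnit_proj (h : IsBVWheelgebra k 𝒢 Δ) {π : ℤ → ∀ m, W m →ₗ[k] W m}
    (hπ : IsGradedProjection 𝒢 π) {t : W 1} (ht : IsWheelUnit k t) : IsWheelUnit k (π 0 1 t) := by
  intro m a
  have hmul {d : ℤ} {x : W (m + 1)} (hx : x ∈ 𝒢 d (m + 1)) :
      π d _ (mul (k := k) t x) = mul (k := k) (π 0 1 t) x := by
    refine (h.isInternal 1).homogeneous_induction (p := fun t =>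
      π d _ (mul (k := k) t x) = mul (k := k) (π 0 1 t) x) (fun e s hs => ?_)
      (fun s s' hs hs' => by
        rw [map_add, LinearMap.add_apply, map_add, hs, hs', map_add, map_add,
          LinearMap.add_apply]) t
    rcases eq_or_ne e 0 with rfl | he
    · rw [hπ.eq_self hs, hπ.eq_self (by simpa using h.mul_mem hs hx)]
    · rw [hπ.eq_zero he hs, hπ.eq_zero (by simpa using he) (h.mul_mem hs hx), map_zero,
        LinearMap.zero_apply]
  have hcontr (i j : Fin (1 + m + 1))
      (hij : ∀ x : W (m + 1), contr (k := k) (m := 1 + m) i j (mul (k := k) t x) =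
        recast k (Nat.add_comm m 1) x) :
      contr (k := k) (m := 1 + m) i j (mul (k := k) (π 0 1 t) a) =
        recast k (Nat.add_comm m 1) a := by
    refine (h.isInternal (m + 1)).homogeneous_induction (p := fun a =>
      contr (k := k) (m := 1 + m) i j (mul (k := k) (π 0 1 t) a) =
        recast k (Nat.add_comm m 1) a) (fun d x hx => ?_)
      (fun x y hx hy => by rw [map_add, map_add, map_add, hx, hy]) a
    have h1 := congrArg (π d (1 + m)) (hij x)
    rw [h.proj_comm hπ _ (fun d x hx => h.contr_mem i j hx)] at h1
    have h2 : π d (1 + m) (recast k (Nat.add_comm m 1) x) = recast k (Nat.add_comm m 1) x :=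
      hπ.eq_self (h.act_mem _ _ hx)
    exact (congrArg _ (hmul hx).symm).trans (h1.trans h2)
  exact ⟨hcontr _ _ fun x => (ht x).1, hcontr _ _ fun x => (ht x).2⟩

/-- Wheeled units have degree `0`. -/
theorem isWheelUnit_mem (h : IsBVWheelgebra k 𝒢 Δ) {t : W 1} (ht : IsWheelUnit k t) :
    t ∈ 𝒢 0 1 := by
  obtain ⟨π, hπ⟩ := h.exists_projections
  have hmem := h.proj_mem hπ 0 t
  -- The degree `0` component of `t` is again a wheeled unit, and it is central, so it equals `t`.
  rw [ht.eq_of_commute (h.isWheelUnit_proj hπ ht) (h.mul_comm_of_mem_zero hmem t)]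
  exact hmem

theorem wheelBracketOf_act (h : IsBVWheelgebra k 𝒢 Δ) (d : ℤ) {m n n' : ℕ} (σ τ : Fin n ≃ Fin n')
    (a : W m) (a' : W n) :
    wheelBracketOf k Δ d a (act (k := k) σ τ a') =
      act (k := k) (blockSum (Equiv.refl _) σ) (blockSum (Equiv.refl _) τ)
        (wheelBracketOf k Δ d a a') := by
  simp only [wheelBracketOf]
  rw [h.map_act, act_mul_right, act_mul_right, act_mul_right, h.map_act, map_sub, map_sub,
    LinearMap.map_negOnePow_smul]

theorem wheelBracketOf_contr (h : IsBVWheelgebra k 𝒢 Δ) (d : ℤ) {m n : ℕ} (i j : Fin (n + 1))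
    (a : W m) (a' : W (n + 1)) :
    wheelBracketOf k Δ d a (contr (k := k) i j a') =
      contr (k := k) (m := m + n) (Fin.natAdd m i) (Fin.natAdd m j)
        (wheelBracketOf k Δ d (n := n + 1) a a') := by
  simp only [wheelBracketOf]
  rw [h.map_contr, contr_mul_right, contr_mul_right, contr_mul_right, h.map_contr]
  refine Eq.symm ((map_sub _ _ _).trans ?_)
  rw [LinearMap.map_negOnePow_smul]
  exact congrArg (· - _) (map_sub _ _ _)

end IsBVWheelgebra
end BVWheelgebras

/-! ### BV operators -/

section Generic

variable {k : Type u} [Field k] {R : Type*} [Ring R] [Algebra k R]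

/-- The bilinear map underlying `bracketOf`. -/
def bracketMap (Δ' : R →ₗ[k] R) (d : ℤ) : R →ₗ[k] R →ₗ[k] R :=
  (LinearMap.mul k R).compr₂ Δ' - LinearMap.mul k R ∘ₗ Δ' -
    (d.negOnePow : ℤ) • (LinearMap.mul k R).compl₂ Δ'

variable {V : Type v} [AddCommGroup V] [Module k V] {ι : Type*} [Fintype ι] [DecidableEq ι]
  {W : ℕ → Type w} [∀ m, AddCommGroup (W m)] [∀ m, Module k (W m)] [Wheelgebra k W]

/-- Matrix elements of an endomorphism of the wheelspace `W` give a compatible family. -/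
theorem isCompatFamily_entry_endomorphism (b : Module.Basis ι k V)
    (ev : WheelgebraHom k W (BaseChange k R (WEnd k V))) (T : ∀ m, W m →ₗ[k] W m)
    (hact : ∀ {m n : ℕ} (σ τ : Fin m ≃ Fin n) (a : W m),
      T n (act (k := k) σ τ a) = act (k := k) σ τ (T m a))
    (hcontr : ∀ {m : ℕ} (i j : Fin (m + 1)) (a : W (m + 1)),
      T m (contr (k := k) i j a) = contr (k := k) i j (T (m + 1) a)) :
    IsCompatFamily ∅ (fun m I J => ev.entry b I J ∘ₗ T m) where
  map_act σ τ a I J := by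
    simp only [LinearMap.comp_apply]
    rw [hact, ev.entry_act]
  map_contr i j a I J := by
    simp only [LinearMap.comp_apply]
    rw [hcontr, ev.entry_contr]
  map_unit t ht := ht.elim

end Generic

/-! ### The BV structure on the representation algebra -/

section BV

variable {k : Type u} [Field k] {V : Type v} [AddCommGroup V] [Module k V]
  [FiniteDimensional k V] {ι : Type v} [Fintype ι] [DecidableEq ι]
  {W : ℕ → Type w} [∀ m, AddCommGroup (W m)] [∀ m, Module k (W m)] [Wheelgebra k W]
  {U : Set (W 1)} {R : Type max u v w} [Ring R] [Algebra k R]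
  {ev : WheelgebraHom k W (BaseChange k R (WEnd k V))}
  {𝒢 : ℤ → ∀ m, Submodule k (W m)} {Δ : ∀ m, W m →ₗ[k] W m}

/-- Projections to homogeneous parts are endomorphisms of the wheelspace, and they commute with
multiplication by a wheeled unit because its degree is `0`. -/
theorem IsRepresentationAlgebra.exists_projections
    (hev : IsRepresentationAlgebra.{u, v, w, max u v w, max u v w} V U ev)
    (hU : ∀ t ∈ U, IsWheelUnit k t) (b : Module.Basis ι k V) (h : IsBVWheelgebra k 𝒢 Δ)
    {π : ℤ → ∀ m, W m →ₗ[k] W m} (hπ : IsGradedProjection 𝒢 π) (d : ℤ) :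
    ∃ p : R →ₗ[k] R, ∀ (m : ℕ) (I J : Fin m → ι) (a : W m),
      p (ev.entry b I J a) = ev.entry b I J (π d m a) := by
  have hrep := (isRepresentation_iff_entry b U ev).1 hev.1
  refine hev.exists_linearMap b ((isCompatFamily_entry_endomorphism b ev (π d)
    (fun σ τ a => h.proj_comm hπ _ (fun e x hx => h.act_mem σ τ hx) d a)
    (fun i j a => h.proj_comm hπ _ (fun e x hx => h.contr_mem i j hx) d a)).of_mul_unit (U := U)
    (fun t ht _ a => h.mul_comm_of_mem_zero (h.isWheelUnit_mem (hU t ht)) a)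
    fun t ht m a I J p q => ?_)
  have hmul := h.proj_comm hπ ((mul (k := k) (m := m) (n := 1)).flip t) (fun e x hx => by
    simpa using h.mul_mem hx (h.isWheelUnit_mem (hU t ht))) d a
  rw [LinearMap.flip_apply, LinearMap.flip_apply] at hmul
  simp only [LinearMap.comp_apply]
  rw [hmul, ev.entry_mul_append, hrep t ht, mul_ite, _root_.mul_one, mul_zero]

/-- The BV operator on the representation algebra, on matrix elements. -/
theorem IsRepresentationAlgebra.exists_operator
    (hev : IsRepresentationAlgebra.{u, v, w, max u v w, max u v w} V U ev)
    (hU : ∀ t ∈ U, IsWheelUnit k t) (b : Module.Basis ι k V) (h : IsBVWheelgebra k 𝒢 Δ) :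
    ∃ Δ' : R →ₗ[k] R, ∀ (m : ℕ) (I J : Fin m → ι) (a : W m),
      Δ' (ev.entry b I J a) = ev.entry b I J (Δ m a) := by
  have hrep := (isRepresentation_iff_entry b U ev).1 hev.1
  -- The bracket with `a` is a derivation in its second argument, and no sign arises on `t t` since
  -- `t` has degree `0`; so its matrix elements vanish on `t`.
  have bracket_unit {t : W 1} (ht : t ∈ U) {d : ℤ} {m : ℕ} {a : W m} (ha : a ∈ 𝒢 d m)
      (I J : Fin m → ι) (p q : Fin 1 → ι) :
      ev.entry b (Fin.append I p) (Fin.append J q) (wheelBracketOf k Δ d a t) = 0 := by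
    refine (isCompatFamily_entry_comp (b := b) ev (wheelBracketMap Δ d a)
      (fun σ τ a' => h.wheelBracketOf_act d σ τ a a')
      (fun i j a' => h.wheelBracketOf_contr d i j a a') I J).unit_eq_zero (hU t ht)
      (fun p q p' q' => ?_) p q
    simp only [LinearMap.comp_apply, wheelBracketMap_apply]
    rw [h.second_order t ha (h.isWheelUnit_mem (hU t ht)), mul_zero, Int.negOnePow_zero, one_smul,
      map_add, (ev.entry_leibniz _ _ t (wheelBracketOf k Δ d a t) I J p q p' q').1,
      (ev.entry_leibniz (wheelBracketOf k Δ d a t) t _ _ I J p q p' q').2, hrep t ht, hrep t ht,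
      mul_ite, _root_.mul_one, mul_zero, ite_mul, _root_.one_mul, zero_mul]
  have map_mul_unit {t : W 1} (ht : t ∈ U) {d : ℤ} {m : ℕ} {a : W m} (ha : a ∈ 𝒢 d m)
      (I J : Fin m → ι) (p q : Fin 1 → ι) :
      ev.entry b (Fin.append I p) (Fin.append J q) (Δ (m + 1) (mul (k := k) a t)) =
        (if p 0 = q 0 then ev.entry b I J (Δ m a) else 0) +
          d.negOnePow • (ev.entry b I J a * ev.entry b p q (Δ 1 t)) := by
    have h0 := bracket_unit ht ha I J p q
    rw [wheelBracketOf, map_sub, map_sub, LinearMap.map_negOnePow_smul, ev.entry_mul_append,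
      ev.entry_mul_append, hrep t ht, mul_ite, _root_.mul_one, mul_zero, sub_sub,
      sub_eq_zero] at h0
    exact h0
  have hf := isCompatFamily_entry_endomorphism b ev Δ h.map_act h.map_contr
  -- As the bracket of `t` with itself vanishes on matrix elements, `Δ` acts on `t t` as a
  -- derivation, and the same argument applies to `Δ` itself.
  have unit_eq_zero {t : W 1} (ht : t ∈ U) (p q : Fin 1 → ι) : ev.entry b p q (Δ 1 t) = 0 := by
    refine hf.unit_eq_zero (hU t ht) (fun p q p' q' => ?_) p q
    simp only [LinearMap.comp_apply]
    rw [map_mul_unit ht (h.isWheelUnit_mem (hU t ht)), Int.negOnePow_zero, one_smul, hrep t ht,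
      ite_mul, _root_.one_mul, zero_mul]
  refine hev.exists_linearMap b (hf.of_mul_unit (U := U)
    (fun t ht _ a => h.mul_comm_of_mem_zero (h.isWheelUnit_mem (hU t ht)) a)
    fun t ht m a I J p q => ?_)
  simp only [LinearMap.comp_apply]
  refine (h.isInternal m).homogeneous_induction (p := fun a =>
    ev.entry b (Fin.append I p) (Fin.append J q) (Δ (m + 1) (mul (k := k) a t)) =
      if p 0 = q 0 then ev.entry b I J (Δ m a) else 0) (fun d x hx => ?_)
    (fun x y hx hy => ?_) a
  · rw [map_mul_unit ht hx, unit_eq_zero ht, mul_zero, smul_zero, add_zero]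
  · rw [map_add, LinearMap.add_apply, map_add, map_add, hx, hy, map_add, map_add]
    split_ifs
    · rfl
    · exact add_zero 0

/-- The projections of `W` descend to `R`, which makes the spans independent; they exhaust `R`
because matrix elements of homogeneous elements span it. -/
theorem IsRepresentationAlgebra.isInternal_entrySpan
    (hev : IsRepresentationAlgebra.{u, v, w, max u v w, max u v w} V U ev)
    (hU : ∀ t ∈ U, IsWheelUnit k t) (b : Module.Basis ι k V) (h : IsBVWheelgebra k 𝒢 Δ) :
    DirectSum.IsInternal (fun d => entrySpan b ev (𝒢 d)) := by
  obtain ⟨π, hπ⟩ := h.exists_projections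
  choose p hp using hev.exists_projections hU b h hπ
  refine DirectSum.isInternal_of_projections p (fun d r hr => ?_) (fun d e he r hr => ?_) ?_
  · have := map_mem_of_mem_entrySpan (p d - LinearMap.id) ⊥ (fun m I J a ha => by
      rw [LinearMap.sub_apply, hp, hπ.eq_self ha, LinearMap.id_apply, sub_self]
      exact Submodule.zero_mem _) hr
    exact sub_eq_zero.1 ((Submodule.mem_bot k).1 this)
  · refine (Submodule.mem_bot k).1 (map_mem_of_mem_entrySpan (p d) ⊥ (fun m I J a ha => ?_) hr)
    rw [hp, hπ.eq_zero he ha, map_zero]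
    exact Submodule.zero_mem _
  · refine eq_top_iff.2 fun r _ => ?_
    refine hev.induction_on b (p := fun r => r ∈ ⨆ d, entrySpan b ev (𝒢 d)) (fun m I J a => ?_)
      (Submodule.zero_mem _) (fun r r' => Submodule.add_mem _) (fun c r => Submodule.smul_mem _ c) r
    refine (h.isInternal m).homogeneous_induction
      (p := fun a => ev.entry b I J a ∈ ⨆ d, entrySpan b ev (𝒢 d))
      (fun d x hx => Submodule.mem_iSup_of_mem d (entry_mem_entrySpan I J hx))
      (fun x y hx hy => by rw [map_add]; exact Submodule.add_mem _ hx hy) a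

theorem IsRepresentationAlgebra.isBVAlgebra
    (hev : IsRepresentationAlgebra.{u, v, w, max u v w, max u v w} V U ev)
    (hU : ∀ t ∈ U, IsWheelUnit k t) (b : Module.Basis ι k V) (h : IsBVWheelgebra k 𝒢 Δ)
    {Δ' : R →ₗ[k] R} (hΔ' : ∀ (m : ℕ) (I J : Fin m → ι) (a : W m),
      Δ' (ev.entry b I J a) = ev.entry b I J (Δ m a)) :
    IsBVAlgebra k (fun d => entrySpan b ev (𝒢 d)) Δ' where
  isInternal := hev.isInternal_entrySpan hU b h
  one_mem := by
    rw [← ev.entry_one b Fin.elim0 Fin.elim0]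
    exact entry_mem_entrySpan _ _ h.one_mem
  mul_mem := entrySpan_mul_mem h.mul_mem
  supercomm {d e r r'} hr hr' := by
    refine map₂_eq_of_mem_entrySpan (LinearMap.mul k R).flip
      (((d * e).negOnePow : ℤ) • LinearMap.mul k R) (fun m n I J I' J' a a' ha ha' => ?_) hr hr'
    change (_ : R) * _ = (d * e).negOnePow • ((_ : R) * _)
    rw [← ev.entry_mul_append, h.supercomm ha ha', LinearMap.map_negOnePow_smul,
      ev.entry_flip_mul]
  degree {d r} hr := by
    refine map_mem_of_mem_entrySpan Δ' _ (fun m I J a ha => ?_) hr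
    rw [hΔ']
    exact entry_mem_entrySpan _ _ (h.degree ha)
  square_zero r := by
    have : Δ' ∘ₗ Δ' = 0 := hev.linearMap_ext b fun m I J a => by
      rw [LinearMap.comp_apply, hΔ', hΔ', h.square_zero, map_zero, LinearMap.zero_apply]
    exact congrArg (fun T => T r) this
  second_order {d e r r'} r'' hr hr' := by
    let swap : (R →ₗ[k] R →ₗ[k] R) →ₗ[k] (R →ₗ[k] R →ₗ[k] R) := LinearMap.lflip.toLinearMap
    have entry_bracket {m n : ℕ} (I J : Fin m → ι) (I' J' : Fin n → ι) (a : W m) (a' : W n) :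
        bracketOf k Δ' d (ev.entry b I J a) (ev.entry b I' J' a') =
          ev.entry b (Fin.append I I') (Fin.append J J') (wheelBracketOf k Δ d a a') := by
      rw [bracketOf, ← ev.entry_mul_append, hΔ', hΔ', hΔ', ← ev.entry_mul_append,
        ← ev.entry_mul_append, ← LinearMap.map_negOnePow_smul, ← map_sub, ← map_sub,
        wheelBracketOf]
    let T₁ : R →ₗ[k] R →ₗ[k] R →ₗ[k] R :=
      (swap ∘ₗ (LinearMap.mul k R).compr₂ (bracketMap Δ' d).flip).flip
    let T₂ : R →ₗ[k] R →ₗ[k] R →ₗ[k] R := (bracketMap Δ' d).compr₂ (LinearMap.mul k R)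
    let T₃ : R →ₗ[k] R →ₗ[k] R →ₗ[k] R :=
      swap ∘ₗ (bracketMap Δ' d).compr₂ (LinearMap.mul k R).flip
    have := map₂_eq_of_mem_entrySpan T₁ (T₂ + (((d - 1) * e).negOnePow : ℤ) • T₃)
      (fun m n I J I' J' a a' ha ha' => hev.linearMap_ext b fun p I'' J'' a'' => by
        change bracketOf k Δ' d _ (_ * _) = bracketOf k Δ' d _ _ * _ +
          ((d - 1) * e).negOnePow • (_ * bracketOf k Δ' d _ _)
        rw [← ev.entry_mul_append, entry_bracket, entry_bracket, entry_bracket,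
          h.second_order a'' ha ha', map_add, LinearMap.map_negOnePow_smul,
          (ev.entry_leibniz _ _ a' (wheelBracketOf k Δ d a a'') I J I' J' I'' J'').1,
          (ev.entry_leibniz (wheelBracketOf k Δ d a a') a'' _ _ I J I' J' I'' J'').2]) hr hr'
    exact congrArg (fun T => T r'') this

theorem IsRepresentationAlgebra.existsUnique_bv
    (hev : IsRepresentationAlgebra.{u, v, w, max u v w, max u v w} V U ev)
    (hU : ∀ t ∈ U, IsWheelUnit k t) (h : IsBVWheelgebra k 𝒢 Δ) :
    ∃! p : (ℤ → Submodule k R) × (R →ₗ[k] R), IsBVAlgebra k p.1 p.2 ∧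
      (∀ (d : ℤ) (m : ℕ) (a : W m), a ∈ 𝒢 d m →
        ev.app m a ∈ BaseChange.sub k (WEnd k V) (p.1 d) m) ∧
      ∀ (m : ℕ) (a : W m),
        ev.app m (Δ m a) = BaseChange.map k (WEnd k V) p.2 m (ev.app m a) := by
  classical
  let b := Module.Free.chooseBasis k V
  obtain ⟨Δ', hΔ'⟩ := hev.exists_operator hU b h
  have hBV := hev.isBVAlgebra hU b h hΔ'
  refine ⟨(fun d => entrySpan b ev (𝒢 d), Δ'), ⟨hBV, fun d m a ha => ?_, fun m a => ?_⟩, ?_⟩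
  · rw [BaseChange.mem_sub_iff b]
    exact fun I J => entry_mem_entrySpan I J ha
  · rw [app_eq_map_iff_entry b]
    exact fun I J => (hΔ' m I J a).symm
  · rintro ⟨A, Δ''⟩ ⟨hA, hmem, hmap⟩
    refine Prod.ext ?_ (hev.linearMap_ext b fun m I J a => ?_)
    -- Preservation of degrees only gives an inclusion of gradings, but two internal gradings with
    -- one contained in the other are equal.
    · refine (hBV.isInternal.eq_of_le hA.isInternal fun d => Submodule.span_le.2 ?_).symm
      rintro _ ⟨m, I, J, a, ha, rfl⟩
      exact (BaseChange.mem_sub_iff b (A d) _).1 (hmem d m a ha) I J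
    · rw [hΔ']
      exact ((app_eq_map_iff_entry b Δ'' ev ev a (Δ m a)).1 (hmap m a) I J).symm

end BV

/-- The image of a morphism of wheelgebras is a sub-wheelgebra. -/
theorem WheelgebraHom.mem_range_of_wheelGenerated {k : Type u} [Field k] {W : ℕ → Type v}
    {W' : ℕ → Type w} [∀ m, AddCommGroup (W m)] [∀ m, Module k (W m)] [Wheelgebra k W]
    [∀ m, AddCommGroup (W' m)] [∀ m, Module k (W' m)] [Wheelgebra k W']
    (ρ : WheelgebraHom k W W') {m : ℕ} {y : W' m}
    (hy : WheelGenerated k (fun n => (LinearMap.range (ρ.app n) : Set (W' n))) m y) :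
    y ∈ LinearMap.range (ρ.app m) := by
  induction hy with
  | mem h => exact h
  | zero => exact Submodule.zero_mem _
  | add _ _ h h' => exact Submodule.add_mem _ h h'
  | smul c _ h => exact Submodule.smul_mem _ c h
  | act σ τ _ h =>
    obtain ⟨a, rfl⟩ := h
    exact ⟨_, ρ.map_act σ τ a⟩
  | contr i j _ h =>
    obtain ⟨a, rfl⟩ := h
    exact ⟨_, ρ.map_contr i j a⟩
  | one => exact ⟨_, ρ.map_one⟩
  | mul _ _ h h' =>
    obtain ⟨a, rfl⟩ := h
    obtain ⟨a', rfl⟩ := h'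
    exact ⟨_, ρ.map_mul a a'⟩

theorem theorem6 {k : Type u} [Field k] [CharZero k]
    (V : Type v) [AddCommGroup V] [Module k V] [FiniteDimensional k V]
    (W : ℕ → Type w) [∀ m, AddCommGroup (W m)] [∀ m, Module k (W m)] [Wheelgebra k W]
    (U : Set (W 1)) (hU : ∀ t ∈ U, IsWheelUnit k t) :
    -- the representation algebra exists
    (∃ (R : Type (max u v w)) (_ : Ring R) (_ : Algebra k R)
        (ev : WheelgebraHom k W (BaseChange k R (WEnd k V))),
      IsRepresentationAlgebra.{u, v, w, x, max u v w} V U ev) ∧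
    ∀ (R : Type (max u v w)) [Ring R] [Algebra k R]
      (ev : WheelgebraHom k W (BaseChange k R (WEnd k V))),
      IsRepresentationAlgebra.{u, v, w, max u v w, max u v w} V U ev →
      -- the action of `GL(V)` and the image of the evaluation morphism
      (∃ Θ : LinearMap.GeneralLinearGroup k V →* (R ≃ₐ[k] R),
        IsCompatibleAction V ev Θ ∧
        (∀ Θ' : LinearMap.GeneralLinearGroup k V →* (R ≃ₐ[k] R),
          IsCompatibleAction V ev Θ' → Θ' = Θ) ∧
        (U.Nonempty → ∀ (m : ℕ) (a : BaseChange k R (WEnd k V) m),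
          a ∈ LinearMap.range (ev.app m) ↔ IsGLInvariant V Θ a) ∧
        (∀ (m : ℕ) (a : BaseChange k R (WEnd k V) m),
          WheelGenerated k
              (fun n => (LinearMap.range (ev.app n) : Set (BaseChange k R (WEnd k V) n)) ∪
                identitySet k V R n) m a ↔
            IsGLInvariant V Θ a)) ∧
      -- commutative
      (IsCommWheelgebra k W → ∀ a b : R, a * b = b * a) ∧
      -- almost commutative
      (∀ F : ℕ → ∀ m, Submodule k (W m), IsAlmostCommWheelgebra k F →
        ∃ F' : ℕ → Submodule k R, IsAlmostCommAlgebra k F' ∧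
          IsLeast {G : ℕ → Submodule k R | ∀ (i m : ℕ) (a : W m), a ∈ F i m →
            ev.app m a ∈ BaseChange.sub k (WEnd k V) (G i) m} F') ∧
      -- Poisson
      (∀ br : ∀ m n : ℕ, W m →ₗ[k] W n →ₗ[k] W (m + n), IsPoissonWheelgebra k br →
        ∃! β : R →ₗ[k] R →ₗ[k] R, IsPoissonAlgebra k β ∧
          ∀ (m n : ℕ) (a : W m) (b : W n),
            ev.app (m + n) (br m n a b) =
              BaseChange.bilin k β Wheelgebra.mul (ev.app m a) (ev.app n b)) ∧
      -- BV
      (∀ (𝒢 : ℤ → ∀ m, Submodule k (W m)) (Δ : ∀ m, W m →ₗ[k] W m), IsBVWheelgebra k 𝒢 Δ →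
        ∃! p : (ℤ → Submodule k R) × (R →ₗ[k] R), IsBVAlgebra k p.1 p.2 ∧
          (∀ (d : ℤ) (m : ℕ) (a : W m), a ∈ 𝒢 d m →
            ev.app m a ∈ BaseChange.sub k (WEnd k V) (p.1 d) m) ∧
          ∀ (m : ℕ) (a : W m),
            ev.app m (Δ m a) = BaseChange.map k (WEnd k V) p.2 m (ev.app m a)) := by
  classical
  refine ⟨?_, ?_⟩
  · let b := Module.Free.chooseBasis k V
    exact ⟨_, inferInstance, inferInstance, RepAlgebra.ev b U,
      RepAlgebra.isRepresentationAlgebra_ev b U⟩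
  · intro R _ _ ev hev
    obtain ⟨Θ, hΘ, huniq⟩ := hev.exists_action
    refine ⟨⟨Θ, hΘ, huniq, fun hne m y => ⟨?_, fun hy => ?_⟩,
      fun m y => ⟨fun hy => ?_, fun hy => ?_⟩⟩,
      hev.mul_comm_of_isCommWheelgebra, fun F hF => hev.exists_filtration hF,
      fun br hbr => hev.existsUnique_bracket hU hbr, fun 𝒢 Δ h => hev.existsUnique_bv hU h⟩
    · rintro ⟨a, rfl⟩
      exact hΘ m a
    · obtain ⟨t, ht⟩ := hne
      -- Since `ev t` is the identity, the image of `ev` alone serves as generating set, and it is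
      -- already a sub-wheelgebra.
      exact ev.mem_range_of_wheelGenerated (hev.wheelGenerated_of_isGLInvariant hΘ
        (S := fun n => (LinearMap.range (ev.app n) : Set (BaseChange k R (WEnd k V) n)))
        ⟨t, hev.1 t ht⟩ (fun n a => ⟨a, rfl⟩) hy)
    · refine isGLInvariant_of_wheelGenerated Θ ?_ hy
      rintro n z (⟨a, rfl⟩ | hz)
      · exact hΘ n a
      · exact isGLInvariant_identitySet Θ n z hz
    · exact hev.wheelGenerated_of_isGLInvariant hΘ (Or.inr rfl) (fun n a => Or.inl ⟨a, rfl⟩) hy
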